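/- A $3$-spanner of a graph $G$ is a subgraph $H$ of $G$ on the same node set with $d_H(u,v)\le 3\,d_G(u,v)$ for all nodes $u,v$ (distances may be $\infty$). Consider an undirected, unweighted graph on $n$ nodes that is initially empty and undergoes a sequence of edge insertions and deletions; each insertion adds an edge that is not present and each deletion removes an edge that is present. The model of computation is the unit-cost word RAM with words of $\Theta(\log n)$ bits and with an instruction that draws an independent uniformly random word. The maintained graph $H$ is output explicitly: the algorithm reports every edge that enters or leaves $H$, one edge per time step. Theorem. For every $a\in\mathbb N$ there are a constant $C$, a constant $c\ge 1$, and a randomized fully dynamic algorithm (one program for all $n$, using words of $c(\lfloor\log_2 n\rfloor+1)$ bits) such that the following holds for every $n\ge 3$. (1) The setup of the algorithm for the empty graph on $n$ nodes takes at most $C n^2$ steps, for every outcome of the random choices. (2) Worst-case update time: for every update sequence of any length and every outcome of the random choices, the algorithm processes each single update within $C\, n^{3/4}\log^4 n$ steps. (3) Correctness with high probability against an oblivious adversary: for every update sequence of any length that is fixed independently of the random choices, and for every window of at most $n^a$ consecutive updates in it, with probability at least $1-n^{-a}$ the following holds at the start of the window and after every update in it: the graph $H$ maintained by the algorithm is a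 $3$-spanner of the current graph, and $H$ has at most $C\, n^{3/2}\,\log^{1/2} n\,\log\log n$ edges. -/

import Mathlib

namespace DynSpanner

open MeasureTheory

/-! ## Graphs, spanners and update sequences -/

/-- `H` is an `α`-spanner of `G`: a subgraph on the same nodes with
`d_H(u, v) ≤ α * d_G(u, v)` for all nodes; distances are in `ℕ ∪ {∞}`. -/
def IsSpanner {V : Type*} (α : ℕ) (G H : SimpleGraph V) : Prop :=
  H ≤ G ∧ ∀ u v : V, H.edist u v ≤ (α : ℕ∞) * G.edist u v

/-- A single update of a graph on the nodes `0, …, n - 1`. -/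
inductive Update (n : ℕ) where
  | insert (u v : Fin n) : Update n
  | delete (u v : Fin n) : Update n

/-- An insertion must insert a new edge, a deletion must delete an existing one. -/
def Update.Legal {n : ℕ} (G : SimpleGraph (Fin n)) : Update n → Prop
  | .insert u v => u ≠ v ∧ ¬ G.Adj u v
  | .delete u v => G.Adj u v

/-- The graph after one update. -/
def Update.perform {n : ℕ} (G : SimpleGraph (Fin n)) : Update n → SimpleGraph (Fin n)
  | .insert u v => G ⊔ SimpleGraph.edge u v
  | .delete u v => G.deleteEdges {s(u, v)}

/-- The graph after a sequence of updates, starting from the empty graph. -/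
def graphAfter {n : ℕ} (σ : List (Update n)) : SimpleGraph (Fin n) :=
  σ.foldl Update.perform ⊥

/-- Every update of the sequence is legal at the time at which it is issued. -/
def LegalSeq {n : ℕ} (σ : List (Update n)) : Prop :=
  ∀ (ρ : List (Update n)) (e : Update n), ρ ++ [e] <+: σ → e.Legal (graphAfter ρ)

/-! ## A randomized word RAM with unit-cost instructions

Registers and memory cells hold words, i.e. numbers below `2 ^ w`.  A program is a finite structured
program; every instruction, and every evaluation of the guard of a conditional or of a loop, costs
one time step.  Random words are read from a tape `ω`, whose entries will be independent and
uniform.  The maintained subgraph is output explicitly: the program reports each edge that enters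
or leaves it, one edge per time step. -/

/-- Binary operations on words. -/
inductive Op where
  | add | sub | mul | div | mod | lt | eq

/-- Addition and multiplication are modulo `2 ^ w`, subtraction is truncated at `0`, division rounds
down, and comparisons return `1` for true and `0` for false. -/
def Op.eval (w : ℕ) : Op → ℕ → ℕ → ℕ
  | .add, x, y => (x + y) % 2 ^ w
  | .sub, x, y => x - y
  | .mul, x, y => (x * y) % 2 ^ w
  | .div, x, y => x / y
  | .mod, x, y => x % y
  | .lt, x, y => if x < y then 1 else 0
  | .eq, x, y => if x = y then 1 else 0

/-- Programs.  Apart from the constant in `const`, all numbers are names of registers. -/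
inductive Prog where
  /-- Do nothing. -/
  | skip : Prog
  /-- `R[r] := k`. -/
  | const (r k : ℕ) : Prog
  /-- `R[r] := R[x] o R[y]`. -/
  | binop (o : Op) (r x y : ℕ) : Prog
  /-- `R[r] := M[R[x]]`. -/
  | load (r x : ℕ) : Prog
  /-- `M[R[x]] := R[y]`. -/
  | store (x y : ℕ) : Prog
  /-- `R[r] :=` a fresh random word. -/
  | rand (r : ℕ) : Prog
  /-- Report that the edge between the nodes `R[x]` and `R[y]` enters the maintained subgraph. -/
  | addEdge (x y : ℕ) : Prog
  /-- Report that the edge between the nodes `R[x]` and `R[y]` leaves the maintained subgraph. -/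
  | removeEdge (x y : ℕ) : Prog
  /-- Run `p`, then `q`. -/
  | seq (p q : Prog) : Prog
  /-- If `R[r] ≠ 0` run `p`, else run `q`. -/
  | cond (r : ℕ) (p q : Prog) : Prog
  /-- While `R[r] ≠ 0` run `p`. -/
  | loop (r : ℕ) (p : Prog) : Prog

/-- Configurations: registers, memory, the subgraph reported so far, and the number of random words
used so far. -/
structure Config where
  reg : ℕ → ℕ
  mem : ℕ → ℕ
  out : Set (Sym2 ℕ)
  pos : ℕ

/-- Assignment to a register. -/
def Config.setReg (s : Config) (r x : ℕ) : Config :=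
  { s with reg := Function.update s.reg r x }

/-- `Exec w ω p s s' t`: started in configuration `s`, the program `p`, with word length `w` and
random tape `ω`, halts in configuration `s'` after exactly `t` time steps.  (The rules are
deterministic: `s'` and `t` are determined by the other arguments.) -/
inductive Exec (w : ℕ) (ω : ℕ → Fin (2 ^ w)) : Prog → Config → Config → ℕ → Prop
  | skip (s : Config) : Exec w ω .skip s s 0
  | const (s : Config) (r k : ℕ) :
      Exec w ω (.const r k) s (s.setReg r (k % 2 ^ w)) 1
  | binop (s : Config) (o : Op) (r x y : ℕ) :
      Exec w ω (.binop o r x y) s (s.setReg r (o.eval w (s.reg x) (s.reg y))) 1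
  | load (s : Config) (r x : ℕ) :
      Exec w ω (.load r x) s (s.setReg r (s.mem (s.reg x))) 1
  | store (s : Config) (x y : ℕ) :
      Exec w ω (.store x y) s
        { s with mem := Function.update s.mem (s.reg x) (s.reg y) } 1
  | rand (s : Config) (r : ℕ) :
      Exec w ω (.rand r) s { s.setReg r (ω s.pos) with pos := s.pos + 1 } 1
  | addEdge (s : Config) (x y : ℕ) :
      Exec w ω (.addEdge x y) s { s with out := s.out ∪ {s(s.reg x, s.reg y)} } 1
  | removeEdge (s : Config) (x y : ℕ) :
      Exec w ω (.removeEdge x y) s { s with out := s.out \ {s(s.reg x, s.reg y)} } 1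
  | seq {p q : Prog} {s s' s'' : Config} {t t' : ℕ} :
      Exec w ω p s s' t → Exec w ω q s' s'' t' → Exec w ω (.seq p q) s s'' (t + t')
  | cond_true {r : ℕ} {p q : Prog} {s s' : Config} {t : ℕ} :
      s.reg r ≠ 0 → Exec w ω p s s' t → Exec w ω (.cond r p q) s s' (t + 1)
  | cond_false {r : ℕ} {p q : Prog} {s s' : Config} {t : ℕ} :
      s.reg r = 0 → Exec w ω q s s' t → Exec w ω (.cond r p q) s s' (t + 1)
  | loop_true {r : ℕ} {p : Prog} {s s' s'' : Config} {t t' : ℕ} :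
      s.reg r ≠ 0 → Exec w ω p s s' t → Exec w ω (.loop r p) s' s'' t' →
        Exec w ω (.loop r p) s s'' (t + t' + 1)
  | loop_false {r : ℕ} {p : Prog} {s : Config} :
      s.reg r = 0 → Exec w ω (.loop r p) s s 1

/-! ## Fully dynamic algorithms -/

/-- A fully dynamic graph algorithm: a program that is run once, for the empty graph, and a program
that is run once for every update.  The same two programs serve every number `n` of nodes. -/
structure DynAlg where
  setup : Prog
  update : Prog

/-- Word length `Θ(log n)`: `c` times the number of binary digits of `n`. -/
def wordLength (c n : ℕ) : ℕ := c * (Nat.log 2 n + 1)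

/-- The initial configuration for graphs with `n` nodes: `n` is in register `0`, and everything
else is blank. -/
def Config.start (n : ℕ) : Config where
  reg := Function.update (fun _ => 0) 0 n
  mem := fun _ => 0
  out := ∅
  pos := 0

/-- Present an update to the algorithm: its kind (`1` for an insertion, `0` for a deletion) and the
two end nodes are written to registers `1`, `2`, `3`. -/
def Config.feed {n : ℕ} (s : Config) : Update n → Config
  | .insert u v => ((s.setReg 1 1).setReg 2 u).setReg 3 v
  | .delete u v => ((s.setReg 1 0).setReg 2 u).setReg 3 v

/-- The subgraph of the complete graph on `0, …, n - 1` that is currently maintained. -/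
def Config.outputGraph (s : Config) (n : ℕ) : SimpleGraph (Fin n) where
  Adj u v := u ≠ v ∧ s(u.val, v.val) ∈ s.out
  symm := ⟨fun _ _ h => ⟨h.1.symm, by rw [Sym2.eq_swap]; exact h.2⟩⟩
  loopless := ⟨fun _ h => h.1 rfl⟩

/-- `Reaches A c n ω σ s`: with random tape `ω`, the algorithm `A` is in configuration `s` after it
has processed the update sequence `σ`. -/
inductive Reaches (A : DynAlg) (c n : ℕ) (ω : ℕ → Fin (2 ^ wordLength c n)) :
    List (Update n) → Config → Prop
  | start {s : Config} {t : ℕ} :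
      Exec (wordLength c n) ω A.setup (Config.start n) s t → Reaches A c n ω [] s
  | step {σ : List (Update n)} {e : Update n} {s s' : Config} {t : ℕ} :
      Reaches A c n ω σ s → Exec (wordLength c n) ω A.update (s.feed e) s' t →
        Reaches A c n ω (σ ++ [e]) s'

/-- For every random tape, the setup halts within `T` steps. -/
def SetupTimeAtMost (A : DynAlg) (c n : ℕ) (T : ℝ) : Prop :=
  ∀ ω : ℕ → Fin (2 ^ wordLength c n), ∃ (s : Config) (t : ℕ),
    Exec (wordLength c n) ω A.setup (Config.start n) s t ∧ (t : ℝ) ≤ T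

/-- Worst-case update time: for every random tape and every legal update sequence of any length,
the processing of each single update halts within `T` steps. -/
def UpdateTimeAtMost (A : DynAlg) (c n : ℕ) (T : ℝ) : Prop :=
  ∀ (ω : ℕ → Fin (2 ^ wordLength c n)) (σ : List (Update n)) (e : Update n),
    LegalSeq (σ ++ [e]) → ∀ s : Config, Reaches A c n ω σ s →
      ∃ (s' : Config) (t : ℕ),
        Exec (wordLength c n) ω A.update (s.feed e) s' t ∧ (t : ℝ) ≤ T

/-- The law of the random tape: independent uniformly distributed words. -/
noncomputable def tapeMeasure (w : ℕ) : Measure (ℕ → Fin (2 ^ w)) :=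
  Measure.infinitePi fun _ : ℕ => (PMF.uniformOfFintype (Fin (2 ^ w))).toMeasure

/-- After the update sequence `σ` the algorithm fails on the tape `ω` if the maintained graph is
not an `α`-spanner of the current graph or has more than `S` edges. -/
def FailsAfter (A : DynAlg) (c n α : ℕ) (S : ℝ) (ω : ℕ → Fin (2 ^ wordLength c n))
    (σ : List (Update n)) : Prop :=
  ∃ s : Config, Reaches A c n ω σ s ∧
    ¬ (IsSpanner α (graphAfter σ) (s.outputGraph n) ∧
        ((s.outputGraph n).edgeSet.ncard : ℝ) ≤ S)

/-- Against an oblivious adversary (the updates are fixed before the random tape is drawn), in every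
window of at most `N` consecutive updates of a legal update sequence of any length, `A` maintains an
`α`-spanner with at most `S` edges throughout the window, with failure probability at most `n⁻ᵃ`. -/
def MaintainsSpannerWHP (A : DynAlg) (c n α : ℕ) (S : ℝ) (N a : ℕ) : Prop :=
  ∀ σ τ : List (Update n), LegalSeq (σ ++ τ) → τ.length ≤ N →
    tapeMeasure (wordLength c n)
      {ω | ∃ τ' : List (Update n), τ' <+: τ ∧ FailsAfter A c n α S ω (σ ++ τ')} ≤
        ((n : ENNReal) ^ a)⁻¹

end DynSpanner

/-! About `√(n log n)` centers are drawn at random once, during the setup, and never redrawn. The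
maintained graph contains every edge at a center. Every other edge becomes an arc from its smaller
to its larger end node. The arcs into a node `v` are numbered by their positions in an array list
and cut into blocks of length `L`, a constant times `√(n log n)`. Block `j` is assigned to the
`j`-th center in the list of centers adjacent to `v`; once these are used up, the remaining arcs get
the dummy label `n + v`. For every node `u` and label `c`, the arcs out of `u` with label `c` form a
list, and the first arc of each nonempty list is kept.

Stretch (`GraphInv.isSpanner`): if `(u, v)` has a center `c` as its label and `(u, v')` is the first
arc of its list, then `v` and `v'` are both adjacent to `c`, and `u, v', c, v` is a path of kept
edges. A dummy label determines `v`, so such an arc is alone in its list and is kept itself. This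
holds for every outcome of the random choices.

Size (`GraphInv.ncard_edgeSet_le`): the edges at centers and the arcs kept for center labels number
at most `n` per center each. At most `L` arcs into `v` have a dummy label as soon as `v` has fewer
than `L` times (adjacent centers plus one) neighbors. To see that this is likely, cut the
neighborhood into fixed blocks of length `L`; each block misses all centers with probability at most
`n⁻ᵇ` (`prob_disjoint_centers_le`), and if none does, the count follows (`card_lt_of_blocks`). The
adversary is oblivious, so the neighborhoods in a window are fixed before the draw, and a union
bound over times, nodes and blocks finishes (`prob_fails_le`). The number of updates before the
window plays no role.

Time: labels depend only on positions, and deletion from an array list moves just the last element.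
So an update of an arc disturbs one position, and a change in a list of centers disturbs one or two
blocks, that is `O(L)` arcs, each refiled in constant time with a constant number of output changes.
The update time is thus `O(√(n log n))`, and the size has no `log log n` factor: both claimed bounds
leave slack.

The RAM programs are compiled from a language whose loops count from one register that is never
overwritten, which makes running times of unnested loops linear in that register
(`Stm.exec_compile`, `Stm.cost_le_of_flat`). Since execution is deterministic (`Exec.unique`), every
reachable configuration satisfies the invariant (`Reaches.graphInv`). -/

namespace DynSpanner

open MeasureTheory

/-! ## A small language with counted loops, compiled to word RAM programs -/

/-- Expressions over registers and memory. -/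
inductive Expr where
  | reg (x : ℕ) : Expr
  | lit (k : ℕ) : Expr
  | bin (o : Op) (a b : Expr) : Expr
  | get (a : Expr) : Expr

namespace Expr

/-- The value of an expression in a configuration. -/
def eval (w : ℕ) (s : Config) : Expr → ℕ
  | reg x => s.reg x
  | lit k => k % 2 ^ w
  | bin o a b => o.eval w (a.eval w s) (b.eval w s)
  | get a => s.mem (a.eval w s)

/-- Code that leaves the value of the expression in register `r`, overwriting only registers from
`r` on. -/
def compile : Expr → ℕ → Prog
  | reg x, r => .seq (.const r 0) (.binop .sub r x r)
  | lit k, r => .const r k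
  | bin o a b, r => .seq (a.compile r) (.seq (b.compile (r + 1)) (.binop o r r (r + 1)))
  | get a, r => .seq (a.compile r) (.load r r)

/-- The running time of the compiled expression. -/
def cost : Expr → ℕ
  | reg _ => 2
  | lit _ => 1
  | bin _ a b => a.cost + (b.cost + 1)
  | get a => a.cost + 1

/-- The expression mentions only variables, i.e. registers below `100`. -/
def ok : Expr → Bool
  | reg x => decide (x < 100)
  | lit _ => true
  | bin _ a b => a.ok && b.ok
  | get a => a.ok

end Expr

/-- Agreement of configurations up to the scratch registers, which are those from `100` on. -/
structure Config.Sim (s h : Config) : Prop where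
  reg : ∀ r < 100, s.reg r = h.reg r
  mem : s.mem = h.mem
  out : s.out = h.out
  pos : s.pos = h.pos

theorem Config.Sim.refl (s : Config) : s.Sim s := ⟨fun _ _ => rfl, rfl, rfl, rfl⟩

theorem Config.Sim.setScratch {s h : Config} (H : s.Sim h) {r : ℕ} (hr : 100 ≤ r) (x : ℕ) :
    (s.setReg r x).Sim h :=
  ⟨fun q hq => by
    rw [← H.reg q hq]; simp [Config.setReg, Function.update_of_ne (show q ≠ r by omega)],
    H.mem, H.out, H.pos⟩

theorem Config.Sim.setReg {s h : Config} (H : s.Sim h) (r x : ℕ) :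
    (s.setReg r x).Sim (h.setReg r x) :=
  ⟨fun q hq => by
    by_cases e : q = r
    · subst e; simp [Config.setReg]
    · simp [Config.setReg, Function.update_of_ne e, H.reg q hq],
    H.mem, H.out, H.pos⟩

@[simp] theorem Config.setReg_reg (s : Config) (r x q : ℕ) :
    (s.setReg r x).reg q = if q = r then x else s.reg q := by
  simp [Config.setReg, Function.update_apply]

@[simp] theorem Config.setReg_mem (s : Config) (r x : ℕ) : (s.setReg r x).mem = s.mem := rfl

@[simp] theorem Config.setReg_out (s : Config) (r x : ℕ) : (s.setReg r x).out = s.out := rfl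

@[simp] theorem Config.setReg_pos (s : Config) (r x : ℕ) : (s.setReg r x).pos = s.pos := rfl

/-- Expressions read only registers below `100` and write only from `r ≥ 100` on, so evaluation is
invisible up to `Sim`. The second operand is evaluated in `r + 1`, which protects the first one in
`r`. -/
theorem Expr.exec_compile (w : ℕ) (ω : ℕ → Fin (2 ^ w)) (e : Expr) (he : e.ok = true) :
    ∀ (r : ℕ) (s h : Config), 100 ≤ r → s.Sim h →
      ∃ s', Exec w ω (e.compile r) s s' e.cost ∧ s'.Sim h ∧ (∀ q < r, s'.reg q = s.reg q) ∧
        s'.reg r = e.eval w h := by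
  induction e with
  | reg x =>
    intro r s h hr H
    have hx : x < 100 := by simpa [Expr.ok] using he
    -- A register is copied by subtracting `0`: unlike addition, subtraction does not reduce modulo
    -- `2 ^ w`, so the copy is exact for every value.
    refine ⟨_, .seq (.const _ _ _) (.binop _ _ _ _ _),
      (H.setScratch hr _).setScratch hr _, fun q hq => ?_, ?_⟩
    · simp [hq.ne]
    · have : x ≠ r := by omega
      simp [this, Op.eval, Expr.eval, H.reg x hx]
  | lit k =>
    intro r s h hr H
    refine ⟨_, .const _ _ _, H.setScratch hr _, fun q hq => ?_, ?_⟩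
    · simp [hq.ne]
    · simp [Expr.eval]
  | bin o a b iha ihb =>
    intro r s h hr H
    simp only [Expr.ok, Bool.and_eq_true] at he
    obtain ⟨s1, h1, H1, f1, v1⟩ := iha he.1 r s h hr H
    obtain ⟨s2, h2, H2, f2, v2⟩ := ihb he.2 (r + 1) s1 h (by omega) H1
    refine ⟨_, .seq h1 (.seq h2 (.binop _ _ _ _ _)), H2.setScratch hr _, fun q hq => ?_, ?_⟩
    · simp [hq.ne, f2 q (by omega), f1 q hq]
    · simp [v2, f2 r (by omega), v1, Expr.eval]
  | get a iha =>
    intro r s h hr H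
    obtain ⟨s1, h1, H1, f1, v1⟩ := iha he r s h hr H
    refine ⟨_, .seq h1 (.load _ _ _), H1.setScratch hr _, fun q hq => ?_, ?_⟩
    · simp [hq.ne, f1 q hq]
    · simp [v1, H1.mem, Expr.eval]

/-- Statements. -/
inductive Stm where
  /-- Assign the value of an expression to a register. -/
  | set (x : ℕ) (e : Expr) : Stm
  /-- Write to memory. -/
  | put (a e : Expr) : Stm
  | rand (x : ℕ) : Stm
  | addEdge (a b : Expr) : Stm
  | removeEdge (a b : Expr) : Stm
  | seq (p q : Stm) : Stm
  | ite (e : Expr) (p q : Stm) : Stm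
  /-- Run `p` with `R[x] = R[y], R[y] - 1, …, 1`. -/
  | rep (x y : ℕ) (p : Stm) : Stm
  | skip : Stm

/-- The effect of a counted loop over register `x` with body `f`. -/
def countdown (x : ℕ) (f : Config → Config) : ℕ → Config → Config
  | 0, s => s.setReg x 0
  | j + 1, s => countdown x f j (f (s.setReg x (j + 1)))

namespace Stm

/-- The effect of a statement. -/
def run (w : ℕ) (ω : ℕ → Fin (2 ^ w)) : Stm → Config → Config
  | set x e, s => s.setReg x (e.eval w s)
  | put a e, s => { s with mem := Function.update s.mem (a.eval w s) (e.eval w s) }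
  | rand x, s => { s.setReg x (ω s.pos) with pos := s.pos + 1 }
  | addEdge a b, s => { s with out := s.out ∪ {s(a.eval w s, b.eval w s)} }
  | removeEdge a b, s => { s with out := s.out \ {s(a.eval w s, b.eval w s)} }
  | seq p q, s => q.run w ω (p.run w ω s)
  | ite e p q, s => if e.eval w s ≠ 0 then p.run w ω s else q.run w ω s
  | rep x y p, s => countdown x (p.run w ω) (s.reg y) s
  | skip, s => s

/-- The RAM program of a statement. -/
def compile : Stm → Prog
  | set x e => .seq (e.compile 100) (.seq (.const 101 0) (.binop .sub x 100 101))
  | put a e => .seq (a.compile 100) (.seq (e.compile 101) (.store 100 101))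
  | rand x => .rand x
  | addEdge a b => .seq (a.compile 100) (.seq (b.compile 101) (.addEdge 100 101))
  | removeEdge a b => .seq (a.compile 100) (.seq (b.compile 101) (.removeEdge 100 101))
  | seq p q => .seq p.compile q.compile
  | ite e p q => .seq (e.compile 100) (.cond 100 p.compile q.compile)
  | rep x y p => .seq (.seq (.const 100 0) (.binop .sub x y 100))
      (.loop x (.seq p.compile (.seq (.const 100 1) (.binop .sub x x 100))))
  | skip => .skip

/-- The registers assigned to. -/
def writes : Stm → List ℕ
  | set x _ => [x]
  | rand x => [x]
  | seq p q => p.writes ++ q.writes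
  | ite _ p q => p.writes ++ q.writes
  | rep x _ p => x :: p.writes
  | _ => []

/-- All loops count from the value of register `z`, which is never assigned to, and
loop variables are not assigned to in the loop. -/
def ok (z : ℕ) : Stm → Bool
  | set x e => decide (x < 100) && decide (x ≠ z) && e.ok
  | put a e => a.ok && e.ok
  | rand x => decide (x < 100) && decide (x ≠ z)
  | addEdge a b => a.ok && b.ok
  | removeEdge a b => a.ok && b.ok
  | seq p q => p.ok z && q.ok z
  | ite e p q => e.ok && p.ok z && q.ok z
  | rep x y p => decide (x < 100) && decide (x ≠ z) && decide (y = z) && decide (z < 100) &&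
      decide (x ∉ p.writes) && p.ok z
  | skip => true

/-- A bound for the running time if loops are run at most `B` times. -/
def cost (B : ℕ) : Stm → ℕ
  | set _ e => e.cost + 2
  | put a e => a.cost + e.cost + 1
  | rand _ => 1
  | addEdge a b => a.cost + b.cost + 1
  | removeEdge a b => a.cost + b.cost + 1
  | seq p q => p.cost B + q.cost B
  | ite e p q => e.cost + max (p.cost B) (q.cost B) + 1
  | rep _ _ p => B * (p.cost B + 3) + 3
  | skip => 0

/-- There are no loops. -/
def loopFree : Stm → Bool
  | seq p q => p.loopFree && q.loopFree
  | ite _ p q => p.loopFree && q.loopFree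
  | rep _ _ _ => false
  | _ => true

/-- There are no nested loops. -/
def flat : Stm → Bool
  | seq p q => p.flat && q.flat
  | ite _ p q => p.flat && q.flat
  | rep _ _ p => p.loopFree
  | _ => true

/-! ### Running time and correctness of compiled statements -/

theorem cost_of_loopFree (B : ℕ) (p : Stm) (h : p.loopFree = true) : p.cost B = p.cost 1 := by
  induction p with
  | seq p q ihp ihq =>
    simp only [loopFree, Bool.and_eq_true] at h
    simp [cost, ihp h.1, ihq h.2]
  | ite e p q ihp ihq =>
    simp only [loopFree, Bool.and_eq_true] at h
    simp [cost, ihp h.1, ihq h.2]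
  | rep => simp [loopFree] at h
  | _ => rfl

/-- Without nesting, a loop multiplies a cost independent of `B` by `B`. This turns the cost of a
concrete program into a constant times its loop bound. -/
theorem cost_le_of_flat (B : ℕ) (p : Stm) (h : p.flat = true) :
    p.cost B ≤ p.cost 1 * (B + 1) := by
  induction p with
  | seq p q ihp ihq =>
    simp only [flat, Bool.and_eq_true] at h
    have h1 := ihp h.1
    have h2 := ihq h.2
    simp only [cost]
    nlinarith
  | ite e p q ihp ihq =>
    simp only [flat, Bool.and_eq_true] at h
    have h1 := ihp h.1
    have h2 := ihq h.2
    have h3 : max (p.cost B) (q.cost B) ≤ max (p.cost 1) (q.cost 1) * (B + 1) :=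
      max_le (h1.trans (Nat.mul_le_mul_right _ (le_max_left _ _)))
        (h2.trans (Nat.mul_le_mul_right _ (le_max_right _ _)))
    simp only [cost]
    nlinarith
  | rep x y p _ =>
    simp only [flat] at h
    simp only [cost, cost_of_loopFree B p h]
    nlinarith
  | _ => simp only [cost]; nlinarith

/-- The frame rule: registers are carried across a subprogram by inspecting its finite list of
written registers. -/
theorem run_reg_of_notMem (w : ℕ) (ω : ℕ → Fin (2 ^ w)) {z : ℕ} (p : Stm) :
    ∀ s : Config, z ∉ p.writes → (p.run w ω s).reg z = s.reg z := by
  induction p with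
  | set x e => intro s h; simp [writes] at h; simp [run, h]
  | rand x => intro s h; simp [writes] at h; simp [run, h]
  | seq p q ihp ihq =>
    intro s h; simp [writes] at h; simp [run, ihq _ h.2, ihp _ h.1]
  | ite e p q ihp ihq =>
    intro s h; simp [writes] at h
    simp only [run]
    split
    · exact ihp _ h.1
    · exact ihq _ h.2
  | rep x y p ih =>
    intro s h
    simp [writes] at h
    simp only [run]
    generalize s.reg y = j
    induction j generalizing s with
    | zero => simp [countdown, h.1]
    | succ j IH => simp [countdown, IH, ih _ h.2, h.1]
  | _ => intro s h; rfl

theorem notMem_writes_of_ok {z : ℕ} (p : Stm) (h : p.ok z = true) : z ∉ p.writes := by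
  induction p with
  | set x e => simp [ok] at h; simp [writes]; grind
  | rand x => simp [ok] at h; simp [writes]; grind
  | seq p q ihp ihq => simp [ok] at h; simp [writes, ihp h.1, ihq h.2]
  | ite e p q ihp ihq => simp [ok] at h; simp [writes, ihp h.1.2, ihq h.2]
  | rep x y p ih => simp [ok] at h; simp [writes, ih h.2]; grind
  | _ => simp [writes]

/-- The semantics `run` is a total function, so the compiled program always halts. Register `z` is
never written, hence its bound `B` survives every subprogram and limits the number of iterations of
each loop. -/
theorem exec_compile (w : ℕ) (hw : 0 < w) (ω : ℕ → Fin (2 ^ w)) (z B : ℕ) (p : Stm)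
    (hp : p.ok z = true) :
    ∀ s h : Config, s.Sim h → h.reg z ≤ B →
      ∃ s' t, Exec w ω p.compile s s' t ∧ s'.Sim (p.run w ω h) ∧ t ≤ p.cost B := by
  induction p with
  | set x e =>
    intro s h H _
    simp [ok] at hp
    obtain ⟨s1, h1, H1, f1, v1⟩ := e.exec_compile w ω hp.2 100 s h le_rfl H
    refine ⟨_, _, .seq h1 (.seq (.const _ _ _) (.binop _ _ _ _ _)), ?_, ?_⟩
    · simpa [Op.eval, v1, run] using (H1.setScratch (r := 101) (by omega) _).setReg x _
    · simp [cost]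
  | put a e =>
    intro s h H _
    simp [ok] at hp
    obtain ⟨s1, h1, H1, f1, v1⟩ := a.exec_compile w ω hp.1 100 s h le_rfl H
    obtain ⟨s2, h2, H2, f2, v2⟩ := e.exec_compile w ω hp.2 101 s1 h (by omega) H1
    refine ⟨_, _, .seq h1 (.seq h2 (.store _ _ _)), ⟨H2.reg, ?_, H2.out, H2.pos⟩, ?_⟩
    · simp [v2, f2 100 (by omega), v1, run, H2.mem]
    · simp [cost]; omega
  | addEdge a e =>
    intro s h H _
    simp [ok] at hp
    obtain ⟨s1, h1, H1, f1, v1⟩ := a.exec_compile w ω hp.1 100 s h le_rfl H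
    obtain ⟨s2, h2, H2, f2, v2⟩ := e.exec_compile w ω hp.2 101 s1 h (by omega) H1
    refine ⟨_, _, .seq h1 (.seq h2 (.addEdge _ _ _)), ⟨H2.reg, H2.mem, ?_, H2.pos⟩, ?_⟩
    · simp only [v2, f2 100 (by omega), v1, run, H2.out]
    · simp [cost]; omega
  | removeEdge a e =>
    intro s h H _
    simp [ok] at hp
    obtain ⟨s1, h1, H1, f1, v1⟩ := a.exec_compile w ω hp.1 100 s h le_rfl H
    obtain ⟨s2, h2, H2, f2, v2⟩ := e.exec_compile w ω hp.2 101 s1 h (by omega) H1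
    refine ⟨_, _, .seq h1 (.seq h2 (.removeEdge _ _ _)), ⟨H2.reg, H2.mem, ?_, H2.pos⟩, ?_⟩
    · simp only [v2, f2 100 (by omega), v1, run, H2.out]
    · simp [cost]; omega
  | rand x =>
    intro s h H _
    refine ⟨_, _, .rand _ _, ?_, le_rfl⟩
    have := H.setReg x (ω s.pos)
    rw [H.pos] at this
    exact ⟨by rw [H.pos]; exact this.reg, this.mem, this.out, by simp [run, H.pos]⟩
  | seq p q ihp ihq =>
    intro s h H hB
    simp [ok] at hp
    obtain ⟨s1, t1, h1, H1, c1⟩ := ihp hp.1 s h H hB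
    obtain ⟨s2, t2, h2, H2, c2⟩ := ihq hp.2 s1 _ H1
      (by rwa [run_reg_of_notMem w ω p h (notMem_writes_of_ok p hp.1)])
    exact ⟨s2, _, .seq h1 h2, H2, by simp only [cost]; omega⟩
  | ite e p q ihp ihq =>
    intro s h H hB
    simp [ok] at hp
    obtain ⟨s1, h1, H1, f1, v1⟩ := e.exec_compile w ω hp.1.1 100 s h le_rfl H
    by_cases hv : e.eval w h ≠ 0
    · obtain ⟨s2, t2, h2, H2, c2⟩ := ihp hp.1.2 s1 _ H1 hB
      refine ⟨s2, _, .seq h1 (.cond_true (by rwa [v1]) h2), by simpa [run, hv] using H2, ?_⟩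
      simp only [cost]; have := le_max_left (p.cost B) (q.cost B); omega
    · obtain ⟨s2, t2, h2, H2, c2⟩ := ihq hp.2 s1 _ H1 hB
      rw [not_not] at hv
      refine ⟨s2, _, .seq h1 (.cond_false (by rwa [v1]) h2), by simpa [run, hv] using H2, ?_⟩
      simp only [cost]; have := le_max_right (p.cost B) (q.cost B); omega
  | rep x y p ih =>
    intro s h H hB
    simp [ok] at hp
    obtain ⟨⟨⟨⟨⟨hx, hxz⟩, rfl⟩, hy⟩, hxp⟩, hp⟩ := hp
    -- Induction on the number `j` of remaining iterations, which the loop variable holds at every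
    -- test of the guard; `p` does not write that variable.
    have key : ∀ j (s h : Config), s.Sim (h.setReg x j) → h.reg y ≤ B →
        ∃ s' t, Exec w ω (.loop x (.seq p.compile (.seq (.const 100 1) (.binop .sub x x 100))))
          s s' t ∧ s'.Sim (countdown x (p.run w ω) j h) ∧ t ≤ j * (p.cost B + 3) + 1 := by
      intro j
      induction j with
      | zero =>
        intro s h H _
        exact ⟨s, _, .loop_false (by simpa using H.reg x hx), H, by simp⟩
      | succ j IH =>
        intro s h H hB
        obtain ⟨s1, t1, h1, H1, c1⟩ := ih hp s _ H (by simpa [Ne.symm hxz] using hB)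
        have e1 : s1.reg x = j + 1 := by
          rw [H1.reg x hx, run_reg_of_notMem w ω p _ hxp]; simp
        have h100 : x ≠ 100 := by omega
        -- With `w = 0` the literal `1` would be reduced to `0` and the loop would never end.
        have hone : 1 % 2 ^ w = 1 := Nat.mod_eq_of_lt (Nat.one_lt_two_pow hw.ne')
        have h2 : Exec w ω (.seq (.const 100 1) (.binop .sub x x 100)) s1
            ((s1.setReg 100 1).setReg x j) 2 := by
          have := Exec.seq (.const s1 100 1) (.binop (w := w) (ω := ω) _ .sub x x 100)
          simpa [Op.eval, e1, h100, hone] using this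
        obtain ⟨s2, t2, h3, H3, c3⟩ := IH _ (p.run w ω (h.setReg x (j + 1)))
          ((H1.setScratch (r := 100) le_rfl 1).setReg x j)
          (by
            rw [run_reg_of_notMem w ω p _ (notMem_writes_of_ok p hp)]
            simpa [Ne.symm hxz] using hB)
        refine ⟨s2, _, .loop_true (by rw [H.reg x hx]; simp) (.seq h1 h2) h3, H3, ?_⟩
        rw [Nat.succ_mul]; omega
    have hy' : y ≠ 100 := by omega
    obtain ⟨s', t, h1, H1, c1⟩ := key (h.reg y)
      (((s.setReg 100 (0 % 2 ^ w)).setReg x (h.reg y))) h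
      ((H.setScratch le_rfl _).setReg x _) hB
    refine ⟨s', 1 + 1 + t, .seq (.seq (.const _ _ _) (.binop _ _ _ _ _)) ?_, H1, ?_⟩
    · simpa [Op.eval, hy', H.reg y hy] using h1
    · simp only [cost]
      have := Nat.mul_le_mul_right (p.cost B + 3) hB
      omega
  | skip => intro s h H _; exact ⟨s, 0, .skip s, H, le_rfl⟩

end Stm

/-- Determinism lets the execution supplied by `Reaches` be identified with the one constructed by
`Stm.exec_compile`. -/
theorem Exec.unique {w : ℕ} {ω : ℕ → Fin (2 ^ w)} {p : Prog} {s s₁ : Config} {t₁ : ℕ}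
    (h₁ : Exec w ω p s s₁ t₁) : ∀ {s₂ : Config} {t₂ : ℕ}, Exec w ω p s s₂ t₂ → s₁ = s₂ := by
  induction h₁ with
  | seq _ _ ih1 ih2 => intro s₂ t₂ h₂; cases h₂ with | seq a b => cases ih1 a; exact ih2 b
  | cond_true hr _ ih =>
    intro s₂ t₂ h₂; cases h₂ with
    | cond_true _ a => exact ih a
    | cond_false h => exact absurd h hr
  | cond_false hr _ ih =>
    intro s₂ t₂ h₂; cases h₂ with
    | cond_true h => exact absurd hr h
    | cond_false _ a => exact ih a
  | loop_true hr _ _ ih1 ih2 =>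
    intro s₂ t₂ h₂; cases h₂ with
    | loop_true _ a b => cases ih1 a; exact ih2 b
    | loop_false h => exact absurd h hr
  | loop_false hr =>
    intro s₂ t₂ h₂; cases h₂ with
    | loop_true h => exact absurd hr h
    | loop_false _ => rfl
  | _ => intro s₂ t₂ h₂; cases h₂; rfl

/-! ## Array lists with constant time insertion and deletion -/

/-- A list stored in an array, together with the positions of its elements. -/
structure Lst where
  cnt : ℕ
  elt : ℕ → ℕ
  pos : ℕ → ℕ

namespace Lst

/-- Append an element. -/
def push (l : Lst) (x : ℕ) : Lst where
  cnt := l.cnt + 1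
  elt := Function.update l.elt l.cnt x
  pos := Function.update l.pos x l.cnt

/-- Delete an element; the last element takes its place. -/
def del (l : Lst) (x : ℕ) : Lst where
  cnt := l.cnt - 1
  elt := Function.update l.elt (l.pos x) (l.elt (l.cnt - 1))
  pos := Function.update l.pos (l.elt (l.cnt - 1)) (l.pos x)

/-- Membership. -/
def Mem (l : Lst) (x : ℕ) : Prop := ∃ i < l.cnt, l.elt i = x

/-- The entries are below `n`, and positions are correct. -/
def Wf (n : ℕ) (l : Lst) : Prop := ∀ i < l.cnt, l.elt i < n ∧ l.pos (l.elt i) = i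

variable {n : ℕ} {l : Lst} {x : ℕ}

/-- `pos` is a left inverse of `elt` on the used cells, so the entries are distinct numbers below
`n`. -/
theorem Wf.cnt_le (h : l.Wf n) : l.cnt ≤ n := by
  have := Finset.card_le_card_of_injOn (s := Finset.range l.cnt) (t := Finset.range n) l.elt
    (fun i hi => by simpa using (h i (by simpa using hi)).1)
    (fun i hi j hj e => by
      rw [← (h i (by simpa using hi)).2, ← (h j (by simpa using hj)).2, e])
  simpa using this

theorem Wf.pos_lt (h : l.Wf n) (hx : l.Mem x) : l.pos x < l.cnt := by
  obtain ⟨i, hi, rfl⟩ := hx; rwa [(h i hi).2]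

theorem Wf.elt_pos (h : l.Wf n) (hx : l.Mem x) : l.elt (l.pos x) = x := by
  obtain ⟨i, hi, rfl⟩ := hx; rw [(h i hi).2]

theorem Wf.lt_of_mem (h : l.Wf n) (hx : l.Mem x) : x < n := by
  obtain ⟨i, hi, rfl⟩ := hx; exact (h i hi).1

theorem elt_push_of_lt {i : ℕ} (hi : i < l.cnt) : (l.push x).elt i = l.elt i := by
  simp [push, hi.ne]

theorem elt_push_last : (l.push x).elt l.cnt = x := by simp [push]

theorem mem_push {y : ℕ} : (l.push x).Mem y ↔ l.Mem y ∨ y = x := by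
  constructor
  · rintro ⟨i, hi, rfl⟩
    rcases Nat.lt_succ_iff_lt_or_eq.mp hi with h | rfl
    · exact .inl ⟨i, h, (elt_push_of_lt h).symm⟩
    · exact .inr elt_push_last
  · rintro (⟨i, hi, rfl⟩ | rfl)
    · exact ⟨i, Nat.lt_succ_of_lt hi, elt_push_of_lt hi⟩
    · exact ⟨l.cnt, Nat.lt_succ_self _, elt_push_last⟩

theorem Wf.push (h : l.Wf n) (hx : ¬ l.Mem x) (hxn : x < n) : (l.push x).Wf n := by
  intro i hi
  rcases Nat.lt_succ_iff_lt_or_eq.mp hi with hi | rfl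
  · rw [elt_push_of_lt hi]
    have : l.elt i ≠ x := fun e => hx ⟨i, hi, e⟩
    exact ⟨(h i hi).1, by simp [Lst.push, Function.update_of_ne this, (h i hi).2]⟩
  · rw [elt_push_last]
    exact ⟨hxn, by simp [Lst.push]⟩

/-- There is room for a new element in an array of `n` cells, because the list after the push is
still well formed. -/
theorem Wf.cnt_lt (h : l.Wf n) (hx : ¬ l.Mem x) (hxn : x < n) : l.cnt < n :=
  (h.push hx hxn).cnt_le

theorem elt_del (i : ℕ) :
    (l.del x).elt i = if i = l.pos x then l.elt (l.cnt - 1) else l.elt i := by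
  simp [del, Function.update_apply]

theorem Wf.elt_inj (h : l.Wf n) {i j : ℕ} (hi : i < l.cnt) (hj : j < l.cnt)
    (e : l.elt i = l.elt j) : i = j := by
  rw [← (h i hi).2, e, (h j hj).2]

/-- The last element overwrites `x`, so only the cell of `x` changes and every other element
survives. If `x` is itself last, it disappears because the length drops. Its stale `pos` is
harmless, since `Wf` speaks only of listed elements. -/
theorem Wf.mem_del (h : l.Wf n) (hx : l.Mem x) {y : ℕ} :
    (l.del x).Mem y ↔ l.Mem y ∧ y ≠ x := by
  have hp := h.pos_lt hx
  have he := h.elt_pos hx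
  constructor
  · rintro ⟨i, hi, rfl⟩
    have hi' : i < l.cnt - 1 := hi
    rw [elt_del]
    split_ifs with hip
    · refine ⟨⟨_, by omega, rfl⟩, fun e => ?_⟩
      have := h.elt_inj (by omega) hp (e.trans he.symm)
      omega
    · refine ⟨⟨i, by omega, rfl⟩, fun e => hip ?_⟩
      exact h.elt_inj (by omega) hp (e.trans he.symm)
  · rintro ⟨⟨i, hi, rfl⟩, hne⟩
    by_cases hl : i = l.cnt - 1
    · refine ⟨l.pos x, ?_, by rw [elt_del, if_pos rfl, hl]⟩
      have : l.pos x ≠ l.cnt - 1 := fun e => hne (by rw [hl, ← e, he])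
      show _ < l.cnt - 1
      omega
    · refine ⟨i, show _ < l.cnt - 1 by omega, ?_⟩
      rw [elt_del, if_neg]
      rintro rfl
      exact hne he

theorem Wf.del (h : l.Wf n) (hx : l.Mem x) : (l.del x).Wf n := by
  have hp := h.pos_lt hx
  intro i hi
  have hi' : i < l.cnt - 1 := hi
  refine ⟨h.lt_of_mem ((h.mem_del hx).1 ⟨i, hi, rfl⟩).1, ?_⟩
  rw [elt_del]
  split_ifs with hip
  · simp [Lst.del, hip]
  · have : l.elt i ≠ l.elt (l.cnt - 1) := fun e => by
      have := h.elt_inj (by omega) (by omega) e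
      omega
    simp [Lst.del, Function.update_of_ne this, (h i (by omega)).2]

end Lst

/-! ## Layout of the memory -/

/-- The data of the algorithm. The list `(u, c)` with `c < 2n` holds the nodes `v` with the arc
`(u, v)` assigned to `c`, the list `(v, 2n)` the tails of arcs into `v`, and the list `(v, 2n + 1)`
the centers adjacent to `v`. -/
structure St where
  ls : ℕ × ℕ → Lst
  asg : ℕ × ℕ → ℕ
  cen : ℕ → ℕ

/-- Replace one list. -/
def St.setLs (σ : St) (k : ℕ × ℕ) (l : Lst) : St := { σ with ls := Function.update σ.ls k l }

/-- Change one assignment. -/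
def St.setAsg (σ : St) (k : ℕ × ℕ) (c : ℕ) : St := { σ with asg := Function.update σ.asg k c }

@[simp] theorem St.setLs_self (σ : St) (k : ℕ × ℕ) (l : Lst) : (σ.setLs k l).ls k = l := by
  simp [St.setLs]

theorem St.setLs_of_ne (σ : St) {k k' : ℕ × ℕ} (l : Lst) (h : k' ≠ k) :
    (σ.setLs k l).ls k' = σ.ls k' := by
  simp [St.setLs, h]

@[simp] theorem St.setLs_asg (σ : St) (k : ℕ × ℕ) (l : Lst) : (σ.setLs k l).asg = σ.asg := rfl

@[simp] theorem St.setAsg_ls (σ : St) (k : ℕ × ℕ) (c : ℕ) : (σ.setAsg k c).ls = σ.ls := rfl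

@[simp] theorem St.setAsg_cen (σ : St) (k : ℕ × ℕ) (c : ℕ) : (σ.setAsg k c).cen = σ.cen := rfl

@[simp] theorem St.setLs_setLs (σ : St) (k : ℕ × ℕ) (l l' : Lst) :
    (σ.setLs k l).setLs k l' = σ.setLs k l' := by
  simp [St.setLs]

/-- The number that encodes the name of a list. -/
def enc (n : ℕ) (k : ℕ × ℕ) : ℕ := k.1 * (2 * n + 2) + k.2

/-- The names of lists. -/
def Valid (n : ℕ) (k : ℕ × ℕ) : Prop := k.1 < n ∧ k.2 < 2 * n + 2

/-- Uniqueness of quotient and remainder; this is why distinct table entries have distinct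
addresses. -/
theorem mul_add_inj {a b q i j : ℕ} (hi : i < q) (hj : j < q) :
    a * q + i = b * q + j ↔ a = b ∧ i = j := by
  constructor
  · intro h
    have hq : 0 < q := by omega
    have h1 : (a * q + i) / q = (b * q + j) / q := by rw [h]
    rw [mul_comm a, mul_comm b, Nat.mul_add_div hq, Nat.mul_add_div hq, Nat.div_eq_of_lt hi,
      Nat.div_eq_of_lt hj] at h1
    have : a = b := by simpa using h1
    subst this
    exact ⟨rfl, by omega⟩
  · rintro ⟨rfl, rfl⟩; rfl

theorem enc_inj {n : ℕ} {k k' : ℕ × ℕ} (h : Valid n k) (h' : Valid n k') :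
    enc n k = enc n k' ↔ k = k' := by
  rw [enc, enc, mul_add_inj h.2 h'.2, Prod.ext_iff]

theorem enc_lt {n : ℕ} (hn : 3 ≤ n) {k : ℕ × ℕ} (h : Valid n k) : enc n k < 3 * n ^ 2 := by
  have h1 := h.1
  have h2 := h.2
  unfold enc
  have : (k.1 + 1) * (2 * n + 2) ≤ n * (3 * n) := Nat.mul_le_mul h1 (by omega)
  nlinarith

/-- The memory `M` holds the data `σ`. -/
structure Rep (n : ℕ) (M : ℕ → ℕ) (σ : St) : Prop where
  cnt : ∀ k, Valid n k → M (8 * enc n k) = (σ.ls k).cnt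
  elt : ∀ k, Valid n k → ∀ i < n, M (8 * (enc n k * n + i) + 1) = (σ.ls k).elt i
  pos : ∀ k, Valid n k → ∀ i < n, M (8 * (enc n k * n + i) + 2) = (σ.ls k).pos i
  asg : ∀ u < n, ∀ v < n, M (8 * (u * n + v) + 3) = σ.asg (u, v)
  cen : ∀ v < n, M (8 * v + 4) = σ.cen v

namespace Rep

variable {n : ℕ} {M : ℕ → ℕ} {σ : St} {k : ℕ × ℕ}

/-- The five tables occupy different residues modulo `8`, so a write to one never touches another.
Within a table, `enc_inj` and `mul_add_inj` separate the cells. The same two reasons prove the next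
three lemmas. -/
theorem setCnt (h : Rep n M σ) (hk : Valid n k) (c : ℕ) :
    Rep n (Function.update M (8 * enc n k) c) (σ.setLs k { σ.ls k with cnt := c }) where
  cnt k' hk' := by
    rcases eq_or_ne k' k with rfl | e
    · simp
    · rw [σ.setLs_of_ne _ e, ← h.cnt k' hk', Function.update_of_ne]
      have := mt (enc_inj hk' hk).1 e
      omega
  elt k' hk' i hi := by
    rw [Function.update_of_ne (by omega), h.elt k' hk' i hi]
    rcases eq_or_ne k' k with rfl | e
    · simp
    · rw [σ.setLs_of_ne _ e]
  pos k' hk' i hi := by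
    rw [Function.update_of_ne (by omega), h.pos k' hk' i hi]
    rcases eq_or_ne k' k with rfl | e
    · simp
    · rw [σ.setLs_of_ne _ e]
  asg u hu v hv := by rw [Function.update_of_ne (by omega), h.asg u hu v hv]; rfl
  cen v hv := by rw [Function.update_of_ne (by omega), h.cen v hv]; rfl

theorem setElt (h : Rep n M σ) (hk : Valid n k) {p : ℕ} (hp : p < n) (c : ℕ) :
    Rep n (Function.update M (8 * (enc n k * n + p) + 1) c)
      (σ.setLs k { σ.ls k with elt := Function.update (σ.ls k).elt p c }) where
  cnt k' hk' := by
    rw [Function.update_of_ne (by omega), h.cnt k' hk']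
    rcases eq_or_ne k' k with rfl | e
    · simp
    · rw [σ.setLs_of_ne _ e]
  elt k' hk' i hi := by
    have hinj := (mul_add_inj (a := enc n k') (b := enc n k) hi hp).trans
      (and_congr_left' (enc_inj hk' hk))
    rcases eq_or_ne k' k with rfl | e
    · rcases eq_or_ne i p with rfl | e'
      · simp
      · have := mt hinj.1 (by tauto)
        rw [Function.update_of_ne (by omega), h.elt k' hk' i hi]
        simp [e']
    · have := mt hinj.1 (by tauto)
      rw [Function.update_of_ne (by omega), h.elt k' hk' i hi, σ.setLs_of_ne _ e]
  pos k' hk' i hi := by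
    rw [Function.update_of_ne (by omega), h.pos k' hk' i hi]
    rcases eq_or_ne k' k with rfl | e
    · simp
    · rw [σ.setLs_of_ne _ e]
  asg u hu v hv := by rw [Function.update_of_ne (by omega), h.asg u hu v hv]; rfl
  cen v hv := by rw [Function.update_of_ne (by omega), h.cen v hv]; rfl

theorem setPos (h : Rep n M σ) (hk : Valid n k) {p : ℕ} (hp : p < n) (c : ℕ) :
    Rep n (Function.update M (8 * (enc n k * n + p) + 2) c)
      (σ.setLs k { σ.ls k with pos := Function.update (σ.ls k).pos p c }) where
  cnt k' hk' := by
    rw [Function.update_of_ne (by omega), h.cnt k' hk']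
    rcases eq_or_ne k' k with rfl | e
    · simp
    · rw [σ.setLs_of_ne _ e]
  elt k' hk' i hi := by
    rw [Function.update_of_ne (by omega), h.elt k' hk' i hi]
    rcases eq_or_ne k' k with rfl | e
    · simp
    · rw [σ.setLs_of_ne _ e]
  pos k' hk' i hi := by
    have hinj := (mul_add_inj (a := enc n k') (b := enc n k) hi hp).trans
      (and_congr_left' (enc_inj hk' hk))
    rcases eq_or_ne k' k with rfl | e
    · rcases eq_or_ne i p with rfl | e'
      · simp
      · have := mt hinj.1 (by tauto)
        rw [Function.update_of_ne (by omega), h.pos k' hk' i hi]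
        simp [e']
    · have := mt hinj.1 (by tauto)
      rw [Function.update_of_ne (by omega), h.pos k' hk' i hi, σ.setLs_of_ne _ e]
  asg u hu v hv := by rw [Function.update_of_ne (by omega), h.asg u hu v hv]; rfl
  cen v hv := by rw [Function.update_of_ne (by omega), h.cen v hv]; rfl

theorem setAsg (h : Rep n M σ) {u v : ℕ} (hv : v < n) (c : ℕ) :
    Rep n (Function.update M (8 * (u * n + v) + 3) c) (σ.setAsg (u, v) c) where
  cnt k' hk' := by rw [Function.update_of_ne (by omega), h.cnt k' hk']; rfl
  elt k' hk' i hi := by rw [Function.update_of_ne (by omega), h.elt k' hk' i hi]; rfl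
  pos k' hk' i hi := by rw [Function.update_of_ne (by omega), h.pos k' hk' i hi]; rfl
  asg x hx y hy := by
    have hinj := mul_add_inj (a := x) (b := u) hy hv
    by_cases e : x = u ∧ y = v
    · obtain ⟨rfl, rfl⟩ := e
      simp [St.setAsg]
    · have e' : (x, y) ≠ (u, v) := by simpa [Prod.ext_iff] using e
      have := mt hinj.1 e
      rw [Function.update_of_ne (by omega), h.asg x hx y hy]
      simp only [St.setAsg, Function.update_of_ne e']
  cen v hv := by rw [Function.update_of_ne (by omega), h.cen v hv]; rfl

end Rep

/-! ## Reading and writing the data -/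

namespace Expr

/-- Sums. -/
def plus (a b : Expr) : Expr := .bin .add a b

/-- Products. -/
def times (a b : Expr) : Expr := .bin .mul a b

/-- `2n`. -/
def twoN : Expr := times (.lit 2) (.reg 0)

/-- The number that encodes the name of a list. -/
def key (u j : Expr) : Expr := plus (times u (plus twoN (.lit 2))) j

/-- The address of the length of a list. -/
def cntA (k : Expr) : Expr := times (.lit 8) k

/-- The address of an entry in an `n`-column table with tag `t`. -/
def cellA (t : ℕ) (k i : Expr) : Expr :=
  plus (times (.lit 8) (plus (times k (.reg 0)) i)) (.lit t)

/-- The address of the mark of a node. -/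
def cenA (v : Expr) : Expr := plus (times (.lit 8) v) (.lit 4)

end Expr

/-- Words are long enough for all addresses and block numbers. -/
structure Fits (n L w : ℕ) : Prop where
  three_le : 3 ≤ n
  cube : 32 * n ^ 3 ≤ 2 ^ w
  block : (n + 1) * L < 2 ^ w
  pos : 0 < L

/-! ### Address arithmetic does not overflow -/

section Eval

variable {n L w : ℕ} {s : Config}

theorem Expr.eval_plus {a b : Expr} {x y : ℕ} (ha : a.eval w s = x) (hb : b.eval w s = y)
    (h : x + y < 2 ^ w) : (Expr.plus a b).eval w s = x + y := by
  simp only [Expr.plus, Expr.eval, Op.eval, ha, hb, Nat.mod_eq_of_lt h]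

theorem Expr.eval_times {a b : Expr} {x y : ℕ} (ha : a.eval w s = x) (hb : b.eval w s = y)
    (h : x * y < 2 ^ w) : (Expr.times a b).eval w s = x * y := by
  simp only [Expr.times, Expr.eval, Op.eval, ha, hb, Nat.mod_eq_of_lt h]

theorem Expr.eval_lit {k : ℕ} (h : k < 2 ^ w) : (Expr.lit k).eval w s = k := by
  simp only [Expr.eval, Nat.mod_eq_of_lt h]

/-- Consequences of `32 * n ^ 3 ≤ 2 ^ w` and `3 ≤ n`, in a form linear in each power of `n`, so that
later overflow checks are linear arithmetic. -/
theorem Fits.large (hf : Fits n L w) : 32 * 27 ≤ 2 ^ w ∧ 96 * n ^ 2 ≤ 2 ^ w ∧ 288 * n ≤ 2 ^ w := by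
  have h1 := hf.three_le
  have h2 := hf.cube
  have h3 : 3 * 3 ≤ n ^ 2 := by nlinarith
  have h4 : n ^ 3 = n ^ 2 * n := by ring
  have h5 : 3 * n ≤ n ^ 2 := by nlinarith
  have h6 : n ^ 2 * 3 ≤ n ^ 2 * n := by nlinarith
  refine ⟨by omega, by omega, by omega⟩

theorem Fits.eval_twoN (hf : Fits n L w) (h0 : s.reg 0 = n) :
    Expr.twoN.eval w s = 2 * n := by
  have := hf.large
  exact Expr.eval_times (Expr.eval_lit (by omega)) h0 (by omega)

theorem Fits.eval_twoN_one (hf : Fits n L w) (h0 : s.reg 0 = n) :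
    (Expr.plus Expr.twoN (.lit 1)).eval w s = 2 * n + 1 := by
  have := hf.large
  exact Expr.eval_plus (hf.eval_twoN h0) (Expr.eval_lit (by omega)) (by omega)

theorem Fits.eval_key (hf : Fits n L w) (h0 : s.reg 0 = n) {a b : Expr} {k : ℕ × ℕ}
    (ha : a.eval w s = k.1) (hb : b.eval w s = k.2) (hk : Valid n k) :
    (Expr.key a b).eval w s = enc n k := by
  have h1 := hf.large
  have h2 : enc n k < 2 ^ w := (enc_lt hf.three_le hk).trans_le (by omega)
  unfold enc at h2 ⊢
  refine Expr.eval_plus (Expr.eval_times ha (Expr.eval_plus (hf.eval_twoN h0)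
    (Expr.eval_lit (by omega)) (by omega)) (by omega)) hb h2

theorem Fits.eval_cntA (hf : Fits n L w) {a : Expr} {k : ℕ × ℕ}
    (ha : a.eval w s = enc n k) (hk : Valid n k) : (Expr.cntA a).eval w s = 8 * enc n k := by
  have h1 := hf.large
  have h2 := enc_lt hf.three_le hk
  exact Expr.eval_times (Expr.eval_lit (by omega)) ha (by omega)

/-- Codes of lists are below `3 * n ^ 2`, so cells have index below `3 * n ^ 3` and addresses below
`24 * n ^ 3 + 8`, within the word size. -/
theorem Fits.eval_cellA (hf : Fits n L w) (h0 : s.reg 0 = n) {t : ℕ} (ht : t < 8) {a b : Expr}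
    {x i : ℕ} (ha : a.eval w s = x) (hb : b.eval w s = i) (hx : x < 3 * n ^ 2) (hi : i < n) :
    (Expr.cellA t a b).eval w s = 8 * (x * n + i) + t := by
  have h1 := hf.large
  have h2 := hf.cube
  have h3 : (x + 1) * n ≤ 3 * n ^ 2 * n := Nat.mul_le_mul_right _ hx
  have h4 : 3 * n ^ 2 * n = 3 * n ^ 3 := by ring
  have h5 : (x + 1) * n = x * n + n := by ring
  exact Expr.eval_plus (Expr.eval_times (Expr.eval_lit (by omega))
    (Expr.eval_plus (Expr.eval_times ha h0 (by omega)) hb (by omega)) (by omega))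
    (Expr.eval_lit (by omega)) (by omega)

theorem Fits.eval_cenA (hf : Fits n L w) {a : Expr} {v : ℕ} (ha : a.eval w s = v)
    (hv : v < n) : (Expr.cenA a).eval w s = 8 * v + 4 := by
  have h1 := hf.large
  exact Expr.eval_plus (Expr.eval_times (Expr.eval_lit (by omega)) ha (by omega))
    (Expr.eval_lit (by omega)) (by omega)

variable {σ : St} {k : ℕ × ℕ} {a b : Expr} {i : ℕ}

theorem Fits.eval_cnt (hf : Fits n L w) (hR : Rep n s.mem σ) (ha : a.eval w s = enc n k)
    (hk : Valid n k) : (Expr.get (Expr.cntA a)).eval w s = (σ.ls k).cnt := by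
  rw [Expr.eval, hf.eval_cntA ha hk, hR.cnt k hk]

theorem Fits.eval_elt (hf : Fits n L w) (h0 : s.reg 0 = n) (hR : Rep n s.mem σ)
    (ha : a.eval w s = enc n k) (hb : b.eval w s = i) (hk : Valid n k) (hi : i < n) :
    (Expr.get (Expr.cellA 1 a b)).eval w s = (σ.ls k).elt i := by
  rw [Expr.eval, hf.eval_cellA h0 (by omega) ha hb (enc_lt hf.three_le hk) hi, hR.elt k hk i hi]

theorem Fits.eval_pos (hf : Fits n L w) (h0 : s.reg 0 = n) (hR : Rep n s.mem σ)
    (ha : a.eval w s = enc n k) (hb : b.eval w s = i) (hk : Valid n k) (hi : i < n) :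
    (Expr.get (Expr.cellA 2 a b)).eval w s = (σ.ls k).pos i := by
  rw [Expr.eval, hf.eval_cellA h0 (by omega) ha hb (enc_lt hf.three_le hk) hi, hR.pos k hk i hi]

theorem Fits.eval_asgA (hf : Fits n L w) (h0 : s.reg 0 = n) {u v : ℕ}
    (ha : a.eval w s = u) (hb : b.eval w s = v) (hu : u < n) (hv : v < n) :
    (Expr.cellA 3 a b).eval w s = 8 * (u * n + v) + 3 :=
  hf.eval_cellA h0 (by omega) ha hb (by nlinarith) hv

theorem Fits.eval_asg (hf : Fits n L w) (h0 : s.reg 0 = n) (hR : Rep n s.mem σ) {u v : ℕ}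
    (ha : a.eval w s = u) (hb : b.eval w s = v) (hu : u < n) (hv : v < n) :
    (Expr.get (Expr.cellA 3 a b)).eval w s = σ.asg (u, v) := by
  rw [Expr.eval, hf.eval_asgA h0 ha hb hu hv, hR.asg u hu v hv]

theorem Fits.eval_cen (hf : Fits n L w) (hR : Rep n s.mem σ) {v : ℕ}
    (ha : a.eval w s = v) (hv : v < n) : (Expr.get (Expr.cenA a)).eval w s = σ.cen v := by
  rw [Expr.eval, hf.eval_cenA ha hv, hR.cen v hv]

end Eval

/-- `p ;; q` runs `p`, then `q`. -/
infixr:60 " ;; " => Stm.seq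

/-- Write to memory. -/
def Config.setMem (s : Config) (a v : ℕ) : Config := { s with mem := Function.update s.mem a v }

@[simp] theorem Config.setMem_reg (s : Config) (a v : ℕ) : (s.setMem a v).reg = s.reg := rfl

@[simp] theorem Config.setMem_mem (s : Config) (a v : ℕ) :
    (s.setMem a v).mem = Function.update s.mem a v := rfl

@[simp] theorem Config.setMem_out (s : Config) (a v : ℕ) : (s.setMem a v).out = s.out := rfl

@[simp] theorem Config.setMem_pos (s : Config) (a v : ℕ) : (s.setMem a v).pos = s.pos := rfl

@[simp] theorem Expr.eval_reg (w : ℕ) (s : Config) (x : ℕ) : (Expr.reg x).eval w s = s.reg x := rfl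

theorem Expr.eval_sub {w : ℕ} {s : Config} {a b : Expr} {x y : ℕ} (ha : a.eval w s = x)
    (hb : b.eval w s = y) : (Expr.bin .sub a b).eval w s = x - y := by
  simp only [Expr.eval, Op.eval, ha, hb]

theorem Expr.eval_div {w : ℕ} {s : Config} {a b : Expr} {x y : ℕ} (ha : a.eval w s = x)
    (hb : b.eval w s = y) : (Expr.bin .div a b).eval w s = x / y := by
  simp only [Expr.eval, Op.eval, ha, hb]

theorem Expr.eval_lt {w : ℕ} {s : Config} {a b : Expr} {x y : ℕ} (ha : a.eval w s = x)
    (hb : b.eval w s = y) : (Expr.bin .lt a b).eval w s ≠ 0 ↔ x < y := by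
  simp only [Expr.eval, Op.eval, ha, hb]
  split <;> simp_all

/-! ### Rules for symbolic execution of statements -/

namespace Stm

variable {w : ℕ} {ω : ℕ → Fin (2 ^ w)} {s : Config}

theorem run_seq (p q : Stm) : (p ;; q).run w ω s = q.run w ω (p.run w ω s) := rfl

theorem run_set {x v : ℕ} {e : Expr} (h : e.eval w s = v) :
    (set x e).run w ω s = s.setReg x v := by
  rw [run, h]

theorem run_put {b v : ℕ} {a e : Expr} (ha : a.eval w s = b) (he : e.eval w s = v) :
    (put a e).run w ω s = s.setMem b v := by
  rw [run, ha, he]; rfl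

theorem run_ite_pos {e : Expr} {p q : Stm} (h : e.eval w s ≠ 0) :
    (ite e p q).run w ω s = p.run w ω s := by
  rw [run, if_pos h]

theorem run_ite_neg {e : Expr} {p q : Stm} (h : ¬ e.eval w s ≠ 0) :
    (ite e p q).run w ω s = q.run w ω s := by
  rw [run, if_neg h]

end Stm

/-- Append the node in register `11` to the list named in register `10`. -/
def pushStm : Stm :=
  .set 12 (.get (.cntA (.reg 10))) ;;
  .put (.cellA 1 (.reg 10) (.reg 12)) (.reg 11) ;;
  .put (.cellA 2 (.reg 10) (.reg 11)) (.reg 12) ;;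
  .put (.cntA (.reg 10)) (.plus (.reg 12) (.lit 1))

/-- Delete the node in register `11` from the list named in register `10`. -/
def delStm : Stm :=
  .set 12 (.get (.cellA 2 (.reg 10) (.reg 11))) ;;
  .set 13 (.bin .sub (.get (.cntA (.reg 10))) (.lit 1)) ;;
  .put (.cntA (.reg 10)) (.reg 13) ;;
  .set 13 (.get (.cellA 1 (.reg 10) (.reg 13))) ;;
  .put (.cellA 1 (.reg 10) (.reg 12)) (.reg 13) ;;
  .put (.cellA 2 (.reg 10) (.reg 13)) (.reg 12)

section Run

variable {n L w : ℕ} {ω : ℕ → Fin (2 ^ w)} {s : Config} {σ : St} {k : ℕ × ℕ} {x : ℕ}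

theorem run_pushStm (hf : Fits n L w) (h0 : s.reg 0 = n) (hR : Rep n s.mem σ)
    (h10 : s.reg 10 = enc n k) (h11 : s.reg 11 = x) (hk : Valid n k) (hx : x < n)
    (hc : (σ.ls k).cnt < n) :
    Rep n (pushStm.run w ω s).mem (σ.setLs k ((σ.ls k).push x)) ∧
      (pushStm.run w ω s).out = s.out := by
  have hl := hf.large
  have hke := enc_lt hf.three_le hk
  rw [pushStm, Stm.run_seq, Stm.run_set (hf.eval_cnt hR (k := k) (by simpa) hk), Stm.run_seq,
    Stm.run_put (v := x) (hf.eval_cellA (x := enc n k) (i := (σ.ls k).cnt) (by simpa) (by omega)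
      (by simpa) (by simp) hke hc) (by simpa), Stm.run_seq,
    Stm.run_put (v := (σ.ls k).cnt) (hf.eval_cellA (x := enc n k) (i := x) (by simpa) (by omega)
      (by simpa) (by simpa) hke hx) (by simp),
    Stm.run_put (hf.eval_cntA (k := k) (by simpa) hk)
      (Expr.eval_plus (x := (σ.ls k).cnt) (by simp) (Expr.eval_lit (k := 1) (by omega))
        (by omega))]
  refine ⟨?_, rfl⟩
  simpa [Lst.push] using
    ((hR.setElt hk hc x).setPos hk hx (σ.ls k).cnt).setCnt hk ((σ.ls k).cnt + 1)

theorem run_delStm (hf : Fits n L w) (h0 : s.reg 0 = n) (hR : Rep n s.mem σ)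
    (h10 : s.reg 10 = enc n k) (h11 : s.reg 11 = x) (hk : Valid n k)
    (hw : (σ.ls k).Wf n) (hm : (σ.ls k).Mem x) :
    Rep n (delStm.run w ω s).mem (σ.setLs k ((σ.ls k).del x)) ∧
      (delStm.run w ω s).out = s.out := by
  have hl := hf.large
  have hx := hw.lt_of_mem hm
  have hp := hw.pos_lt hm
  have hc := hw.cnt_le
  have hke := enc_lt hf.three_le hk
  have hy : (σ.ls k).elt ((σ.ls k).cnt - 1) < n := (hw _ (by omega)).1
  -- The length is lowered first; register `13` holds the index of the last entry up to its use, and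
  -- then that entry itself.
  have hR1 := hR.setCnt hk ((σ.ls k).cnt - 1)
  rw [delStm, Stm.run_seq,
    Stm.run_set (hf.eval_pos (k := k) (i := x) h0 hR (by simpa) (by simpa) hk hx), Stm.run_seq,
    Stm.run_set (Expr.eval_sub (hf.eval_cnt (σ := σ) (by exact hR) (k := k) (by simpa) hk)
      (Expr.eval_lit (k := 1) (by omega))), Stm.run_seq,
    Stm.run_put (v := (σ.ls k).cnt - 1) (hf.eval_cntA (k := k) (by simpa) hk) (by simp),
    Stm.run_seq,
    Stm.run_set (hf.eval_elt (k := k) (i := (σ.ls k).cnt - 1) (by simpa) (by exact hR1) (by simpa)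
      (by simp)       hk (by omega)), Stm.run_seq,
    Stm.run_put (v := (σ.ls k).elt ((σ.ls k).cnt - 1)) (hf.eval_cellA (t := 1) (x := enc n k)
      (i := (σ.ls k).pos x) (by simpa) (by omega) (by simpa) (by simp) hke (by omega)) (by simp),
    Stm.run_put (v := (σ.ls k).pos x) (hf.eval_cellA (t := 2) (x := enc n k)
      (i := (σ.ls k).elt ((σ.ls k).cnt - 1)) (by simpa) (by omega) (by simpa) (by simp) hke hy)
      (by simp)]
  refine ⟨?_, rfl⟩
  simpa [Lst.del] using (hR1.setElt hk (hp.trans_le hc) ((σ.ls k).elt ((σ.ls k).cnt - 1))).setPos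
    hk hy ((σ.ls k).pos x)

end Run

/-! ## Reassignment of arcs -/

/-- `x` is the first element of the list. -/
def Lst.Head (l : Lst) (x : ℕ) : Prop := 0 < l.cnt ∧ l.elt 0 = x

theorem Lst.Head.mem {l : Lst} {x : ℕ} (h : l.Head x) : l.Mem x := ⟨0, h.1, h.2⟩

theorem Lst.head_push {l : Lst} {x y : ℕ} :
    (l.push x).Head y ↔ l.Head y ∨ l.cnt = 0 ∧ y = x := by
  unfold Lst.Head
  rcases Nat.eq_zero_or_pos l.cnt with h | h
  · simp [Lst.push, h, eq_comm]
  · rw [Lst.elt_push_of_lt h]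
    simp [Lst.push, h, h.ne']

/-- Only a deletion at position `0` changes the head, and then the former last element takes over.
Hence refiling an arc changes the output by a constant number of edges. -/
theorem Lst.Wf.head_del {n : ℕ} {l : Lst} {x y : ℕ} (h : l.Wf n) (hx : l.Mem x) :
    (l.del x).Head y ↔
      l.pos x ≠ 0 ∧ l.Head y ∨ l.pos x = 0 ∧ 1 < l.cnt ∧ l.elt (l.cnt - 1) = y := by
  have hp := h.pos_lt hx
  unfold Lst.Head
  rw [Lst.elt_del]
  change 0 < l.cnt - 1 ∧ _ ↔ _
  by_cases h0 : l.pos x = 0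
  · simp [h0]
  · rw [if_neg (Ne.symm h0)]
    have h1 : 0 < l.cnt - 1 := by omega
    have h2 : 0 < l.cnt := by omega
    simp [h0, h1, h2]

theorem Lst.Wf.head_iff_of_pos {n : ℕ} {l : Lst} {x y : ℕ} (h : l.Wf n) (hx : l.Mem x)
    (h0 : l.pos x = 0) : l.Head y ↔ y = x := by
  have hp := h.pos_lt hx
  have he := h.elt_pos hx
  rw [h0] at hp he
  exact ⟨fun hy => hy.2.symm.trans he, fun e => ⟨hp, he.trans e.symm⟩⟩

/-- The node to which the `i`-th arc into `v` is to be assigned: arcs are assigned to the adjacent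
centers in blocks of length `L`, the remaining ones to the dummy `n + v`. -/
def tgt (n L : ℕ) (l : Lst) (v i : ℕ) : ℕ := if i / L < l.cnt then l.elt (i / L) else n + v

theorem tgt_lt {n L v i : ℕ} {l : Lst} (hl : l.Wf n) (hv : v < n) : tgt n L l v i < 2 * n := by
  unfold tgt
  split_ifs with h
  · have := (hl _ h).1; omega
  · omega

/-- The arcs in `Arc` are filed correctly, and the output consists of the edges in `Z` and the
first arc of each list. -/
structure Core (n L : ℕ) (Arc : Set (ℕ × ℕ)) (Z : Set (Sym2 ℕ)) (s : Config) (σ : St) : Prop where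
  reg0 : s.reg 0 = n
  reg4 : s.reg 4 = L
  rep : Rep n s.mem σ
  wf : ∀ k, Valid n k → (σ.ls k).Wf n
  arc : ∀ u v, (u, v) ∈ Arc → u < v ∧ v < n ∧ s(u, v) ∉ Z ∧ σ.asg (u, v) < 2 * n
  lst : ∀ u < n, ∀ c < 2 * n, ∀ v, (σ.ls (u, c)).Mem v ↔ (u, v) ∈ Arc ∧ σ.asg (u, v) = c
  out : ∀ e, e ∈ s.out ↔
    e ∈ Z ∨ ∃ u < n, ∃ c < 2 * n, ∃ v, (σ.ls (u, c)).Head v ∧ e = s(u, v)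

/-- All arcs except perhaps those into `v` in positions of `B` are assigned as they should be. -/
def Settled (n L : ℕ) (σ : St) (v : ℕ) (B : Set ℕ) : Prop :=
  ∀ x < n, ∀ i < (σ.ls (x, 2 * n)).cnt, ¬ (x = v ∧ i ∈ B) →
    σ.asg ((σ.ls (x, 2 * n)).elt i, x) = tgt n L (σ.ls (x, 2 * n + 1)) x i

/-- The two states differ only in the filing and assignment of arcs. -/
def SameAdj (n : ℕ) (σ σ' : St) : Prop :=
  (∀ x j, 2 * n ≤ j → σ'.ls (x, j) = σ.ls (x, j)) ∧ σ'.cen = σ.cen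

theorem SameAdj.trans {n : ℕ} {σ σ' σ'' : St} (h : SameAdj n σ σ') (h' : SameAdj n σ' σ'') :
    SameAdj n σ σ'' :=
  ⟨fun x j hj => (h'.1 x j hj).trans (h.1 x j hj), h'.2.trans h.2⟩

theorem sameAdj_setLs {n : ℕ} (σ : St) {u c : ℕ} (hc : c < 2 * n) (l : Lst) :
    SameAdj n σ (σ.setLs (u, c) l) :=
  ⟨fun x j hj => σ.setLs_of_ne _ (by simp only [ne_eq, Prod.mk.injEq, not_and]; omega), rfl⟩

/-! ### Refiling a single arc and a whole block -/

section Core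

variable {n L w : ℕ} {ω : ℕ → Fin (2 ^ w)} {s s' : Config} {σ σ' : St} {u v : ℕ}
  {Arc : Set (ℕ × ℕ)} {Z : Set (Sym2 ℕ)} {B : Set ℕ}

theorem Settled.mono {B' : Set ℕ} (h : Settled n L σ v B) (hB : B ⊆ B') :
    Settled n L σ v B' :=
  fun x hx i hi hn => h x hx i hi fun h' => hn ⟨h'.1, hB h'.2⟩

/-- With no exceptional positions the node is immaterial; the invariant `Inv` therefore names node
`0`. -/
theorem Settled.change (h : Settled n L σ v ∅) (v' : ℕ) : Settled n L σ v' ∅ :=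
  fun x hx i hi _ => h x hx i hi (by simp)

theorem Settled.congr (h : Settled n L σ v B) (hs : SameAdj n σ σ') (ha : σ'.asg = σ.asg) :
    Settled n L σ' v B := by
  intro x hx i hi hn
  rw [hs.1 x _ le_rfl] at hi ⊢
  rw [hs.1 x _ (by omega), ha]
  exact h x hx i hi hn

/-- Different positions hold different tails, so correcting the label at position `i` leaves all
other labels alone. -/
theorem Settled.setAsg {i : ℕ} (hw : (σ.ls (v, 2 * n)).Wf n) (hi : i < (σ.ls (v, 2 * n)).cnt)
    (h : Settled n L σ v (insert i B)) :
    Settled n L (σ.setAsg ((σ.ls (v, 2 * n)).elt i, v)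
      (tgt n L (σ.ls (v, 2 * n + 1)) v i)) v B := by
  intro x hx j hj hn
  simp only [St.setAsg_ls] at hj ⊢
  simp only [St.setAsg]
  by_cases e : x = v ∧ j = i
  · rw [e.1, e.2]; simp
  · rw [Function.update_of_ne]
    · apply h x hx j hj
      rintro ⟨rfl, h'⟩
      rcases h' with rfl | h'
      · exact e ⟨rfl, rfl⟩
      · exact hn ⟨rfl, h'⟩
    · intro h'
      simp only [Prod.mk.injEq] at h'
      obtain ⟨h1, rfl⟩ := h'
      exact e ⟨rfl, hw.elt_inj hj hi h1⟩

theorem Core.congr (H : Core n L Arc Z s σ) (h0 : s'.reg 0 = s.reg 0) (h4 : s'.reg 4 = s.reg 4)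
    (hm : s'.mem = s.mem) (ho : s'.out = s.out) : Core n L Arc Z s' σ :=
  ⟨h0.trans H.reg0, h4.trans H.reg4, hm ▸ H.rep, H.wf, H.arc, H.lst, ho ▸ H.out⟩

theorem Core.arc_of_head (H : Core n L Arc Z s σ) {c : ℕ} (hu : u < n) (hc : c < 2 * n)
    (h : (σ.ls (u, c)).Head v) : (u, v) ∈ Arc ∧ σ.asg (u, v) = c :=
  (H.lst u hu c hc v).1 h.mem

theorem sym2_eq_of_lt {u' v' : ℕ} (h : u < v) (h' : u' < v') (e : s(u', v') = s(u, v)) :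
    u' = u ∧ v' = v := by
  rw [Sym2.eq_iff] at e
  omega

/-- Take the arc from register `6` to register `7` out of its list. -/
def detachStm : Stm :=
  .set 11 (.reg 7) ;;
  .set 10 (.key (.reg 6) (.get (.cellA 3 (.reg 6) (.reg 7)))) ;;
  .ite (.get (.cellA 2 (.reg 10) (.reg 11))) .skip
    (.removeEdge (.reg 6) (.reg 7) ;;
      .ite (.bin .lt (.lit 1) (.get (.cntA (.reg 10))))
        (.addEdge (.reg 6) (.get (.cellA 1 (.reg 10)
          (.bin .sub (.get (.cntA (.reg 10))) (.lit 1))))) .skip) ;;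
  delStm

/-- An arc lies in exactly one list and its edge is not in `Z`. So the edge of a head is in the
output for one reason only, and reporting its removal loses nothing else. The label of the detached
arc remains in memory, but `Core` constrains labels only of arcs in `Arc`. -/
theorem run_detachStm (hf : Fits n L w) (H : Core n L Arc Z s σ) (h : (u, v) ∈ Arc)
    (h6 : s.reg 6 = u) (h7 : s.reg 7 = v) :
    Core n L (Arc \ {(u, v)}) Z (detachStm.run w ω s)
      (σ.setLs (u, σ.asg (u, v)) ((σ.ls (u, σ.asg (u, v))).del v)) := by
  have hl := hf.large
  obtain ⟨huv, hv, hZ, hc⟩ := H.arc u v h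
  set c := σ.asg (u, v) with hcdef
  have hu : u < n := by omega
  have hk : Valid n (u, c) := ⟨hu, by simp only; omega⟩
  have hw := H.wf _ hk
  have hm : (σ.ls (u, c)).Mem v := (H.lst u hu c hc v).2 ⟨h, rfl⟩
  have hp := hw.pos_lt hm
  have hcn := hw.cnt_le
  rw [detachStm, Stm.run_seq, Stm.run_set (v := v) (by simpa), Stm.run_seq,
    Stm.run_set (hf.eval_key (k := (u, c)) (by simpa using H.reg0) (by simpa)
      (hf.eval_asg (u := u) (v := v) (σ := σ) (by simpa using H.reg0) (by exact H.rep) (by simpa)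
        (by simpa) hu hv) hk), Stm.run_seq]
  generalize hs1 : (s.setReg 11 v).setReg 10 (enc n (u, c)) = s1
  have r0 : s1.reg 0 = n := by subst hs1; simpa using H.reg0
  have r4 : s1.reg 4 = L := by subst hs1; simpa using H.reg4
  have r6 : s1.reg 6 = u := by subst hs1; simpa
  have r7 : s1.reg 7 = v := by subst hs1; simpa
  have r10 : s1.reg 10 = enc n (u, c) := by subst hs1; simp
  have r11 : s1.reg 11 = v := by subst hs1; simp
  have hR : Rep n s1.mem σ := by subst hs1; exact H.rep
  have ho : s1.out = s.out := by subst hs1; rfl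
  have ev := hf.eval_pos (k := (u, c)) (i := v) r0 hR (a := .reg 10) (b := .reg 11) r10 r11 hk hv
  -- The output is corrected before the list is changed, while the last entry, which is the future
  -- head, can still be read. This block changes nothing but the output.
  have key : ∃ O : Set (Sym2 ℕ), Stm.run w ω (.ite (.get (.cellA 2 (.reg 10) (.reg 11))) .skip
      (.removeEdge (.reg 6) (.reg 7) ;;
        .ite (.bin .lt (.lit 1) (.get (.cntA (.reg 10))))
          (.addEdge (.reg 6) (.get (.cellA 1 (.reg 10)
            (.bin .sub (.get (.cntA (.reg 10))) (.lit 1))))) .skip)) s1 = { s1 with out := O } ∧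
      ∀ e, e ∈ O ↔ ((σ.ls (u, c)).pos v ≠ 0 ∧ e ∈ s.out) ∨ ((σ.ls (u, c)).pos v = 0 ∧
        ((e ∈ s.out ∧ e ≠ s(u, v)) ∨ (1 < (σ.ls (u, c)).cnt ∧
          e = s(u, (σ.ls (u, c)).elt ((σ.ls (u, c)).cnt - 1))))) := by
    by_cases hp0 : (σ.ls (u, c)).pos v = 0
    · rw [Stm.run_ite_neg (by rw [ev]; simpa), Stm.run_seq]
      have e1 : (Stm.removeEdge (.reg 6) (.reg 7)).run w ω s1 =
          { s1 with out := s.out \ {s(u, v)} } := by simp [Stm.run, r6, r7, ho]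
      rw [e1]
      have evc := hf.eval_cnt (s := { s1 with out := s.out \ {s(u, v)} }) (k := (u, c))
        (a := .reg 10) (by exact hR) r10 hk
      by_cases h1 : 1 < (σ.ls (u, c)).cnt
      · rw [Stm.run_ite_pos ((Expr.eval_lt (Expr.eval_lit (by omega)) evc).2 h1)]
        refine ⟨_, by rw [Stm.run, hf.eval_elt (k := (u, c)) (i := (σ.ls (u, c)).cnt - 1)
          (by exact r0) (by exact hR) (by exact r10)
          (Expr.eval_sub evc (Expr.eval_lit (by omega))) hk (by omega)], fun e => ?_⟩
        simp [hp0, h1, r6, or_comm]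
      · rw [Stm.run_ite_neg (mt (Expr.eval_lt (Expr.eval_lit (by omega)) evc).1 h1)]
        exact ⟨_, rfl, fun e => by simp [hp0, h1]⟩
    · rw [Stm.run_ite_pos (by rw [ev]; simpa)]
      exact ⟨s.out, by rw [← ho]; rfl, fun e => by simp [hp0]⟩
  obtain ⟨O, e1, hO⟩ := key
  rw [e1]
  obtain ⟨hR', ho'⟩ := run_delStm (ω := ω) (s := { s1 with out := O }) (k := (u, c)) (x := v) hf
    r0 hR r10 r11 hk hw hm
  have hfr : ∀ q, q ∉ [12, 13] → (delStm.run w ω { s1 with out := O }).reg q = s1.reg q :=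
    fun q hq => Stm.run_reg_of_notMem w ω delStm _ (by simpa [delStm, Stm.writes] using hq)
  -- Arcs point upwards, so an edge determines its arc, and the label of the arc determines its
  -- list.
  have other : ∀ u' < n, ∀ c' < 2 * n, (u', c') ≠ (u, c) → ∀ v', (σ.ls (u', c')).Head v' →
      s(u', v') ≠ s(u, v) := by
    intro u' hu' c' hc' hne v' hh e
    obtain ⟨ha, hasg⟩ := H.arc_of_head hu' hc' hh
    obtain ⟨rfl, rfl⟩ := sym2_eq_of_lt huv (H.arc _ _ ha).1 e
    exact hne (by rw [hcdef, ← hasg])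
  refine ⟨(hfr 0 (by simp)).trans r0, (hfr 4 (by simp)).trans r4, hR', ?_, ?_, ?_, ?_⟩
  · intro k hk'
    rcases eq_or_ne k (u, c) with rfl | e
    · rw [St.setLs_self]; exact hw.del hm
    · rw [σ.setLs_of_ne _ e]; exact H.wf k hk'
  · intro a b hab; exact H.arc a b hab.1
  · intro u' hu' c' hc' v'
    simp only [St.setLs_asg, Set.mem_sdiff, Set.mem_singleton_iff]
    rcases eq_or_ne (u', c') (u, c) with e | e
    · rw [e, St.setLs_self, hw.mem_del hm]
      obtain ⟨rfl, rfl⟩ := Prod.mk.inj e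
      rw [H.lst _ hu' _ hc']
      constructor
      · rintro ⟨⟨h1, h2⟩, h3⟩; exact ⟨⟨h1, by simpa⟩, h2⟩
      · rintro ⟨⟨h1, h2⟩, h3⟩; exact ⟨⟨h1, h3⟩, by simpa using h2⟩
    · rw [σ.setLs_of_ne _ e, H.lst _ hu' _ hc']
      constructor
      · rintro ⟨h1, h2⟩
        refine ⟨⟨h1, fun h3 => e ?_⟩, h2⟩
        obtain ⟨rfl, rfl⟩ := Prod.mk.inj h3
        rw [hcdef, h2]
      · rintro ⟨⟨h1, _⟩, h2⟩; exact ⟨h1, h2⟩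
  · intro e
    rw [ho', hO, H.out]
    by_cases hp0 : (σ.ls (u, c)).pos v = 0
    · simp only [hp0, ne_eq, not_true_eq_false, false_and, true_and, false_or]
      constructor
      · rintro (⟨hz | ⟨u', hu', c', hc', v', hh, rfl⟩, hne⟩ | ⟨h1, rfl⟩)
        · exact .inl hz
        · refine .inr ⟨u', hu', c', hc', v', ?_, rfl⟩
          rwa [σ.setLs_of_ne]
          intro e
          rw [e] at hh
          obtain ⟨rfl, rfl⟩ := Prod.mk.inj e
          rw [hw.head_iff_of_pos hm hp0] at hh
          exact hne (by rw [hh])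
        · refine .inr ⟨u, hu, c, hc, _, ?_, rfl⟩
          rw [St.setLs_self, hw.head_del hm]
          exact .inr ⟨hp0, h1, rfl⟩
      · rintro (hz | ⟨u', hu', c', hc', v', hh, rfl⟩)
        · exact .inl ⟨.inl hz, fun e => hZ (e ▸ hz)⟩
        · rcases eq_or_ne (u', c') (u, c) with e | e
          · rw [e, St.setLs_self, hw.head_del hm] at hh
            obtain ⟨rfl, rfl⟩ := Prod.mk.inj e
            rcases hh with ⟨h1, _⟩ | ⟨_, h1, rfl⟩
            · exact absurd hp0 h1
            · exact .inr ⟨h1, rfl⟩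
          · rw [σ.setLs_of_ne _ e] at hh
            exact .inl ⟨.inr ⟨u', hu', c', hc', v', hh, rfl⟩, other u' hu' c' hc' e v' hh⟩
    · simp only [hp0, ne_eq, not_false_eq_true, false_and, true_and, or_false]
      refine or_congr_right ?_
      have : ∀ k y, ((σ.setLs (u, c) ((σ.ls (u, c)).del v)).ls k).Head y ↔ (σ.ls k).Head y := by
        intro k y
        rcases eq_or_ne k (u, c) with rfl | e
        · rw [St.setLs_self, hw.head_del hm]; simp [hp0]
        · rw [σ.setLs_of_ne _ e]
      simp only [this]

/-- Assign the arc from register `6` to register `7` and put it into its list. -/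
def attachStm : Stm :=
  .set 12 (.bin .div (.get (.cellA 2 (.key (.reg 7) .twoN) (.reg 6))) (.reg 4)) ;;
  .ite (.bin .lt (.reg 12) (.get (.cntA (.key (.reg 7) (.plus .twoN (.lit 1))))))
    (.set 13 (.get (.cellA 1 (.key (.reg 7) (.plus .twoN (.lit 1))) (.reg 12))))
    (.set 13 (.plus (.reg 0) (.reg 7))) ;;
  .put (.cellA 3 (.reg 6) (.reg 7)) (.reg 13) ;;
  .set 10 (.key (.reg 6) (.reg 13)) ;;
  .set 11 (.reg 7) ;;
  .ite (.get (.cntA (.reg 10))) .skip (.addEdge (.reg 6) (.reg 7)) ;;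
  pushStm

/-- Appending creates a new head only in an empty list, so that is the only case in which an edge is
reported. The label is computed from the current position of `u` among the tails of `v`. -/
theorem run_attachStm (hf : Fits n L w) (H : Core n L Arc Z s σ) (h : (u, v) ∉ Arc)
    (huv : u < v) (hv : v < n) (hZ : s(u, v) ∉ Z) (hadj : (σ.ls (v, 2 * n)).Mem u) {t : ℕ}
    (ht : t = tgt n L (σ.ls (v, 2 * n + 1)) v ((σ.ls (v, 2 * n)).pos u))
    (h6 : s.reg 6 = u) (h7 : s.reg 7 = v) :
    Core n L (insert (u, v) Arc) Z (attachStm.run w ω s)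
      ((σ.setAsg (u, v) t).setLs (u, t) ((σ.ls (u, t)).push v)) := by
  have hl := hf.large
  have hu : u < n := by omega
  have hk1 : Valid n (v, 2 * n) := ⟨hv, by simp⟩
  have hk2 : Valid n (v, 2 * n + 1) := ⟨hv, by simp⟩
  have hw2 := H.wf _ hk2
  have htn : t < 2 * n := ht ▸ tgt_lt hw2 hv
  have hk : Valid n (u, t) := ⟨hu, by simp only; omega⟩
  have hw := H.wf _ hk
  have hm : ¬ (σ.ls (u, t)).Mem v := fun hm => h ((H.lst u hu t htn v).1 hm).1
  have hc := hw.cnt_lt hm hv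
  set i := (σ.ls (v, 2 * n)).pos u
  rw [attachStm, Stm.run_seq,
    Stm.run_set (Expr.eval_div (hf.eval_pos (k := (v, 2 * n)) (i := u) H.reg0 H.rep
      (hf.eval_key H.reg0 (by simpa) (hf.eval_twoN H.reg0) hk1) (by simpa) hk1 hu)
      (by simpa using H.reg4)), Stm.run_seq]
  have r0 : (s.setReg 12 (i / L)).reg 0 = n := by simpa using H.reg0
  have r7 : (s.setReg 12 (i / L)).reg 7 = v := by simpa
  have r12 : (s.setReg 12 (i / L)).reg 12 = i / L := by simp
  have hR : Rep n (s.setReg 12 (i / L)).mem σ := H.rep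
  have ekey := hf.eval_key (k := (v, 2 * n + 1)) r0 (a := .reg 7) r7 (hf.eval_twoN_one r0) hk2
  have e1 : Stm.run w ω (.ite
      (.bin .lt (.reg 12) (.get (.cntA (.key (.reg 7) (.plus .twoN (.lit 1))))))
      (.set 13 (.get (.cellA 1 (.key (.reg 7) (.plus .twoN (.lit 1))) (.reg 12))))
      (.set 13 (.plus (.reg 0) (.reg 7)))) (s.setReg 12 (i / L)) =
      (s.setReg 12 (i / L)).setReg 13 t := by
    have elt := Expr.eval_lt (a := .reg 12) r12 (hf.eval_cnt hR ekey hk2)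
    rw [ht, tgt]
    split_ifs with hi
    · rw [Stm.run_ite_pos (elt.2 hi), Stm.run_set (hf.eval_elt (i := i / L) r0 hR ekey (by simp) hk2
        (hi.trans_le hw2.cnt_le))]
    · rw [Stm.run_ite_neg (mt elt.1 hi), Stm.run_set (Expr.eval_plus (x := n) (y := v) (by simpa using r0)
        (by simpa using r7) (by omega))]
  rw [e1, Stm.run_seq,
    Stm.run_put (v := t) (hf.eval_asgA (u := u) (v := v) (by simpa using H.reg0) (by simpa)
      (by simpa) hu hv) (by simp), Stm.run_seq,
    Stm.run_set (hf.eval_key (k := (u, t)) (by simpa using H.reg0) (by simpa) (by simp) hk),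
    Stm.run_seq, Stm.run_set (v := v) (by simpa), Stm.run_seq]
  have hR1 := H.rep.setAsg (u := u) hv t
  generalize hs1 : (((((s.setReg 12 (i / L)).setReg 13 t).setMem (8 * (u * n + v) + 3) t).setReg 10
    (enc n (u, t))).setReg 11 v) = s1
  have r0 : s1.reg 0 = n := by subst hs1; simpa using H.reg0
  have r4 : s1.reg 4 = L := by subst hs1; simpa using H.reg4
  have r6 : s1.reg 6 = u := by subst hs1; simpa
  have r7 : s1.reg 7 = v := by subst hs1; simpa
  have r10 : s1.reg 10 = enc n (u, t) := by subst hs1; simp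
  have r11 : s1.reg 11 = v := by subst hs1; simp
  have hR2 : Rep n s1.mem (σ.setAsg (u, v) t) := by subst hs1; exact hR1
  have ho : s1.out = s.out := by subst hs1; rfl
  have ev := hf.eval_cnt (k := (u, t)) hR2 (a := .reg 10) r10 hk
  have key : ∃ O : Set (Sym2 ℕ), Stm.run w ω (.ite (.get (.cntA (.reg 10))) .skip
      (.addEdge (.reg 6) (.reg 7))) s1 = { s1 with out := O } ∧
      ∀ e, e ∈ O ↔ e ∈ s.out ∨ ((σ.ls (u, t)).cnt = 0 ∧ e = s(u, v)) := by
    by_cases hp0 : (σ.ls (u, t)).cnt = 0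
    · rw [Stm.run_ite_neg (by rw [ev]; simpa)]
      exact ⟨_, rfl, fun e => by simp [r6, r7, ho, hp0, or_comm]⟩
    · rw [Stm.run_ite_pos (by rw [ev]; simpa)]
      exact ⟨s1.out, rfl, fun e => by simp [hp0, ho]⟩
  obtain ⟨O, e2, hO⟩ := key
  rw [e2]
  obtain ⟨hR', ho'⟩ := run_pushStm (ω := ω) (s := { s1 with out := O }) (k := (u, t)) (x := v) hf
    r0 hR2 r10 r11 hk hv hc
  have hfr : ∀ q, q ∉ [12, 13] → (pushStm.run w ω { s1 with out := O }).reg q = s1.reg q :=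
    fun q hq => Stm.run_reg_of_notMem w ω pushStm _ (by simp [pushStm, Stm.writes]; grind)
  have hasg : ∀ p ∈ Arc, Function.update σ.asg (u, v) t p = σ.asg p := fun p hp =>
    Function.update_of_ne (by rintro rfl; exact h hp) _ _
  refine ⟨(hfr 0 (by simp)).trans r0, (hfr 4 (by simp)).trans r4, hR', ?_, ?_, ?_, ?_⟩
  · intro k hk'
    rcases eq_or_ne k (u, t) with rfl | e
    · rw [St.setLs_self]; exact hw.push hm hv
    · rw [St.setLs_of_ne _ _ e]; exact H.wf k hk'
  · intro a b hab
    simp only [St.setLs_asg, St.setAsg]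
    rcases hab with e | hab
    · rw [e]; obtain ⟨rfl, rfl⟩ := Prod.mk.inj e
      exact ⟨huv, hv, hZ, by simpa⟩
    · rw [hasg _ hab]; exact H.arc a b hab
  · intro u' hu' c' hc' v'
    simp only [St.setLs_asg]
    rcases eq_or_ne (u', v') (u, v) with e | e
    · rw [e]; obtain ⟨rfl, rfl⟩ := Prod.mk.inj e
      simp only [St.setAsg, Function.update_self, Set.mem_insert_iff, true_or, true_and]
      rcases eq_or_ne t c' with rfl | e'
      · simp [Lst.mem_push, St.setLs]
      · rw [St.setLs_of_ne]
        · simp only [e', iff_false]; exact fun hm => h ((H.lst _ hu' _ hc' _).1 hm).1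
        · simpa using Ne.symm e'
    · have : (u', v') ∈ insert (u, v) Arc ↔ (u', v') ∈ Arc := by simp [Set.mem_insert_iff, e]
      rw [this]
      simp only [St.setAsg, Function.update_of_ne e]
      rw [← H.lst u' hu' c' hc' v']
      rcases eq_or_ne (u', c') (u, t) with e' | e'
      · rw [e', St.setLs_self, Lst.mem_push]
        obtain ⟨rfl, rfl⟩ := Prod.mk.inj e'
        simp only [or_iff_left_iff_imp]
        rintro rfl; exact absurd rfl e
      · rw [St.setLs_of_ne _ _ e']
  · intro e
    rw [ho', hO, H.out, or_assoc]
    refine or_congr_right ?_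
    constructor
    · rintro (⟨u', hu', c', hc', v', hh, rfl⟩ | ⟨h1, rfl⟩)
      · refine ⟨u', hu', c', hc', v', ?_, rfl⟩
        rcases eq_or_ne (u', c') (u, t) with e' | e'
        · rw [e'] at hh ⊢; rw [St.setLs_self, Lst.head_push]; exact .inl hh
        · rwa [St.setLs_of_ne _ _ e']
      · exact ⟨u, hu, t, htn, v, by rw [St.setLs_self, Lst.head_push]; exact .inr ⟨h1, rfl⟩, rfl⟩
    · rintro ⟨u', hu', c', hc', v', hh, rfl⟩
      rcases eq_or_ne (u', c') (u, t) with e' | e'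
      · rw [e', St.setLs_self, Lst.head_push] at hh
        obtain ⟨rfl, rfl⟩ := Prod.mk.inj e'
        rcases hh with hh | ⟨h1, rfl⟩
        · exact .inl ⟨_, hu', _, hc', v', hh, rfl⟩
        · exact .inr ⟨h1, rfl⟩
      · rw [St.setLs_of_ne _ _ e'] at hh
        exact .inl ⟨_, hu', _, hc', v', hh, rfl⟩

/-- Reassign the arc into register `7` whose position is in register `8`. -/
def fixStm : Stm :=
  .ite (.bin .lt (.reg 8) (.get (.cntA (.key (.reg 7) .twoN))))
    (.set 6 (.get (.cellA 1 (.key (.reg 7) .twoN) (.reg 8))) ;; detachStm ;; attachStm) .skip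

theorem detachStm_writes : detachStm.writes = [11, 10, 12, 13, 13] := by decide

theorem fixStm_writes :
    fixStm.writes = [6, 11, 10, 12, 13, 13, 12, 13, 13, 10, 11, 12] := by decide

/-- Detaching and attaching again restores the arc set and renews the label of position `i`. If the
list has no position `i`, the program does nothing, and the exception at `i` was vacuous. -/
theorem run_fixStm (hf : Fits n L w) (H : Core n L Arc Z s σ)
    (hadj : ∀ v < n, ∀ u, (σ.ls (v, 2 * n)).Mem u ↔ (u, v) ∈ Arc) (hv : v < n) {i : ℕ}
    (h7 : s.reg 7 = v) (h8 : s.reg 8 = i) :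
    ∃ σ', Core n L Arc Z (fixStm.run w ω s) σ' ∧ SameAdj n σ σ' ∧
      ∀ B, Settled n L σ v (insert i B) → Settled n L σ' v B := by
  have hk : Valid n (v, 2 * n) := ⟨hv, by simp⟩
  have hw := H.wf _ hk
  have ekey := hf.eval_key (k := (v, 2 * n)) H.reg0 (a := .reg 7) h7 (hf.eval_twoN H.reg0) hk
  have elt := Expr.eval_lt (a := .reg 8) h8 (hf.eval_cnt H.rep ekey hk)
  by_cases hi : i < (σ.ls (v, 2 * n)).cnt
  · rw [fixStm, Stm.run_ite_pos (elt.2 hi), Stm.run_seq,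
      Stm.run_set (hf.eval_elt (i := i) H.reg0 H.rep ekey (by simpa) hk (hi.trans_le hw.cnt_le)),
      Stm.run_seq]
    set u := (σ.ls (v, 2 * n)).elt i with hudef
    have hmem : (σ.ls (v, 2 * n)).Mem u := ⟨i, hi, rfl⟩
    have hpos : (σ.ls (v, 2 * n)).pos u = i := (hw i hi).2
    have ha : (u, v) ∈ Arc := (hadj v hv u).1 hmem
    obtain ⟨huv, -, hZ, hc⟩ := H.arc u v ha
    have H0 : Core n L Arc Z (s.setReg 6 u) σ := H.congr (by simp) (by simp) rfl rfl
    have H1 := run_detachStm (ω := ω) hf H0 ha (by simp) (by simpa)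
    set σ1 := σ.setLs (u, σ.asg (u, v)) ((σ.ls (u, σ.asg (u, v))).del v)
    have hs1 : SameAdj n σ σ1 := sameAdj_setLs σ hc _
    set t := tgt n L (σ.ls (v, 2 * n + 1)) v i with htdef
    have htn : t < 2 * n := tgt_lt (H.wf _ ⟨hv, by simp⟩) hv
    have hfr : ∀ q, q ∉ [10, 11, 12, 13] → (detachStm.run w ω (s.setReg 6 u)).reg q =
        (s.setReg 6 u).reg q := fun q hq =>
      Stm.run_reg_of_notMem w ω detachStm _ (by simp [detachStm_writes]; grind)
    have H2 := run_attachStm (ω := ω) (u := u) (v := v) (t := t) hf H1 (by simp) huv hv hZ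
      (by rw [hs1.1 _ _ le_rfl]; exact hmem)
      (by rw [hs1.1 _ _ le_rfl, hs1.1 _ _ (by omega), hpos])
      ((hfr 6 (by simp)).trans (by simp)) ((hfr 7 (by simp)).trans (by simpa))
    refine ⟨_, by simpa [Set.insert_eq_of_mem ha] using H2, hs1.trans ?_, fun B hB => ?_⟩
    · exact sameAdj_setLs (σ1.setAsg (u, v) t) htn _
    · exact Settled.congr (hB.setAsg hw hi)
        (σ' := (σ1.setAsg (u, v) t).setLs (u, t) ((σ1.ls (u, t)).push v))
        (SameAdj.trans (sameAdj_setLs (σ.setAsg (u, v) t) hc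
          ((σ.ls (u, σ.asg (u, v))).del v)) (sameAdj_setLs _ htn _)) rfl
  · rw [fixStm, Stm.run_ite_neg (mt elt.1 hi)]
    refine ⟨σ, H, ⟨fun _ _ _ => rfl, rfl⟩, fun B hB x hx j hj hn => hB x hx j hj ?_⟩
    rintro ⟨rfl, rfl | h⟩
    · exact hi hj
    · exact hn ⟨rfl, h⟩

/-- Reassign the arcs into register `7` of the block whose number is in register `14`. -/
def fixBlockStm : Stm :=
  .rep 9 4
    (.set 8 (.plus (.times (.reg 14) (.reg 4)) (.bin .sub (.reg 9) (.lit 1))) ;; fixStm)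

theorem fixBlockStm_writes :
    fixBlockStm.writes = [9, 8, 6, 11, 10, 12, 13, 13, 12, 13, 13, 10, 11, 12] := by decide

/-- Block `b` consists of the positions from `b * L` to `b * L + L - 1`; each pass removes one of
them from the exceptional set. -/
theorem run_fixBlockStm (hf : Fits n L w) (H : Core n L Arc Z s σ)
    (hadj : ∀ v < n, ∀ u, (σ.ls (v, 2 * n)).Mem u ↔ (u, v) ∈ Arc) (hv : v < n) {b : ℕ}
    (hb : b ≤ n) (h7 : s.reg 7 = v) (h14 : s.reg 14 = b)
    (hS : Settled n L σ v {i | i / L = b ∨ i ∈ B}) :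
    ∃ σ', Core n L Arc Z (fixBlockStm.run w ω s) σ' ∧ SameAdj n σ σ' ∧ Settled n L σ' v B := by
  have hl := hf.large
  have hL := hf.pos
  have hblock := hf.block
  rw [fixBlockStm, Stm.run, H.reg4]
  -- With `j` passes left, only the first `j` positions of the block may be wrong, besides `B`. The
  -- loop variable runs over `j, …, 1`, hence the subtraction of `1` in the position.
  have key : ∀ j ≤ L, ∀ (s : Config) (σ : St), Core n L Arc Z s σ →
      (∀ v < n, ∀ u, (σ.ls (v, 2 * n)).Mem u ↔ (u, v) ∈ Arc) →
      s.reg 7 = v → s.reg 14 = b → Settled n L σ v {i | (b * L ≤ i ∧ i < b * L + j) ∨ i ∈ B} →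
      ∃ σ', Core n L Arc Z (countdown 9 (Stm.run w ω (.set 8 (.plus (.times (.reg 14) (.reg 4))
        (.bin .sub (.reg 9) (.lit 1))) ;; fixStm)) j s) σ' ∧ SameAdj n σ σ' ∧
          Settled n L σ' v B := by
    intro j
    induction j with
    | zero =>
      intro _ s σ H _ _ _ hS
      exact ⟨σ, H.congr (by simp [countdown]) (by simp [countdown]) rfl rfl,
        ⟨fun _ _ _ => rfl, rfl⟩, hS.mono (by
          rintro i (h | h)
          · omega
          · exact h)⟩
    | succ j IH =>
      intro hj s σ H hadj h7 h14 hS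
      -- The block number `b = n` is admitted, since a list of centers may have length up to `n`;
      -- hence the factor `n + 1` in `Fits.block`.
      have hbL : b * L + L ≤ (n + 1) * L := by nlinarith
      rw [countdown, Stm.run_seq, Stm.run_set (v := b * L + j)
        (Expr.eval_plus (Expr.eval_times (x := b) (y := L) (by simpa) (by simpa using H.reg4)
          (by omega)) (Expr.eval_sub (x := j + 1) (y := 1) (by simp) (Expr.eval_lit (by omega)))
          (by omega))]
      have H0 : Core n L Arc Z ((s.setReg 9 (j + 1)).setReg 8 (b * L + j)) σ :=
        H.congr (by simp) (by simp) rfl rfl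
      obtain ⟨σ1, H1, hs1, hS1⟩ := run_fixStm (ω := ω) (v := v) (i := b * L + j) hf H0 hadj hv
        (by simpa) (by simp)
      have hfr : ∀ q, q ∉ [6, 10, 11, 12, 13] →
          (fixStm.run w ω ((s.setReg 9 (j + 1)).setReg 8 (b * L + j))).reg q =
            ((s.setReg 9 (j + 1)).setReg 8 (b * L + j)).reg q := fun q hq =>
        Stm.run_reg_of_notMem w ω fixStm _ (by simp [fixStm_writes]; grind)
      obtain ⟨σ2, H2, hs2, hS2⟩ := IH (by omega) _ σ1 H1
        (fun x hx u => by rw [hs1.1 _ _ le_rfl]; exact hadj x hx u)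
        ((hfr 7 (by simp)).trans (by simpa)) ((hfr 14 (by simp)).trans (by simpa))
        (hS1 _ (hS.mono (by
          intro i
          simp only [Set.mem_ofPred_eq, Set.mem_insert_iff]
          rintro (h | h)
          · omega
          · exact .inr (.inr h))))
      exact ⟨σ2, H2, hs1.trans hs2, hS2⟩
  refine key L le_rfl s σ H hadj h7 h14 (hS.mono ?_)
  rintro i (rfl | h)
  · left
    have := Nat.div_add_mod i L
    have := Nat.mod_lt i hL
    rw [mul_comm]; omega
  · exact .inr h

end Core

/-! ## The update program -/

/-- Invariant of the algorithm: `C` is the set of centers, `Arc` the set of arcs, `Z` the set of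
edges at centers, and `Cl v c` says that `c` is in the list of centers of `v`. -/
structure Inv (n L : ℕ) (C : Set ℕ) (Arc : Set (ℕ × ℕ)) (Z : Set (Sym2 ℕ)) (Cl : ℕ → ℕ → Prop)
    (s : Config) (σ : St) : Prop where
  core : Core n L Arc Z s σ
  adj : ∀ v < n, ∀ u, (σ.ls (v, 2 * n)).Mem u ↔ (u, v) ∈ Arc
  cenl : ∀ v < n, ∀ c, (σ.ls (v, 2 * n + 1)).Mem c ↔ Cl v c
  settled : Settled n L σ 0 ∅
  cen_of_mem : ∀ v < n, v ∈ C → σ.cen v = 1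
  cen_of_notMem : ∀ v < n, v ∉ C → σ.cen v = 0
  avoid : ∀ u v, (u, v) ∈ Arc → u ∉ C ∧ v ∉ C

/-- Insert the arc from register `6` to register `7`. -/
def arcAddStm : Stm :=
  .set 10 (.key (.reg 7) .twoN) ;; .set 11 (.reg 6) ;; pushStm ;; attachStm

/-- Delete the arc from register `6` to register `7`. -/
def arcDelStm : Stm :=
  .set 14 (.get (.cellA 2 (.key (.reg 7) .twoN) (.reg 6))) ;;
  detachStm ;;
  .set 10 (.key (.reg 7) .twoN) ;; .set 11 (.reg 6) ;; delStm ;;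
  .set 8 (.reg 14) ;; fixStm

/-- Add the center in register `a` to the list of centers of the node in register `b`. -/
def cenAddStm (a b : ℕ) : Stm :=
  .ite (.get (.cenA (.reg a)))
    (.set 7 (.reg b) ;; .set 11 (.reg a) ;;
      .set 10 (.key (.reg 7) (.plus .twoN (.lit 1))) ;;
      .set 14 (.get (.cntA (.reg 10))) ;; pushStm ;; fixBlockStm) .skip

/-- Delete the center in register `a` from the list of centers of the node in register `b`. -/
def cenDelStm (a b : ℕ) : Stm :=
  .ite (.get (.cenA (.reg a)))
    (.set 7 (.reg b) ;; .set 11 (.reg a) ;;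
      .set 10 (.key (.reg 7) (.plus .twoN (.lit 1))) ;;
      .set 14 (.get (.cellA 2 (.reg 10) (.reg 11))) ;; delStm ;; fixBlockStm ;;
      .set 14 (.get (.cntA (.key (.reg 7) (.plus .twoN (.lit 1))))) ;; fixBlockStm) .skip

/-- Process an update. -/
def updateStm : Stm :=
  .ite (.plus (.get (.cenA (.reg 2))) (.get (.cenA (.reg 3))))
    (.ite (.reg 1)
      (.addEdge (.reg 2) (.reg 3) ;; cenAddStm 2 3 ;; cenAddStm 3 2)
      (.removeEdge (.reg 2) (.reg 3) ;; cenDelStm 2 3 ;; cenDelStm 3 2))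
    (.ite (.bin .lt (.reg 2) (.reg 3)) (.set 6 (.reg 2) ;; .set 7 (.reg 3))
        (.set 6 (.reg 3) ;; .set 7 (.reg 2)) ;;
      .ite (.reg 1) arcAddStm arcDelStm)

section Update

variable {n L w : ℕ} {ω : ℕ → Fin (2 ^ w)} {s s' : Config} {σ σ' : St} {u v : ℕ} {C : Set ℕ}
  {Arc : Set (ℕ × ℕ)} {Z : Set (Sym2 ℕ)} {Cl : ℕ → ℕ → Prop}

theorem pushStm_writes : pushStm.writes = [12] := by decide

theorem delStm_writes : delStm.writes = [12, 13, 13] := by decide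

/-- The lists with second index at least `2 * n` do not affect the output; of them `Core` asks only
that they are stored and well formed. -/
theorem Core.setAdj (H : Core n L Arc Z s σ) {x j : ℕ} (hj : 2 * n ≤ j) {l : Lst} (hl : l.Wf n)
    (h0 : s'.reg 0 = s.reg 0) (h4 : s'.reg 4 = s.reg 4) (hR : Rep n s'.mem (σ.setLs (x, j) l))
    (ho : s'.out = s.out) : Core n L Arc Z s' (σ.setLs (x, j) l) := by
  have hls : ∀ u, ∀ c < 2 * n, (σ.setLs (x, j) l).ls (u, c) = σ.ls (u, c) := fun u c hc =>
    σ.setLs_of_ne _ (by simp only [ne_eq, Prod.mk.injEq, not_and]; omega)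
  refine ⟨h0.trans H.reg0, h4.trans H.reg4, hR, fun k hk => ?_, H.arc, fun u hu c hc v => ?_,
    fun e => ?_⟩
  · rcases eq_or_ne k (x, j) with rfl | e
    · rwa [St.setLs_self]
    · rw [σ.setLs_of_ne _ e]; exact H.wf k hk
  · rw [hls u c hc]; exact H.lst u hu c hc v
  · rw [ho, H.out]
    refine or_congr_right (exists_congr fun u => and_congr_right fun hu => exists_congr fun c =>
      and_congr_right fun hc => ?_)
    rw [hls u c hc]

/-- An edge that carries no arc can enter `Z` without meeting the heads of lists. The next lemma is
its counterpart for removal, where no head may lose its edge. -/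
theorem Core.addEdge (H : Core n L Arc Z s σ) {e : Sym2 ℕ}
    (he : ∀ u v, (u, v) ∈ Arc → s(u, v) ≠ e) :
    Core n L Arc (insert e Z) { s with out := s.out ∪ {e} } σ where
  reg0 := H.reg0
  reg4 := H.reg4
  rep := H.rep
  wf := H.wf
  arc u v h := by
    obtain ⟨h1, h2, h3, h4⟩ := H.arc u v h
    exact ⟨h1, h2, by simp [he u v h, h3], h4⟩
  lst := H.lst
  out f := by
    simp only [Set.mem_union, H.out, Set.mem_insert_iff, Set.mem_singleton_iff]
    rw [or_right_comm, or_comm (a := f ∈ Z)]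

theorem Core.removeEdge (H : Core n L Arc Z s σ) {e : Sym2 ℕ}
    (he : ∀ u v, (u, v) ∈ Arc → s(u, v) ≠ e) :
    Core n L Arc (Z \ {e}) { s with out := s.out \ {e} } σ where
  reg0 := H.reg0
  reg4 := H.reg4
  rep := H.rep
  wf := H.wf
  arc u v h := by
    obtain ⟨h1, h2, h3, h4⟩ := H.arc u v h
    exact ⟨h1, h2, fun h => h3 h.1, h4⟩
  lst := H.lst
  out f := by
    simp only [Set.mem_sdiff, H.out, Set.mem_singleton_iff, or_and_right]
    refine or_congr_right ⟨fun h => h.1, fun h => ⟨h, ?_⟩⟩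
    obtain ⟨u, hu, c, hc, v, hh, rfl⟩ := h
    exact he u v (H.arc_of_head hu hc hh).1

/-- The new tail goes to the end of the list, so all other arcs keep their positions and hence their
labels. -/
theorem run_arcAddStm (hf : Fits n L w) (H : Inv n L C Arc Z Cl s σ) (huv : u < v) (hv : v < n)
    (hZ : s(u, v) ∉ Z) (h : (u, v) ∉ Arc) (huC : u ∉ C) (hvC : v ∉ C) (h6 : s.reg 6 = u)
    (h7 : s.reg 7 = v) :
    ∃ σ', Inv n L C (insert (u, v) Arc) Z Cl (arcAddStm.run w ω s) σ' := by
  have hu : u < n := by omega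
  have hk : Valid n (v, 2 * n) := ⟨hv, by simp⟩
  have hw := H.core.wf _ hk
  have hm : ¬ (σ.ls (v, 2 * n)).Mem u := fun h' => h ((H.adj v hv u).1 h')
  have hw' := hw.push hm hu
  rw [arcAddStm, Stm.run_seq, Stm.run_set (hf.eval_key (k := (v, 2 * n)) H.core.reg0 (by simpa)
    (hf.eval_twoN H.core.reg0) hk), Stm.run_seq, Stm.run_set (v := u) (by simpa), Stm.run_seq]
  generalize hs1 : (s.setReg 10 (enc n (v, 2 * n))).setReg 11 u = s1
  have H1 : Core n L Arc Z s1 σ :=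
    H.core.congr (by simp [← hs1]) (by simp [← hs1]) (by simp [← hs1]) (by simp [← hs1])
  obtain ⟨hR, ho⟩ := run_pushStm (ω := ω) (k := (v, 2 * n)) (x := u) hf H1.reg0 H1.rep
    (by simp [← hs1]) (by simp [← hs1]) hk hu (hw.cnt_lt hm hu)
  have hfr : ∀ q, q ≠ 12 → (pushStm.run w ω s1).reg q = s1.reg q :=
    fun q hq => Stm.run_reg_of_notMem w ω pushStm _ (by simpa [pushStm_writes] using hq)
  have H2 := H1.setAdj (s' := pushStm.run w ω s1) le_rfl hw' (hfr 0 (by simp)) (hfr 4 (by simp))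
    hR ho
  generalize hσ1 : σ.setLs (v, 2 * n) ((σ.ls (v, 2 * n)).push u) = σ1 at H2
  have e1 : σ1.ls (v, 2 * n) = (σ.ls (v, 2 * n)).push u := by rw [← hσ1, St.setLs_self]
  have e2 : ∀ k ≠ (v, 2 * n), σ1.ls k = σ.ls k := fun k hk => by
    rw [← hσ1, σ.setLs_of_ne _ hk]
  have e3 : ∀ x, σ1.ls (x, 2 * n + 1) = σ.ls (x, 2 * n + 1) := fun x => e2 _ (by simp)
  have hwf1 : (σ1.ls (v, 2 * n)).Wf n := by rwa [e1]
  have hm1 : (σ1.ls (v, 2 * n)).Mem u := by rw [e1, Lst.mem_push]; exact .inr rfl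
  have hpos : (σ1.ls (v, 2 * n)).pos u = (σ.ls (v, 2 * n)).cnt := by simp [e1, Lst.push]
  have hlt := hwf1.pos_lt hm1
  have helt := hwf1.elt_pos hm1
  rw [hpos] at hlt helt
  have H3 := run_attachStm (ω := ω) hf H2 h huv hv hZ hm1 rfl
    ((hfr 6 (by simp)).trans (by simp [← hs1, h6])) ((hfr 7 (by simp)).trans (by simp [← hs1, h7]))
  rw [hpos] at H3
  set t := tgt n L (σ1.ls (v, 2 * n + 1)) v (σ.ls (v, 2 * n)).cnt with htdef
  have htn : t < 2 * n := tgt_lt (H2.wf _ ⟨hv, by simp⟩) hv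
  -- The old length is the position of the new tail, the only one without a proper label.
  have hS1 : Settled n L σ1 v (insert (σ.ls (v, 2 * n)).cnt ∅) := by
    intro x hx i hi hn
    have hasg : σ1.asg = σ.asg := by rw [← hσ1]; rfl
    rw [e3, hasg]
    rcases eq_or_ne x v with rfl | e
    · rw [e1] at hi ⊢
      have hi' : i < (σ.ls (x, 2 * n)).cnt := by
        rcases Nat.lt_succ_iff_lt_or_eq.mp hi with h | rfl
        · exact h
        · exact absurd ⟨rfl, by simp⟩ hn
      rw [Lst.elt_push_of_lt hi']
      exact H.settled x hx i hi' (by simp)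
    · have : (x, 2 * n) ≠ (v, 2 * n) := by simpa using e
      rw [e2 _ this] at hi ⊢
      exact H.settled x hx i hi (by simp)
  have hS2 := hS1.setAsg hwf1 hlt
  rw [helt, ← htdef] at hS2
  have hsame := sameAdj_setLs (σ1.setAsg (u, v) t) (u := u) htn ((σ1.ls (u, t)).push v)
  have hcen : σ1.cen = σ.cen := by rw [← hσ1]; rfl
  refine ⟨_, H3, ?_, ?_, ((hS2.congr hsame rfl).change 0), ?_, ?_, ?_⟩
  · intro x hx y
    rw [hsame.1 _ _ le_rfl, St.setAsg_ls, Set.mem_insert_iff, ← H.adj x hx y]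
    rcases eq_or_ne x v with rfl | e
    · rw [e1, Lst.mem_push]; simp [or_comm]
    · have : (x, 2 * n) ≠ (v, 2 * n) := by simpa using e
      rw [e2 _ this]; simp [e]
  · intro x hx y
    rw [hsame.1 _ _ (by omega), St.setAsg_ls, e3]
    exact H.cenl x hx y
  · intro x hx hxC; rw [hsame.2, St.setAsg_cen, hcen]; exact H.cen_of_mem x hx hxC
  · intro x hx hxC; rw [hsame.2, St.setAsg_cen, hcen]; exact H.cen_of_notMem x hx hxC
  · rintro x y (e | hxy)
    · obtain ⟨rfl, rfl⟩ := Prod.mk.inj e; exact ⟨huC, hvC⟩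
    · exact H.avoid x y hxy

/-- Only the last tail changes its position: it moves to the position `p` of the deleted one, which
is then fixed. If the deleted tail was last, `p` is beyond the end and nothing is wrong. Register
`14` keeps `p`, since detaching overwrites registers `10` to `13`. -/
theorem run_arcDelStm (hf : Fits n L w) (H : Inv n L C Arc Z Cl s σ) (h : (u, v) ∈ Arc)
    (h6 : s.reg 6 = u) (h7 : s.reg 7 = v) :
    ∃ σ', Inv n L C (Arc \ {(u, v)}) Z Cl (arcDelStm.run w ω s) σ' := by
  obtain ⟨huv, hv, hZ, hc⟩ := H.core.arc u v h
  have hu : u < n := by omega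
  have hk : Valid n (v, 2 * n) := ⟨hv, by simp⟩
  have hw := H.core.wf _ hk
  have hm : (σ.ls (v, 2 * n)).Mem u := (H.adj v hv u).2 h
  have hw' := hw.del hm
  have hp := hw.pos_lt hm
  have he := hw.elt_pos hm
  set p := (σ.ls (v, 2 * n)).pos u with hpdef
  have ekey := hf.eval_key (k := (v, 2 * n)) H.core.reg0 (a := .reg 7) h7
    (hf.eval_twoN H.core.reg0) hk
  rw [arcDelStm, Stm.run_seq, Stm.run_set (v := p)
    (hf.eval_pos H.core.reg0 H.core.rep ekey (by simpa) hk hu), Stm.run_seq]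
  have H0 : Core n L Arc Z (s.setReg 14 p) σ := H.core.congr (by simp) (by simp) rfl rfl
  have H1 := run_detachStm (ω := ω) hf H0 h (by simpa) (by simpa)
  have hfr : ∀ q, q ∉ [10, 11, 12, 13] → (detachStm.run w ω (s.setReg 14 p)).reg q =
      (s.setReg 14 p).reg q := fun q hq =>
    Stm.run_reg_of_notMem w ω detachStm _ (by simp [detachStm_writes]; grind)
  generalize hs1 : detachStm.run w ω (s.setReg 14 p) = s1 at H1 hfr
  generalize hl1 : (σ.ls (u, σ.asg (u, v))).del v = l1 at H1
  have hsame := sameAdj_setLs σ (u := u) hc l1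
  generalize hσ1 : σ.setLs (u, σ.asg (u, v)) l1 = σ1 at H1 hsame
  have hasg1 : σ1.asg = σ.asg := by rw [← hσ1]; rfl
  have r6 : s1.reg 6 = u := (hfr 6 (by simp)).trans (by simpa)
  have r7 : s1.reg 7 = v := (hfr 7 (by simp)).trans (by simpa)
  have r14 : s1.reg 14 = p := (hfr 14 (by simp)).trans (by simp)
  rw [Stm.run_seq, Stm.run_set (hf.eval_key (k := (v, 2 * n)) H1.reg0 (by simpa)
    (hf.eval_twoN H1.reg0) hk), Stm.run_seq, Stm.run_set (v := u) (by simpa), Stm.run_seq]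
  generalize hs2 : (s1.setReg 10 (enc n (v, 2 * n))).setReg 11 u = s2
  have H2 : Core n L (Arc \ {(u, v)}) Z s2 σ1 :=
    H1.congr (by simp [← hs2]) (by simp [← hs2]) (by simp [← hs2]) (by simp [← hs2])
  have el : σ1.ls (v, 2 * n) = σ.ls (v, 2 * n) := hsame.1 _ _ le_rfl
  obtain ⟨hR, ho⟩ := run_delStm (ω := ω) (k := (v, 2 * n)) (x := u) hf H2.reg0 H2.rep
    (by simp [← hs2]) (by simp [← hs2]) hk (by rwa [el]) (by rwa [el])
  have hfr2 : ∀ q, q ∉ [12, 13] → (delStm.run w ω s2).reg q = s2.reg q :=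
    fun q hq => Stm.run_reg_of_notMem w ω delStm _ (by simpa [delStm_writes] using hq)
  rw [el] at hR
  have H3 := H2.setAdj (s' := delStm.run w ω s2) le_rfl hw' (hfr2 0 (by simp)) (hfr2 4 (by simp))
    hR ho
  generalize hs3 : delStm.run w ω s2 = s3 at H3 hfr2
  generalize hσ2 : σ1.setLs (v, 2 * n) ((σ.ls (v, 2 * n)).del u) = σ2 at H3
  have e1 : σ2.ls (v, 2 * n) = (σ.ls (v, 2 * n)).del u := by rw [← hσ2, St.setLs_self]
  have e2 : ∀ x ≠ v, σ2.ls (x, 2 * n) = σ.ls (x, 2 * n) := fun x hx => by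
    rw [← hσ2, σ1.setLs_of_ne _ (by simpa using hx), hsame.1 _ _ le_rfl]
  have e3 : ∀ x, σ2.ls (x, 2 * n + 1) = σ.ls (x, 2 * n + 1) := fun x => by
    rw [← hσ2, σ1.setLs_of_ne _ (by simp), hsame.1 _ _ (by omega)]
  have hasg2 : σ2.asg = σ.asg := by rw [← hσ2, ← hasg1]; rfl
  have hcen2 : σ2.cen = σ.cen := by rw [← hσ2, ← hsame.2]; rfl
  rw [Stm.run_seq, Stm.run_set (v := p) (by
    rw [Expr.eval_reg, hfr2 14 (by simp), ← hs2]; simpa)]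
  have hadj : ∀ x < n, ∀ y, (σ2.ls (x, 2 * n)).Mem y ↔ (y, x) ∈ Arc \ {(u, v)} := by
    intro x hx y
    rw [Set.mem_sdiff, ← H.adj x hx y]
    rcases eq_or_ne x v with rfl | e
    · rw [e1, hw.mem_del hm]; simp
    · rw [e2 _ e]; simp [e]
  have hS : Settled n L σ2 v (insert p ∅) := by
    intro x hx i hi hn
    rw [e3, hasg2]
    rcases eq_or_ne x v with rfl | e
    · rw [e1] at hi ⊢
      have hip : i ≠ p := fun e => hn ⟨rfl, by simp [e]⟩
      rw [Lst.elt_del, if_neg hip]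
      exact H.settled x hx i (lt_of_lt_of_le hi (Nat.sub_le _ _)) (by simp)
    · rw [e2 _ e] at hi ⊢
      exact H.settled x hx i hi (by simp)
  have H4 : Core n L (Arc \ {(u, v)}) Z (s3.setReg 8 p) σ2 :=
    H3.congr (by simp) (by simp) rfl rfl
  obtain ⟨σ3, H5, hs5, hS5⟩ := run_fixStm (ω := ω) (v := v) (i := p) hf H4 hadj hv
    (by rw [Config.setReg_reg, if_neg (by simp), hfr2 7 (by simp), ← hs2]; simpa) (by simp)
  refine ⟨σ3, H5, ?_, ?_, (hS5 ∅ hS).change 0, ?_, ?_, ?_⟩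
  · intro x hx y; rw [hs5.1 _ _ le_rfl]; exact hadj x hx y
  · intro x hx y; rw [hs5.1 _ _ (by omega), e3]; exact H.cenl x hx y
  · intro x hx hxC; rw [hs5.2, hcen2]; exact H.cen_of_mem x hx hxC
  · intro x hx hxC; rw [hs5.2, hcen2]; exact H.cen_of_notMem x hx hxC
  · intro x y hxy; exact H.avoid x y hxy.1

theorem Inv.eval_cen (hf : Fits n L w) (H : Inv n L C Arc Z Cl s σ) {a : ℕ} (ha : s.reg a = u)
    (hu : u < n) : (Expr.get (.cenA (.reg a))).eval w s ≠ 0 ↔ u ∈ C := by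
  rw [hf.eval_cen H.core.rep (a := .reg a) ha hu]
  by_cases h : u ∈ C
  · simp [H.cen_of_mem u hu h, h]
  · simp [H.cen_of_notMem u hu h, h]

theorem Inv.congr_list (H : Inv n L C Arc Z Cl s σ) {Cl' : ℕ → ℕ → Prop}
    (h : ∀ v < n, ∀ c, Cl v c ↔ Cl' v c) : Inv n L C Arc Z Cl' s σ :=
  { H with cenl := fun v hv c => (H.cenl v hv c).trans (h v hv c) }

/-- The new center takes the slot whose number is the old length, so exactly the arcs of that block
change from the dummy to a center. The bound `a < 7` protects register `a` when register `7` is set.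
-/
theorem run_cenAddStm (hf : Fits n L w) (H : Inv n L C Arc Z Cl s σ) (hu : u < n) (hv : v < n)
    {a b : ℕ} (ha : a < 7) (ha' : s.reg a = u) (hb' : s.reg b = v) (h : u ∈ C → ¬ Cl v u) :
    ∃ σ', Inv n L C Arc Z (fun x c => Cl x c ∨ (u ∈ C ∧ x = v ∧ c = u))
      ((cenAddStm a b).run w ω s) σ' := by
  have hcen := H.eval_cen hf ha' hu
  by_cases huC : u ∈ C
  swap
  · rw [cenAddStm, Stm.run_ite_neg (mt hcen.1 huC)]
    exact ⟨σ, H.congr_list fun v hv c => by simp [huC]⟩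
  have hk : Valid n (v, 2 * n + 1) := ⟨hv, by simp⟩
  have hw := H.core.wf _ hk
  have hm : ¬ (σ.ls (v, 2 * n + 1)).Mem u := fun h' => h huC ((H.cenl v hv u).1 h')
  have hw' := hw.push hm hu
  rw [cenAddStm, Stm.run_ite_pos (hcen.2 huC), Stm.run_seq, Stm.run_set (v := v) (by simpa),
    Stm.run_seq, Stm.run_set (v := u) (by simp [ha.ne, ha']), Stm.run_seq,
    Stm.run_set (hf.eval_key (k := (v, 2 * n + 1)) (by simpa using H.core.reg0) (by simp)
      (hf.eval_twoN_one (by simpa using H.core.reg0)) hk), Stm.run_seq,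
    Stm.run_set (hf.eval_cnt (σ := σ) (k := (v, 2 * n + 1)) (by exact H.core.rep) (by simp) hk),
    Stm.run_seq]
  generalize hs1 : (((s.setReg 7 v).setReg 11 u).setReg 10 (enc n (v, 2 * n + 1))).setReg 14
    (σ.ls (v, 2 * n + 1)).cnt = s1
  have H1 : Core n L Arc Z s1 σ :=
    H.core.congr (by simp [← hs1]) (by simp [← hs1]) (by simp [← hs1]) (by simp [← hs1])
  obtain ⟨hR, ho⟩ := run_pushStm (ω := ω) (k := (v, 2 * n + 1)) (x := u) hf H1.reg0 H1.rep
    (by simp [← hs1]) (by simp [← hs1]) hk hu (hw.cnt_lt hm hu)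
  have hfr : ∀ q, q ≠ 12 → (pushStm.run w ω s1).reg q = s1.reg q :=
    fun q hq => Stm.run_reg_of_notMem w ω pushStm _ (by simpa [pushStm_writes] using hq)
  have H2 := H1.setAdj (s' := pushStm.run w ω s1) (Nat.le_succ _) hw' (hfr 0 (by simp))
    (hfr 4 (by simp)) hR ho
  generalize hσ1 : σ.setLs (v, 2 * n + 1) ((σ.ls (v, 2 * n + 1)).push u) = σ1 at H2
  have e1 : σ1.ls (v, 2 * n + 1) = (σ.ls (v, 2 * n + 1)).push u := by rw [← hσ1, St.setLs_self]
  have e2 : ∀ x ≠ v, σ1.ls (x, 2 * n + 1) = σ.ls (x, 2 * n + 1) := fun x hx => by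
    rw [← hσ1, σ.setLs_of_ne _ (by simpa using hx)]
  have e3 : ∀ x, σ1.ls (x, 2 * n) = σ.ls (x, 2 * n) := fun x => by
    rw [← hσ1, σ.setLs_of_ne _ (by simp)]
  have hasg1 : σ1.asg = σ.asg := by rw [← hσ1]; rfl
  have hcen1 : σ1.cen = σ.cen := by rw [← hσ1]; rfl
  have hadj : ∀ v < n, ∀ u, (σ1.ls (v, 2 * n)).Mem u ↔ (u, v) ∈ Arc := fun x hx y => by
    rw [e3]; exact H.adj x hx y
  have hS1 : Settled n L σ1 v {i | i / L = (σ.ls (v, 2 * n + 1)).cnt ∨ i ∈ (∅ : Set ℕ)} := by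
    intro x hx i hi hn
    rw [e3] at hi
    rw [e3, hasg1, H.settled x hx i hi (by simp)]
    rcases eq_or_ne x v with rfl | e
    · have hne : i / L ≠ (σ.ls (x, 2 * n + 1)).cnt := fun e => hn ⟨rfl, .inl e⟩
      rw [e1, tgt, tgt]
      have : i / L < ((σ.ls (x, 2 * n + 1)).push u).cnt ↔ i / L < (σ.ls (x, 2 * n + 1)).cnt := by
        simp only [Lst.push]; omega
      simp only [this]
      split_ifs with h
      · rw [Lst.elt_push_of_lt h]
      · rfl
    · rw [e2 x e]
  obtain ⟨σ2, H3, hs3, hS3⟩ := run_fixBlockStm (ω := ω) hf H2 hadj hv hw.cnt_le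
    ((hfr 7 (by simp)).trans (by simp [← hs1])) ((hfr 14 (by simp)).trans (by simp [← hs1])) hS1
  refine ⟨σ2, H3, ?_, ?_, hS3.change 0, ?_, ?_, H.avoid⟩
  · intro x hx y; rw [hs3.1 _ _ le_rfl]; exact hadj x hx y
  · intro x hx y
    rw [hs3.1 _ _ (by omega)]
    rcases eq_or_ne x v with rfl | e
    · rw [e1, Lst.mem_push, H.cenl x hx]; simp [huC]
    · rw [e2 x e, H.cenl x hx]; simp [e]
  · intro x hx hxC; rw [hs3.2, hcen1]; exact H.cen_of_mem x hx hxC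
  · intro x hx hxC; rw [hs3.2, hcen1]; exact H.cen_of_notMem x hx hxC

/-- Two blocks are disturbed: that of the deleted center, now served by the former last center, and
that of the vacated last slot, whose arcs fall back to the dummy. -/
theorem run_cenDelStm (hf : Fits n L w) (H : Inv n L C Arc Z Cl s σ) (hu : u < n) (hv : v < n)
    {a b : ℕ} (ha : a < 7) (ha' : s.reg a = u) (hb' : s.reg b = v) (h : u ∈ C → Cl v u) :
    ∃ σ', Inv n L C Arc Z (fun x c => Cl x c ∧ ¬ (u ∈ C ∧ x = v ∧ c = u))
      ((cenDelStm a b).run w ω s) σ' := by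
  have hcen := H.eval_cen hf ha' hu
  by_cases huC : u ∈ C
  swap
  · rw [cenDelStm, Stm.run_ite_neg (mt hcen.1 huC)]
    exact ⟨σ, H.congr_list fun v hv c => by simp [huC]⟩
  have hk : Valid n (v, 2 * n + 1) := ⟨hv, by simp⟩
  have hw := H.core.wf _ hk
  have hm : (σ.ls (v, 2 * n + 1)).Mem u := (H.cenl v hv u).2 (h huC)
  have hw' := hw.del hm
  have hp := hw.pos_lt hm
  set p := (σ.ls (v, 2 * n + 1)).pos u with hpdef
  rw [cenDelStm, Stm.run_ite_pos (hcen.2 huC), Stm.run_seq, Stm.run_set (v := v) (by simpa),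
    Stm.run_seq, Stm.run_set (v := u) (by simp [ha.ne, ha']), Stm.run_seq,
    Stm.run_set (hf.eval_key (k := (v, 2 * n + 1)) (by simpa using H.core.reg0) (by simp)
      (hf.eval_twoN_one (by simpa using H.core.reg0)) hk), Stm.run_seq,
    Stm.run_set (v := p) (hf.eval_pos (σ := σ) (k := (v, 2 * n + 1)) (i := u)
      (by simpa using H.core.reg0) (by exact H.core.rep) (by simp) (by simp) hk hu),
    Stm.run_seq]
  generalize hs1 : (((s.setReg 7 v).setReg 11 u).setReg 10 (enc n (v, 2 * n + 1))).setReg 14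
    p = s1
  have H1 : Core n L Arc Z s1 σ :=
    H.core.congr (by simp [← hs1]) (by simp [← hs1]) (by simp [← hs1]) (by simp [← hs1])
  obtain ⟨hR, ho⟩ := run_delStm (ω := ω) (k := (v, 2 * n + 1)) (x := u) hf H1.reg0 H1.rep
    (by simp [← hs1]) (by simp [← hs1]) hk hw hm
  have hfr : ∀ q, q ∉ [12, 13] → (delStm.run w ω s1).reg q = s1.reg q :=
    fun q hq => Stm.run_reg_of_notMem w ω delStm _ (by simpa [delStm_writes] using hq)
  have H2 := H1.setAdj (s' := delStm.run w ω s1) (Nat.le_succ _) hw' (hfr 0 (by simp))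
    (hfr 4 (by simp)) hR ho
  generalize hσ1 : σ.setLs (v, 2 * n + 1) ((σ.ls (v, 2 * n + 1)).del u) = σ1 at H2
  have e1 : σ1.ls (v, 2 * n + 1) = (σ.ls (v, 2 * n + 1)).del u := by rw [← hσ1, St.setLs_self]
  have e2 : ∀ x ≠ v, σ1.ls (x, 2 * n + 1) = σ.ls (x, 2 * n + 1) := fun x hx => by
    rw [← hσ1, σ.setLs_of_ne _ (by simpa using hx)]
  have e3 : ∀ x, σ1.ls (x, 2 * n) = σ.ls (x, 2 * n) := fun x => by
    rw [← hσ1, σ.setLs_of_ne _ (by simp)]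
  have hasg1 : σ1.asg = σ.asg := by rw [← hσ1]; rfl
  have hcen1 : σ1.cen = σ.cen := by rw [← hσ1]; rfl
  have hadj : ∀ v < n, ∀ u, (σ1.ls (v, 2 * n)).Mem u ↔ (u, v) ∈ Arc := fun x hx y => by
    rw [e3]; exact H.adj x hx y
  have hcnt : (σ1.ls (v, 2 * n + 1)).cnt = (σ.ls (v, 2 * n + 1)).cnt - 1 := by rw [e1]; rfl
  -- The exceptions are nested so that the first repair removes block `p` and the second removes the
  -- block whose number is the new length.
  have hS1 : Settled n L σ1 v
      {i | i / L = p ∨ i ∈ {i | i / L = (σ1.ls (v, 2 * n + 1)).cnt ∨ i ∈ (∅ : Set ℕ)}} := by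
    intro x hx i hi hn
    rw [e3] at hi
    rw [e3, hasg1, H.settled x hx i hi (by simp)]
    rcases eq_or_ne x v with rfl | e
    · have hne : i / L ≠ p := fun e => hn ⟨rfl, .inl e⟩
      have hne' : i / L ≠ (σ.ls (x, 2 * n + 1)).cnt - 1 := fun e =>
        hn ⟨rfl, .inr (.inl (by rw [e, hcnt]))⟩
      rw [tgt, tgt, e1, Lst.elt_del, if_neg hne]
      have : i / L < ((σ.ls (x, 2 * n + 1)).del u).cnt ↔ i / L < (σ.ls (x, 2 * n + 1)).cnt := by
        simp only [Lst.del]; omega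
      simp only [this]
    · rw [e2 x e]
  have r7 := (hfr 7 (by simp)).trans (show s1.reg 7 = v by simp [← hs1])
  obtain ⟨σ2, H3, hs3, hS3⟩ := run_fixBlockStm (ω := ω) hf H2 hadj hv (hp.le.trans hw.cnt_le)
    r7 ((hfr 14 (by simp)).trans (by simp [← hs1])) hS1
  rw [Stm.run_seq, Stm.run_seq]
  generalize hs4 : fixBlockStm.run w ω (delStm.run w ω s1) = s4 at H3
  have q7 : s4.reg 7 = v := by
    rw [← hs4, ← r7]
    exact Stm.run_reg_of_notMem w ω fixBlockStm _ (by simp [fixBlockStm_writes])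
  rw [Stm.run_set (hf.eval_cnt (k := (v, 2 * n + 1)) H3.rep (hf.eval_key H3.reg0 (by simpa)
    (hf.eval_twoN_one H3.reg0) hk) hk)]
  have H4 : Core n L Arc Z (s4.setReg 14 (σ2.ls (v, 2 * n + 1)).cnt) σ2 :=
    H3.congr (by simp) (by simp) rfl rfl
  have hadj2 : ∀ v < n, ∀ u, (σ2.ls (v, 2 * n)).Mem u ↔ (u, v) ∈ Arc := fun x hx y => by
    rw [hs3.1 _ _ le_rfl]; exact hadj x hx y
  rw [← hs3.1 _ _ (by omega)] at hS3
  obtain ⟨σ3, H5, hs5, hS5⟩ := run_fixBlockStm (ω := ω) hf H4 hadj2 hv (H4.wf _ hk).cnt_le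
    (by simpa) (by simp) hS3
  refine ⟨σ3, H5, ?_, ?_, hS5.change 0, ?_, ?_, H.avoid⟩
  · intro x hx y; rw [hs5.1 _ _ le_rfl]; exact hadj2 x hx y
  · intro x hx y
    rw [hs5.1 _ _ (by omega), hs3.1 _ _ (by omega)]
    rcases eq_or_ne x v with rfl | e
    · rw [e1, hw.mem_del hm, H.cenl x hx]; simp [huC]
    · rw [e2 x e, H.cenl x hx]; simp [e]
  · intro x hx hxC; rw [hs5.2, hs3.2, hcen1]; exact H.cen_of_mem x hx hxC
  · intro x hx hxC; rw [hs5.2, hs3.2, hcen1]; exact H.cen_of_notMem x hx hxC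

end Update

/-- The edges avoiding the centers, directed upwards. -/
def arcs (C : Set ℕ) (R : ℕ → ℕ → Prop) : Set (ℕ × ℕ) :=
  {p | R p.1 p.2 ∧ p.1 < p.2 ∧ p.1 ∉ C ∧ p.2 ∉ C}

/-- The edges at centers. -/
def cenEdges (C : Set ℕ) (R : ℕ → ℕ → Prop) : Set (Sym2 ℕ) :=
  {e | ∃ a b, R a b ∧ a ∈ C ∧ e = s(a, b)}

theorem mk_mem_cenEdges {C : Set ℕ} {R : ℕ → ℕ → Prop} (hR : ∀ ⦃a b⦄, R a b → R b a) {a b : ℕ} :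
    s(a, b) ∈ cenEdges C R ↔ R a b ∧ (a ∈ C ∨ b ∈ C) := by
  constructor
  · rintro ⟨x, y, h, hx, e⟩
    rcases Sym2.eq_iff.1 e with ⟨rfl, rfl⟩ | ⟨rfl, rfl⟩
    · exact ⟨h, .inl hx⟩
    · exact ⟨hR h, .inr hx⟩
  · rintro ⟨h, ha | hb⟩
    · exact ⟨a, b, h, ha, rfl⟩
    · exact ⟨b, a, hR h, hb, Sym2.eq_swap⟩

/-- Invariant of the algorithm for the graph with adjacency relation `R`. -/
def GraphInv (n L : ℕ) (C : Set ℕ) (R : ℕ → ℕ → Prop) (s : Config) : Prop :=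
  ∃ σ, Inv n L C (arcs C R) (cenEdges C R) (fun v c => c ∈ C ∧ R c v) s σ

/-! ### Updates of the graph preserve the invariant -/

section GraphUpdate

variable {n L w : ℕ} {ω : ℕ → Fin (2 ^ w)} {s s' : Config} {u v : ℕ} {C : Set ℕ}
  {R : ℕ → ℕ → Prop}

theorem GraphInv.congr (h : GraphInv n L C R s) (h0 : s'.reg 0 = s.reg 0)
    (h4 : s'.reg 4 = s.reg 4) (hm : s'.mem = s.mem) (ho : s'.out = s.out) :
    GraphInv n L C R s' := by
  obtain ⟨σ, H⟩ := h
  exact ⟨σ, { H with core := H.core.congr h0 h4 hm ho }⟩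

theorem cenAddStm_writes (a b : ℕ) : (cenAddStm a b).writes =
    [7, 11, 10, 14, 12, 9, 8, 6, 11, 10, 12, 13, 13, 12, 13, 13, 10, 11, 12] := by
  simp [cenAddStm, Stm.writes, pushStm_writes, fixBlockStm_writes]

theorem cenDelStm_writes (a b : ℕ) : (cenDelStm a b).writes =
    [7, 11, 10, 14, 12, 13, 13, 9, 8, 6, 11, 10, 12, 13, 13, 12, 13, 13, 10, 11, 12, 14, 9, 8, 6,
      11, 10, 12, 13, 13, 12, 13, 13, 10, 11, 12] := by
  simp [cenDelStm, Stm.writes, delStm_writes, fixBlockStm_writes]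

/-- The guard that recognizes edges at centers. -/
theorem Inv.eval_guard (hf : Fits n L w) {Arc : Set (ℕ × ℕ)} {Z : Set (Sym2 ℕ)}
    {Cl : ℕ → ℕ → Prop} {σ : St} (H : Inv n L C Arc Z Cl s σ) (h2 : s.reg 2 = u)
    (h3 : s.reg 3 = v) (hu : u < n) (hv : v < n) :
    (Expr.plus (.get (.cenA (.reg 2))) (.get (.cenA (.reg 3)))).eval w s ≠ 0 ↔ u ∈ C ∨ v ∈ C := by
  have hl := hf.large
  have hu1 : σ.cen u ≤ 1 := by
    by_cases h : u ∈ C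
    · rw [H.cen_of_mem u hu h]
    · rw [H.cen_of_notMem u hu h]; omega
  have hv1 : σ.cen v ≤ 1 := by
    by_cases h : v ∈ C
    · rw [H.cen_of_mem v hv h]
    · rw [H.cen_of_notMem v hv h]; omega
  rw [Expr.eval_plus (hf.eval_cen H.core.rep (a := .reg 2) h2 hu)
    (hf.eval_cen H.core.rep (a := .reg 3) h3 hv) (by omega)]
  by_cases h : u ∈ C <;> by_cases h' : v ∈ C
  all_goals first | rw [H.cen_of_mem u hu h] | rw [H.cen_of_notMem u hu h]
  all_goals first | rw [H.cen_of_mem v hv h'] | rw [H.cen_of_notMem v hv h']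
  all_goals simp [h, h']

/-- Ordering the end nodes of the edge. -/
theorem run_order (hne : u ≠ v) (h2 : s.reg 2 = u) (h3 : s.reg 3 = v) :
    Stm.run w ω (.ite (.bin .lt (.reg 2) (.reg 3)) (.set 6 (.reg 2) ;; .set 7 (.reg 3))
        (.set 6 (.reg 3) ;; .set 7 (.reg 2))) s =
      (s.setReg 6 (min u v)).setReg 7 (max u v) := by
  have hlt := Expr.eval_lt (w := w) (s := s) (a := .reg 2) (b := .reg 3) h2 h3
  rcases lt_or_gt_of_ne hne with h | h
  · rw [Stm.run_ite_pos (hlt.2 h), min_eq_left h.le, max_eq_right h.le]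
    simp [Stm.run, h2, h3]
  · rw [Stm.run_ite_neg (mt hlt.1 (by omega)), min_eq_right h.le, max_eq_left h.le]
    simp [Stm.run, h2, h3]

theorem mk_min_max (u v : ℕ) : s(min u v, max u v) = s(u, v) := by
  rcases le_total u v with h | h
  · rw [min_eq_left h, max_eq_right h]
  · rw [min_eq_right h, max_eq_left h, Sym2.eq_swap]

theorem pair_eq_min_max {a b : ℕ} (h : a < b) : s(a, b) = s(u, v) ↔ (a, b) = (min u v, max u v) := by
  rw [Sym2.eq_iff, Prod.mk.injEq]; omega

theorem min_max_notMem (h : ¬ (u ∈ C ∨ v ∈ C)) : min u v ∉ C ∧ max u v ∉ C := by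
  push Not at h
  rcases le_total u v with h' | h'
  · rw [min_eq_left h', max_eq_right h']; exact h
  · rw [min_eq_right h', max_eq_left h']; exact h.symm

/-- An edge at a center changes `cenEdges` and lists of centers but no arc; any other edge changes
one arc and no list of centers. The program tries both end nodes as centers, and a call for a node
that is no center does nothing. -/
theorem run_updateStm_insert (hf : Fits n L w) (hR : ∀ ⦃a b⦄, R a b → R b a) (h : GraphInv n L C R s)
    (hne : u ≠ v) (hu : u < n) (hv : v < n) (huv : ¬ R u v) (h1 : s.reg 1 = 1)
    (h2 : s.reg 2 = u) (h3 : s.reg 3 = v) :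
    GraphInv n L C (fun a b => R a b ∨ s(a, b) = s(u, v)) (updateStm.run w ω s) := by
  obtain ⟨σ, H⟩ := h
  have hguard := H.eval_guard hf h2 h3 hu hv
  have hR' : ∀ ⦃a b⦄, R a b ∨ s(a, b) = s(u, v) → R b a ∨ s(b, a) = s(u, v) := fun a b h =>
    h.imp (fun h => hR h) fun h => by rw [Sym2.eq_swap, h]
  by_cases hC : u ∈ C ∨ v ∈ C
  · rw [updateStm, Stm.run_ite_pos (hguard.2 hC), Stm.run_ite_pos (by simp [h1]), Stm.run_seq,
      Stm.run_seq]
    have e1 : (Stm.addEdge (.reg 2) (.reg 3)).run w ω s = { s with out := s.out ∪ {s(u, v)} } := by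
      simp [Stm.run, h2, h3]
    rw [e1]
    have harc : ∀ a b, (a, b) ∈ arcs C R → s(a, b) ≠ s(u, v) := by
      rintro a b ⟨hab, _, ha, hb⟩ e
      rcases Sym2.eq_iff.1 e with ⟨rfl, rfl⟩ | ⟨rfl, rfl⟩
      · exact huv hab
      · exact huv (hR hab)
    have H1 : Inv n L C (arcs C R) (insert s(u, v) (cenEdges C R)) (fun v c => c ∈ C ∧ R c v)
        { s with out := s.out ∪ {s(u, v)} } σ :=
      { core := H.core.addEdge harc, adj := H.adj, cenl := H.cenl, settled := H.settled,
        cen_of_mem := H.cen_of_mem, cen_of_notMem := H.cen_of_notMem, avoid := H.avoid }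
    obtain ⟨σ2, H2⟩ := run_cenAddStm (ω := ω) hf H1 hu hv (a := 2) (b := 3) (by omega) h2 h3
      (fun _ h => huv h.2)
    have hfr : ∀ q < 4, ((cenAddStm 2 3).run w ω { s with out := s.out ∪ {s(u, v)} }).reg q =
      s.reg q := fun q hq =>
        Stm.run_reg_of_notMem w ω (cenAddStm 2 3) { s with out := s.out ∪ {s(u, v)} }
          (by simp [cenAddStm_writes]; omega)
    obtain ⟨σ3, H3⟩ := run_cenAddStm (ω := ω) hf H2 hv hu (a := 3) (b := 2) (by omega)
      ((hfr 3 (by omega)).trans h3) ((hfr 2 (by omega)).trans h2)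
      -- If both ends are centers, the first call changed only the list of `v`, so `v` is still
      -- absent from the list of `u`.
      (fun _ h => h.elim (fun h => huv (hR h.2)) fun h => hne h.2.1)
    have ea : arcs C (fun a b => R a b ∨ s(a, b) = s(u, v)) = arcs C R := by
      ext ⟨a, b⟩
      refine ⟨fun ⟨h, hl, ha, hb⟩ => ⟨h.resolve_right fun e => ?_, hl, ha, hb⟩,
        fun ⟨h, hl⟩ => ⟨.inl h, hl⟩⟩
      rcases Sym2.eq_iff.1 e with ⟨e1, e2⟩ | ⟨e1, e2⟩ <;> simp only at e1 e2 ha hb <;> grind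
    have ez : cenEdges C (fun a b => R a b ∨ s(a, b) = s(u, v)) =
        insert s(u, v) (cenEdges C R) := by
      ext e
      induction e with
      | h a b =>
        rw [mk_mem_cenEdges hR', Set.mem_insert_iff, mk_mem_cenEdges hR]
        constructor
        · rintro ⟨h | h, h'⟩
          · exact .inr ⟨h, h'⟩
          · exact .inl h
        · rintro (h | ⟨h, h'⟩)
          · refine ⟨.inr h, ?_⟩
            rcases Sym2.eq_iff.1 h with ⟨rfl, rfl⟩ | ⟨rfl, rfl⟩
            · exact hC
            · exact hC.symm
          · exact ⟨.inl h, h'⟩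
    refine ⟨σ3, ?_⟩
    rw [ea, ez]
    refine H3.congr_list fun x hx c => ?_
    change _ ↔ c ∈ C ∧ (R c x ∨ s(c, x) = s(u, v))
    rw [Sym2.eq_iff]
    constructor
    · rintro ((h | ⟨h, rfl, rfl⟩) | ⟨h, rfl, rfl⟩)
      · exact ⟨h.1, .inl h.2⟩
      · exact ⟨h, .inr (.inl ⟨rfl, rfl⟩)⟩
      · exact ⟨h, .inr (.inr ⟨rfl, rfl⟩)⟩
    · rintro ⟨h, h' | ⟨rfl, rfl⟩ | ⟨rfl, rfl⟩⟩
      · exact .inl (.inl ⟨h, h'⟩)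
      · exact .inl (.inr ⟨h, rfl, rfl⟩)
      · exact .inr ⟨h, rfl, rfl⟩
  · obtain ⟨hminC, hmaxC⟩ := min_max_notMem hC
    have hRm : ¬ R (min u v) (max u v) := by
      rcases le_total u v with h' | h'
      · rwa [min_eq_left h', max_eq_right h']
      · rw [min_eq_right h', max_eq_left h']; exact fun h => huv (hR h)
    rw [updateStm, Stm.run_ite_neg (mt hguard.1 hC), Stm.run_seq, run_order hne h2 h3,
      Stm.run_ite_pos (by simp [h1])]
    have H1 : Inv n L C (arcs C R) (cenEdges C R) (fun v c => c ∈ C ∧ R c v)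
        ((s.setReg 6 (min u v)).setReg 7 (max u v)) σ :=
      { H with core := H.core.congr (by simp) (by simp) rfl rfl }
    obtain ⟨σ2, H2⟩ := run_arcAddStm (ω := ω) hf H1 (u := min u v) (v := max u v) (by omega)
      (by omega) (by rw [mk_mem_cenEdges hR]; exact fun h => hRm h.1) (fun h => hRm h.1) hminC
      hmaxC (by simp) (by simp)
    have ea : arcs C (fun a b => R a b ∨ s(a, b) = s(u, v)) =
        insert (min u v, max u v) (arcs C R) := by
      ext ⟨a, b⟩
      rw [Set.mem_insert_iff]
      constructor
      · rintro ⟨h | h, hl, h'⟩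
        · exact .inr ⟨h, hl, h'⟩
        · exact .inl ((pair_eq_min_max hl).1 h)
      · rintro (h | ⟨h, hl, h'⟩)
        · obtain ⟨rfl, rfl⟩ := Prod.mk.inj h
          exact ⟨.inr (mk_min_max u v), show min u v < max u v by omega, hminC, hmaxC⟩
        · exact ⟨.inl h, hl, h'⟩
    have ez : cenEdges C (fun a b => R a b ∨ s(a, b) = s(u, v)) = cenEdges C R := by
      ext e
      induction e with
      | h a b =>
        rw [mk_mem_cenEdges hR', mk_mem_cenEdges hR]
        refine ⟨fun ⟨h, h'⟩ => ⟨h.resolve_right fun e => ?_, h'⟩, fun ⟨h, h'⟩ => ⟨.inl h, h'⟩⟩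
        rcases Sym2.eq_iff.1 e with ⟨rfl, rfl⟩ | ⟨rfl, rfl⟩
        · exact hC h'
        · exact hC h'.symm
    refine ⟨σ2, ?_⟩
    rw [ea, ez]
    refine H2.congr_list fun x hx c => ?_
    refine ⟨fun h => ⟨h.1, .inl h.2⟩, fun ⟨h, h'⟩ => ⟨h, h'.resolve_right fun e => hC ?_⟩⟩
    rcases Sym2.eq_iff.1 e with ⟨rfl, rfl⟩ | ⟨rfl, rfl⟩
    · exact .inl h
    · exact .inr h

theorem run_updateStm_delete (hf : Fits n L w) (hR : ∀ ⦃a b⦄, R a b → R b a) (h : GraphInv n L C R s)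
    (hne : u ≠ v) (hu : u < n) (hv : v < n) (huv : R u v) (h1 : s.reg 1 = 0)
    (h2 : s.reg 2 = u) (h3 : s.reg 3 = v) :
    GraphInv n L C (fun a b => R a b ∧ s(a, b) ≠ s(u, v)) (updateStm.run w ω s) := by
  obtain ⟨σ, H⟩ := h
  have hguard := H.eval_guard hf h2 h3 hu hv
  have hR' : ∀ ⦃a b⦄, R a b ∧ s(a, b) ≠ s(u, v) → R b a ∧ s(b, a) ≠ s(u, v) := fun a b h =>
    h.imp (fun h => hR h) fun h => by rwa [Sym2.eq_swap]
  by_cases hC : u ∈ C ∨ v ∈ C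
  · rw [updateStm, Stm.run_ite_pos (hguard.2 hC), Stm.run_ite_neg (by simp [h1]), Stm.run_seq,
      Stm.run_seq]
    have e1 : (Stm.removeEdge (.reg 2) (.reg 3)).run w ω s =
        { s with out := s.out \ {s(u, v)} } := by simp [Stm.run, h2, h3]
    rw [e1]
    have harc : ∀ a b, (a, b) ∈ arcs C R → s(a, b) ≠ s(u, v) := by
      rintro a b ⟨_, _, ha, hb⟩ e
      rcases Sym2.eq_iff.1 e with ⟨rfl, rfl⟩ | ⟨rfl, rfl⟩
      · exact hC.elim ha hb
      · exact hC.elim hb ha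
    have H1 : Inv n L C (arcs C R) (cenEdges C R \ {s(u, v)}) (fun v c => c ∈ C ∧ R c v)
        { s with out := s.out \ {s(u, v)} } σ :=
      { core := H.core.removeEdge harc, adj := H.adj, cenl := H.cenl, settled := H.settled,
        cen_of_mem := H.cen_of_mem, cen_of_notMem := H.cen_of_notMem, avoid := H.avoid }
    obtain ⟨σ2, H2⟩ := run_cenDelStm (ω := ω) hf H1 hu hv (a := 2) (b := 3) (by omega) h2 h3
      (fun h => ⟨h, huv⟩)
    have hfr : ∀ q < 4, ((cenDelStm 2 3).run w ω { s with out := s.out \ {s(u, v)} }).reg q =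
      s.reg q := fun q hq =>
        Stm.run_reg_of_notMem w ω (cenDelStm 2 3) { s with out := s.out \ {s(u, v)} }
          (by simp [cenDelStm_writes]; omega)
    obtain ⟨σ3, H3⟩ := run_cenDelStm (ω := ω) hf H2 hv hu (a := 3) (b := 2) (by omega)
      ((hfr 3 (by omega)).trans h3) ((hfr 2 (by omega)).trans h2)
      (fun h => ⟨⟨h, hR huv⟩, fun h' => hne h'.2.1⟩)
    have ea : arcs C (fun a b => R a b ∧ s(a, b) ≠ s(u, v)) = arcs C R := by
      ext ⟨a, b⟩
      exact ⟨fun ⟨h, hl⟩ => ⟨h.1, hl⟩, fun h => ⟨⟨h.1, harc a b h⟩, h.2⟩⟩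
    have ez : cenEdges C (fun a b => R a b ∧ s(a, b) ≠ s(u, v)) =
        cenEdges C R \ {s(u, v)} := by
      ext e
      induction e with
      | h a b =>
        rw [mk_mem_cenEdges hR', Set.mem_sdiff, mk_mem_cenEdges hR, Set.mem_singleton_iff]
        tauto
    refine ⟨σ3, ?_⟩
    rw [ea, ez]
    refine H3.congr_list fun x hx c => ?_
    change _ ↔ c ∈ C ∧ R c x ∧ ¬ s(c, x) = s(u, v)
    rw [Sym2.eq_iff]
    constructor
    · rintro ⟨⟨⟨h, h'⟩, h2⟩, h3⟩
      refine ⟨h, h', ?_⟩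
      rintro (⟨rfl, rfl⟩ | ⟨rfl, rfl⟩)
      · exact h2 ⟨h, rfl, rfl⟩
      · exact h3 ⟨h, rfl, rfl⟩
    · rintro ⟨h, h', h2⟩
      exact ⟨⟨⟨h, h'⟩, fun ⟨_, e1, e2⟩ => h2 (.inl ⟨e2, e1⟩)⟩,
        fun ⟨_, e1, e2⟩ => h2 (.inr ⟨e2, e1⟩)⟩
  · obtain ⟨hminC, hmaxC⟩ := min_max_notMem hC
    have hRm : R (min u v) (max u v) := by
      rcases le_total u v with h' | h'
      · rwa [min_eq_left h', max_eq_right h']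
      · rw [min_eq_right h', max_eq_left h']; exact hR huv
    rw [updateStm, Stm.run_ite_neg (mt hguard.1 hC), Stm.run_seq, run_order hne h2 h3,
      Stm.run_ite_neg (by simp [h1])]
    have H1 : Inv n L C (arcs C R) (cenEdges C R) (fun v c => c ∈ C ∧ R c v)
        ((s.setReg 6 (min u v)).setReg 7 (max u v)) σ :=
      { H with core := H.core.congr (by simp) (by simp) rfl rfl }
    obtain ⟨σ2, H2⟩ := run_arcDelStm (ω := ω) hf H1 (u := min u v) (v := max u v)
      ⟨hRm, show min u v < max u v by omega, hminC, hmaxC⟩ (by simp) (by simp)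
    have ea : arcs C (fun a b => R a b ∧ s(a, b) ≠ s(u, v)) =
        arcs C R \ {(min u v, max u v)} := by
      ext ⟨a, b⟩
      rw [Set.mem_sdiff, Set.mem_singleton_iff]
      exact ⟨fun ⟨h, hl⟩ => ⟨⟨h.1, hl⟩, fun e => h.2 ((pair_eq_min_max hl.1).2 e)⟩,
        fun ⟨⟨h, hl⟩, e⟩ => ⟨⟨h, fun e' => e ((pair_eq_min_max hl.1).1 e')⟩, hl⟩⟩
    have ez : cenEdges C (fun a b => R a b ∧ s(a, b) ≠ s(u, v)) = cenEdges C R := by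
      ext e
      induction e with
      | h a b =>
        rw [mk_mem_cenEdges hR', mk_mem_cenEdges hR]
        refine ⟨fun ⟨h, h'⟩ => ⟨h.1, h'⟩, fun ⟨h, h'⟩ => ⟨⟨h, fun e => ?_⟩, h'⟩⟩
        rcases Sym2.eq_iff.1 e with ⟨rfl, rfl⟩ | ⟨rfl, rfl⟩
        · exact hC h'
        · exact hC h'.symm
    refine ⟨σ2, ?_⟩
    rw [ea, ez]
    refine H2.congr_list fun x hx c => ?_
    refine ⟨fun h => ⟨h.1, h.2, fun e => hC ?_⟩, fun ⟨h, h'⟩ => ⟨h, h'.1⟩⟩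
    rcases Sym2.eq_iff.1 e with ⟨e1, _⟩ | ⟨e1, _⟩
    · exact .inl (e1 ▸ h.1)
    · exact .inr (e1 ▸ h.1)

end GraphUpdate

/-! ## The setup program -/

/-- The number of binary digits of `n`. -/
def lg (n : ℕ) : ℕ := Nat.log 2 n + 1

/-- The square root of `n * lg n`, rounded up: the number of centers that are drawn. -/
def sq (n : ℕ) : ℕ := Nat.sqrt (n * lg n - 1) + 1

theorem lt_lg {n : ℕ} (hn : n ≠ 0) (j : ℕ) : j < lg n ↔ 2 ^ j ≤ n := by
  rw [lg, Nat.lt_succ_iff, Nat.le_log_iff_pow_le (by norm_num) hn]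

theorem lg_pos (n : ℕ) : 0 < lg n := Nat.succ_pos _

/-- The right side is the test in `sqStm`: counting up while it holds ends at the rounded root. -/
theorem lt_sq {n : ℕ} (hn : n ≠ 0) (j : ℕ) : j < sq n ↔ j * j < n * lg n := by
  have := Nat.mul_pos (Nat.pos_of_ne_zero hn) (lg_pos n)
  rw [sq, Nat.lt_succ_iff, Nat.le_sqrt]
  omega

theorem lg_le {n : ℕ} (hn : n ≠ 0) : lg n ≤ n := Nat.log_lt_self 2 hn

theorem sq_le {n : ℕ} (hn : n ≠ 0) : sq n ≤ n := by
  by_contra! h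
  have := (lt_sq hn n).1 h
  have := Nat.mul_le_mul_left n (lg_le hn)
  omega

theorem lt_two_pow_lg (n : ℕ) : n < 2 ^ lg n := Nat.lt_pow_succ_log_self (by norm_num) n

theorem le_sq_mul_sq {n : ℕ} (hn : n ≠ 0) : n * lg n ≤ sq n * sq n := by
  by_contra! h
  exact absurd ((lt_sq hn _).2 h) (lt_irrefl _)

theorem sq_mul_sq_le {n : ℕ} (hn : n ≠ 0) : sq n * sq n ≤ 4 * (n * lg n) := by
  have h : (sq n - 1) * (sq n - 1) < n * lg n := (lt_sq hn _).1 (by unfold sq; omega)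
  have h1 : 1 ≤ sq n := by unfold sq; omega
  have h2 : 1 ≤ n * lg n := Nat.mul_pos (Nat.pos_of_ne_zero hn) (lg_pos n)
  obtain ⟨k, hk⟩ : ∃ k, sq n = k + 1 := ⟨sq n - 1, by omega⟩
  rw [hk] at h ⊢
  simp only [Nat.add_sub_cancel] at h
  -- Because `(k + 1) ^ 2 ≤ 2 * (k ^ 2 + 1)` and `k ^ 2 + 1 ≤ n * lg n`.
  nlinarith [sq_nonneg ((k : ℤ) - 1)]

/-- The loop rule, with an invariant indexed by the number of iterations still to come. -/
theorem countdown_induction {x : ℕ} {f : Config → Config} (P : ℕ → Config → Prop) (m : ℕ)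
    (step : ∀ j < m, ∀ s, P (j + 1) s → P j (f (s.setReg x (j + 1)))) (s : Config) (h : P m s) :
    ∃ s', P 0 s' ∧ countdown x f m s = s'.setReg x 0 := by
  induction m generalizing s with
  | zero => exact ⟨s, h, rfl⟩
  | succ m IH => exact IH (fun j hj => step j (by omega)) _ (step m (by omega) s h)

/-- Compute `lg n` in register `5`. -/
def lgStm : Stm :=
  .set 5 (.lit 0) ;; .set 6 (.lit 1) ;;
  .rep 9 0 (.ite (.bin .lt (.reg 0) (.reg 6)) .skip
    (.set 6 (.times (.lit 2) (.reg 6)) ;; .set 5 (.plus (.reg 5) (.lit 1))))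

/-- Compute `sq n` in register `8`. -/
def sqStm : Stm :=
  .set 8 (.lit 0) ;;
  .rep 9 0 (.ite (.bin .lt (.times (.reg 8) (.reg 8)) (.times (.reg 0) (.reg 5)))
    (.set 8 (.plus (.reg 8) (.lit 1))) .skip)

/-- Draw and mark the centers. -/
def drawStm : Stm :=
  .rep 9 0 (.ite (.bin .lt (.reg 8) (.reg 9)) .skip
    (.rand 10 ;; .put (.cenA (.bin .mod (.reg 10) (.reg 0))) (.lit 1)))

/-- Set up the algorithm with block length `K * sq n`. -/
def setupStm (K : ℕ) : Stm :=
  lgStm ;; sqStm ;; .set 4 (.times (.lit K) (.reg 8)) ;; drawStm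

/-- The centers drawn by the tape `ω`. -/
def centers {w : ℕ} (n : ℕ) (ω : ℕ → Fin (2 ^ w)) : Set ℕ :=
  {v | ∃ i < sq n, (ω i : ℕ) % n = v}

/-! ### Correctness of the setup -/

section Setup

variable {n L w : ℕ} {ω : ℕ → Fin (2 ^ w)} {s : Config}

/-- All `n` iterations are run, but the counter stops at `lg n`, hence the minimum in the invariant;
`lg n ≤ n` ensures that it gets there. A power of two is doubled only while it is at most `n`, which
excludes overflow. -/
theorem run_lgStm (hf : Fits n L w) (h0 : s.reg 0 = n) :
    (lgStm.run w ω s).reg 5 = lg n ∧ (lgStm.run w ω s).mem = s.mem ∧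
      (lgStm.run w ω s).out = s.out ∧ (lgStm.run w ω s).pos = s.pos := by
  have hl := hf.large
  have hn : n ≠ 0 := by have := hf.three_le; omega
  rw [lgStm, Stm.run_seq, Stm.run_set (Expr.eval_lit (by omega)), Stm.run_seq,
    Stm.run_set (Expr.eval_lit (by omega)), Stm.run]
  have e0 : ((s.setReg 5 0).setReg 6 1).reg 0 = n := by simpa
  rw [e0]
  obtain ⟨s', ⟨_, h5, _, hm, ho, hp⟩, e⟩ := countdown_induction (x := 9)
    (f := Stm.run w ω (.ite (.bin .lt (.reg 0) (.reg 6)) .skip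
      (.set 6 (.times (.lit 2) (.reg 6)) ;; .set 5 (.plus (.reg 5) (.lit 1)))))
    (fun j t => t.reg 0 = n ∧ t.reg 5 = min (n - j) (lg n) ∧ t.reg 6 = 2 ^ t.reg 5 ∧
      t.mem = s.mem ∧ t.out = s.out ∧ t.pos = s.pos) n
    (fun j hj t ⟨t0, t5, t6, tm, tu, tp⟩ => by
      have hlt := Expr.eval_lt (w := w) (s := t.setReg 9 (j + 1)) (a := .reg 0) (b := .reg 6)
        (x := n) (y := 2 ^ t.reg 5) (by simpa) (by simpa)
      have hiff := lt_lg hn (t.reg 5)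
      by_cases h : n < 2 ^ t.reg 5
      · rw [Stm.run_ite_pos (hlt.2 h)]
        have : ¬ t.reg 5 < lg n := by rw [hiff]; omega
        refine ⟨by simpa, ?_, by simpa, tm, tu, tp⟩
        simp only [Stm.run, Config.setReg_reg]; norm_num; omega
      · rw [Stm.run_ite_neg (mt hlt.1 h), Stm.run_seq,
          Stm.run_set (Expr.eval_times (x := 2) (y := 2 ^ t.reg 5) (Expr.eval_lit (by omega))
            (by simpa) (by omega)),
          Stm.run_set (Expr.eval_plus (x := t.reg 5) (y := 1) (by simp) (Expr.eval_lit (by omega))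
            (by have := (t.reg 5).lt_two_pow_self; omega))]
        have : t.reg 5 < lg n := by rw [hiff]; omega
        refine ⟨by simpa, ?_, by simp [pow_succ, mul_comm], tm, tu, tp⟩
        simp only [Config.setReg_reg]; norm_num; omega)
    _ (⟨e0, by simp, by simp, rfl, rfl, rfl⟩)
  rw [e]
  have := lg_le hn
  refine ⟨?_, hm, ho, hp⟩
  simp only [Config.setReg_reg]; norm_num; omega

theorem run_sqStm (hf : Fits n L w) (h0 : s.reg 0 = n) (h5 : s.reg 5 = lg n) :
    (sqStm.run w ω s).reg 8 = sq n ∧ (sqStm.run w ω s).mem = s.mem ∧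
      (sqStm.run w ω s).out = s.out ∧ (sqStm.run w ω s).pos = s.pos := by
  have hl := hf.large
  have hn : n ≠ 0 := by have := hf.three_le; omega
  have hsq : ∀ k ≤ n, k * k < 2 ^ w := fun k hk => by
    have := Nat.mul_le_mul hk hk
    have h2 : n ^ 2 = n * n := by ring
    have := hf.three_le
    have : 0 < n * n := by positivity
    omega
  rw [sqStm, Stm.run_seq, Stm.run_set (Expr.eval_lit (by omega)), Stm.run]
  have e0 : (s.setReg 8 0).reg 0 = n := by simpa
  rw [e0]
  obtain ⟨s', ⟨_, _, h8, hm, ho, hp⟩, e⟩ := countdown_induction (x := 9)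
    (f := Stm.run w ω (.ite (.bin .lt (.times (.reg 8) (.reg 8)) (.times (.reg 0) (.reg 5)))
      (.set 8 (.plus (.reg 8) (.lit 1))) .skip))
    (fun j t => t.reg 0 = n ∧ t.reg 5 = lg n ∧ t.reg 8 = min (n - j) (sq n) ∧
      t.mem = s.mem ∧ t.out = s.out ∧ t.pos = s.pos) n
    (fun j hj t ⟨t0, t5, t8, tm, tu, tp⟩ => by
      have hlt := Expr.eval_lt (w := w) (s := t.setReg 9 (j + 1))
        (Expr.eval_times (a := .reg 8) (b := .reg 8) (x := t.reg 8) (y := t.reg 8) (by simp)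
          (by simp) (hsq _ (by omega)))
        (Expr.eval_times (a := .reg 0) (b := .reg 5) (x := n) (y := lg n) (by simpa) (by simpa)
          ((Nat.mul_le_mul_left n (lg_le hn)).trans_lt (hsq _ le_rfl)))
      rw [← lt_sq hn] at hlt
      by_cases h : t.reg 8 < sq n
      · rw [Stm.run_ite_pos (hlt.2 h),
          Stm.run_set (Expr.eval_plus (x := t.reg 8) (y := 1) (by simp) (Expr.eval_lit (by omega))
            (by omega))]
        refine ⟨by simpa, by simpa, ?_, tm, tu, tp⟩
        simp only [Config.setReg_reg]; norm_num; omega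
      · rw [Stm.run_ite_neg (mt hlt.1 h)]
        refine ⟨by simpa, by simpa, ?_, tm, tu, tp⟩
        simp only [Stm.run, Config.setReg_reg]; norm_num; omega)
    _ (⟨e0, by simpa, by simp, rfl, rfl, rfl⟩)
  rw [e]
  have := sq_le hn
  refine ⟨?_, hm, ho, hp⟩
  simp only [Config.setReg_reg]; norm_num; omega

/-- Setup loops must count from register `0`, so the loop runs `n` times and draws only when its
counter is at most `sq n`. Truncated subtraction in `sq n - j` makes the number of words used stay
`0` until then. -/
theorem run_drawStm (hf : Fits n L w) (h0 : s.reg 0 = n) (h8 : s.reg 8 = sq n)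
    (hm : s.mem = fun _ => 0) (hp : s.pos = 0) :
    (∀ a, (drawStm.run w ω s).mem a ≠ 0 → ∃ v ∈ centers n ω, a = 8 * v + 4) ∧
      (∀ v ∈ centers n ω, (drawStm.run w ω s).mem (8 * v + 4) = 1) ∧
      (drawStm.run w ω s).out = s.out := by
  have hl := hf.large
  have hn : n ≠ 0 := by have := hf.three_le; omega
  rw [drawStm, Stm.run, h0]
  obtain ⟨s', ⟨_, _, hp', h1, h2, ho⟩, e⟩ := countdown_induction (x := 9)
    (f := Stm.run w ω (.ite (.bin .lt (.reg 8) (.reg 9)) .skip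
      (.rand 10 ;; .put (.cenA (.bin .mod (.reg 10) (.reg 0))) (.lit 1))))
    (fun j t => t.reg 0 = n ∧ t.reg 8 = sq n ∧ t.pos = sq n - j ∧
      (∀ a, t.mem a ≠ 0 → ∃ i < t.pos, a = 8 * ((ω i : ℕ) % n) + 4) ∧
      (∀ i < t.pos, t.mem (8 * ((ω i : ℕ) % n) + 4) = 1) ∧ t.out = s.out) n
    (fun j hj t ⟨t0, t8, tp, t1, t2, tu⟩ => by
      have hlt := Expr.eval_lt (w := w) (s := t.setReg 9 (j + 1)) (a := .reg 8) (b := .reg 9)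
        (x := sq n) (y := j + 1) (by simpa) (by simp)
      by_cases h : sq n < j + 1
      · rw [Stm.run_ite_pos (hlt.2 h)]
        refine ⟨by simpa, by simpa, ?_, t1, t2, tu⟩
        simp only [Stm.run, Config.setReg_pos, tp]; omega
      · rw [Stm.run_ite_neg (mt hlt.1 h), Stm.run_seq,
          Stm.run_put (v := 1) (hf.eval_cenA (v := (ω t.pos : ℕ) % n)
            (by simp [Stm.run, Expr.eval, Op.eval, t0])
            (Nat.mod_lt _ (by omega))) (Expr.eval_lit (by omega))]
        refine ⟨by simp [Stm.run, t0], by simp [Stm.run, t8], ?_, ?_, ?_, by simp [Stm.run, tu]⟩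
        · simp only [Stm.run, Config.setMem_pos, Config.setReg_pos, tp]; omega
        · intro a ha
          simp only [Stm.run, Config.setMem_mem, Config.setMem_pos, Config.setReg_pos,
            Config.setReg_mem] at ha ⊢
          rcases eq_or_ne a (8 * ((ω t.pos : ℕ) % n) + 4) with e | e
          · exact ⟨t.pos, by omega, e⟩
          · rw [Function.update_of_ne e] at ha
            obtain ⟨i, hi, e⟩ := t1 a ha
            exact ⟨i, by omega, e⟩
        · intro i hi
          simp only [Stm.run, Config.setMem_mem, Config.setMem_pos, Config.setReg_pos,
            Config.setReg_mem] at hi ⊢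
          rw [Function.update_apply]
          split_ifs with e
          · rfl
          · exact t2 i (lt_of_le_of_ne (by omega) (by rintro rfl; exact e rfl)))
    s ⟨h0, h8, by have := sq_le hn; omega, fun a ha => absurd (by rw [hm]) ha,
      fun i hi => by omega, rfl⟩
  rw [e]
  rw [hp', Nat.sub_zero] at h1 h2
  refine ⟨fun a ha => ?_, ?_, ho⟩
  · obtain ⟨i, hi, e⟩ := h1 a ha
    exact ⟨_, ⟨i, hi, rfl⟩, e⟩
  · rintro v ⟨i, hi, rfl⟩
    exact h2 i hi

theorem drawStm_writes : drawStm.writes = [9, 10] := by decide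

theorem lgStm_writes : lgStm.writes = [5, 6, 9, 6, 5] := by decide

theorem sqStm_writes : sqStm.writes = [8, 9, 8] := by decide

-- Blank memory already represents empty lists, so only the marks of centers are written. This is
-- why the setup needs only linear time.
open Classical in
theorem run_setupStm {K : ℕ} (hf : Fits n (K * sq n) w) :
    GraphInv n (K * sq n) (centers n ω) (fun _ _ => False)
      ((setupStm K).run w ω (Config.start n)) := by
  have hl := hf.large
  have hn : n ≠ 0 := by have := hf.three_le; omega
  have h0 : (Config.start n).reg 0 = n := by simp [Config.start]
  obtain ⟨a5, am, ao, ap⟩ := run_lgStm (ω := ω) hf h0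
  have a0 : (lgStm.run w ω (Config.start n)).reg 0 = n :=
    (Stm.run_reg_of_notMem w ω lgStm _ (by simp [lgStm_writes])).trans h0
  rw [setupStm, Stm.run_seq, Stm.run_seq, Stm.run_seq]
  generalize lgStm.run w ω (Config.start n) = s1 at *
  obtain ⟨b8, bm, bo, bp⟩ := run_sqStm (ω := ω) hf a0 a5
  have b0 : (sqStm.run w ω s1).reg 0 = n :=
    (Stm.run_reg_of_notMem w ω sqStm _ (by simp [sqStm_writes])).trans a0
  generalize sqStm.run w ω s1 = s2 at *
  have hK : K * sq n < 2 ^ w := by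
    have := hf.block; nlinarith
  have hsq : 0 < sq n := Nat.succ_pos _
  rw [Stm.run_set (v := K * sq n) (Expr.eval_times (x := K) (y := sq n)
    (Expr.eval_lit (by nlinarith)) (by simpa) hK)]
  obtain ⟨c1, c2, co⟩ := run_drawStm (ω := ω) (s := s2.setReg 4 (K * sq n)) hf (by simpa)
    (by simpa) (by simp [bm, am, Config.start]) (by simp [bp, ap, Config.start])
  have c0 : (drawStm.run w ω (s2.setReg 4 (K * sq n))).reg 0 = n :=
    (Stm.run_reg_of_notMem w ω drawStm _ (by simp [drawStm_writes])).trans (by simpa)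
  have c4 : (drawStm.run w ω (s2.setReg 4 (K * sq n))).reg 4 = K * sq n :=
    (Stm.run_reg_of_notMem w ω drawStm _ (by simp [drawStm_writes])).trans (by simp)
  generalize drawStm.run w ω (s2.setReg 4 (K * sq n)) = s3 at *
  have ho : s3.out = ∅ := by rw [co]; simp [bo, ao, Config.start]
  have hz : ∀ a, (∀ v, a ≠ 8 * v + 4) → s3.mem a = 0 := fun a ha => by
    by_contra h
    obtain ⟨v, _, e⟩ := c1 a h
    exact ha v e
  have earcs : arcs (centers n ω) (fun _ _ => False) = ∅ := by ext; simp [arcs]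
  have ecen : cenEdges (centers n ω) (fun _ _ => False) = ∅ := by ext; simp [cenEdges]
  refine ⟨⟨fun _ => ⟨0, fun _ => 0, fun _ => 0⟩, fun _ => 0,
    fun v => if v ∈ centers n ω then 1 else 0⟩, ?_⟩
  rw [earcs, ecen]
  refine ⟨⟨c0, c4, ⟨?_, ?_, ?_, ?_, ?_⟩, ?_, ?_, ?_, ?_⟩, ?_, ?_, ?_, ?_, ?_, ?_⟩
  · intro k _; exact hz _ (by omega)
  · intro k _ i _; exact hz _ (by omega)
  · intro k _ i _; exact hz _ (by omega)
  · intro u _ v _; exact hz _ (by omega)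
  · intro v _
    simp only
    split_ifs with h
    · exact c2 v h
    · by_contra h'
      obtain ⟨v', hv', e⟩ := c1 _ h'
      obtain rfl : v = v' := by omega
      exact h hv'
  · intro k _ i hi; simp at hi
  · intro u v h; simp at h
  · intro u _ c _ v; simp [Lst.Mem]
  · intro e; simp [ho, Lst.Head]
  · intro v _ u; simp [Lst.Mem]
  · intro v _ u; simp [Lst.Mem]
  · intro x _ i hi; simp at hi
  · intro v _ h; simp [h]
  · intro v _ h; simp [h]
  · intro u v h; simp at h

end Setup

/-! ## The algorithm -/

/-- The dynamic 3-spanner algorithm with block length `K * sq n`. -/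
def spannerAlg (K : ℕ) : DynAlg := ⟨(setupStm K).compile, updateStm.compile⟩

theorem setupStm_ok (K : ℕ) : (setupStm K).ok 0 = true := rfl

theorem updateStm_ok : updateStm.ok 4 = true := by decide +kernel

theorem setupStm_flat (K : ℕ) : (setupStm K).flat = true := rfl

theorem updateStm_flat : updateStm.flat = true := by decide +kernel

/-- Three of the `K + 10` factors `2 ^ lg n` pay for `n ^ 3`. The other `K + 7` are at least `4`
each, and `4 ^ (K + 7) ≥ 32 * (K + 1)` pays for the address constant and for the factor `K` in the
block length. -/
theorem fits_wordLength {n K : ℕ} (hn : 3 ≤ n) (hK : 0 < K) :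
    Fits n (K * sq n) (wordLength (K + 10) n) := by
  have h1 : n < 2 ^ lg n := lt_two_pow_lg n
  have h2 : 2 ≤ lg n := by
    have := (lt_lg (show n ≠ 0 by omega) 1).2 (by omega); omega
  have h3 : 4 ≤ 2 ^ lg n := by
    calc 4 = 2 ^ 2 := by norm_num
      _ ≤ _ := Nat.pow_le_pow_right (by norm_num) h2
  have hw : (2 : ℕ) ^ wordLength (K + 10) n = (2 ^ lg n) ^ (K + 7) * (2 ^ lg n) ^ 3 := by
    rw [← pow_add, ← pow_mul, mul_comm (lg n)]; rfl
  have h4 : 32 * (K + 1) ≤ (2 ^ lg n) ^ (K + 7) := by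
    have : K + 1 ≤ 4 ^ K := by
      have := K.lt_pow_self (show 1 < 4 by norm_num); omega
    calc 32 * (K + 1) ≤ 4 ^ 7 * 4 ^ K := Nat.mul_le_mul (by norm_num) this
      _ = 4 ^ (K + 7) := by ring
      _ ≤ _ := Nat.pow_le_pow_left h3 _
  have h5 : n ^ 3 ≤ (2 ^ lg n) ^ 3 := Nat.pow_le_pow_left h1.le 3
  have hsq := sq_le (show n ≠ 0 by omega)
  have h6 : 32 * (K + 1) * n ^ 3 ≤ 2 ^ wordLength (K + 10) n := hw ▸ Nat.mul_le_mul h4 h5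
  refine ⟨hn, le_trans (Nat.mul_le_mul_right _ (by omega)) h6, lt_of_lt_of_le ?_ h6,
    Nat.mul_pos hK (Nat.succ_pos _)⟩
  have h7 : (n + 1) * (K * sq n) ≤ 2 * n * (K * n) :=
    Nat.mul_le_mul (by omega) (Nat.mul_le_mul_left _ hsq)
  have h8 : 2 * n * (K * n) ≤ 2 * K * n ^ 3 := by
    have : n ^ 2 ≤ n ^ 3 := Nat.pow_le_pow_right (by omega) (by omega)
    calc 2 * n * (K * n) = 2 * K * n ^ 2 := by ring
      _ ≤ _ := Nat.mul_le_mul_left _ this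
  have h9 : 2 * K * n ^ 3 < 32 * (K + 1) * n ^ 3 :=
    Nat.mul_lt_mul_of_pos_right (by omega) (by positivity)
  omega

theorem wordLength_pos {K n : ℕ} : 0 < wordLength (K + 10) n :=
  Nat.mul_pos (by omega) (Nat.succ_pos _)

/-- Adjacency of nodes given as numbers. -/
def natAdj {n : ℕ} (G : SimpleGraph (Fin n)) (a b : ℕ) : Prop :=
  ∃ (ha : a < n) (hb : b < n), G.Adj ⟨a, ha⟩ ⟨b, hb⟩

theorem natAdj_symm {n : ℕ} (G : SimpleGraph (Fin n)) ⦃a b : ℕ⦄ (h : natAdj G a b) :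
    natAdj G b a := by
  obtain ⟨ha, hb, h⟩ := h; exact ⟨hb, ha, h.symm⟩

theorem natAdj_val {n : ℕ} (G : SimpleGraph (Fin n)) (u v : Fin n) :
    natAdj G u v ↔ G.Adj u v :=
  ⟨fun ⟨_, _, h⟩ => h, fun h => ⟨u.2, v.2, h⟩⟩

theorem natAdj_bot {n : ℕ} : natAdj (⊥ : SimpleGraph (Fin n)) = fun _ _ => False := by
  ext a b; simp [natAdj]

theorem natAdj_insert {n : ℕ} (G : SimpleGraph (Fin n)) {u v : Fin n} (h : u ≠ v) :
    natAdj ((Update.insert u v).perform G) =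
      fun a b => natAdj G a b ∨ s(a, b) = s((u : ℕ), (v : ℕ)) := by
  ext a b
  constructor
  · rintro ⟨ha, hb, h'⟩
    rw [Update.perform, SimpleGraph.sup_adj, SimpleGraph.edge_adj] at h'
    rcases h' with h' | ⟨⟨e1, e2⟩ | ⟨e1, e2⟩, -⟩
    · exact .inl ⟨ha, hb, h'⟩
    · right; rw [← e1, ← e2]
    · right; rw [← e1, ← e2, Sym2.eq_swap]
  · rintro (⟨ha, hb, h'⟩ | h')
    · exact ⟨ha, hb, .inl h'⟩
    · rcases Sym2.eq_iff.1 h' with ⟨rfl, rfl⟩ | ⟨rfl, rfl⟩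
      · exact ⟨u.2, v.2, .inr (by simp [SimpleGraph.edge_adj, h])⟩
      · exact ⟨v.2, u.2, .inr (by simp [SimpleGraph.edge_adj, h.symm])⟩

theorem natAdj_delete {n : ℕ} (G : SimpleGraph (Fin n)) (u v : Fin n) :
    natAdj ((Update.delete u v).perform G) =
      fun a b => natAdj G a b ∧ s(a, b) ≠ s((u : ℕ), (v : ℕ)) := by
  ext a b
  simp only [natAdj, Update.perform, SimpleGraph.deleteEdges_adj, Set.mem_singleton_iff, Ne,
    Sym2.eq_iff, Fin.ext_iff, exists_and_right]

theorem legalSeq_of_append {n : ℕ} {σ τ : List (Update n)} (h : LegalSeq (σ ++ τ)) :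
    LegalSeq σ :=
  fun ρ e hp => h ρ e (hp.trans (List.prefix_append _ _))

theorem graphAfter_append {n : ℕ} (σ : List (Update n)) (e : Update n) :
    graphAfter (σ ++ [e]) = e.perform (graphAfter σ) := by
  simp [graphAfter]

theorem reg_feed {n : ℕ} (s : Config) (e : Update n) {q : ℕ} (hq : q = 0 ∨ 3 < q) :
    (s.feed e).reg q = s.reg q := by
  have h1 : q ≠ 1 := by omega
  have h2 : q ≠ 2 := by omega
  have h3 : q ≠ 3 := by omega
  cases e <;> simp [Config.feed, h1, h2, h3]

theorem GraphInv.feed {n L : ℕ} {C : Set ℕ} {R : ℕ → ℕ → Prop} {s : Config}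
    (h : GraphInv n L C R s) (e : Update n) : GraphInv n L C R (s.feed e) := by
  refine h.congr (reg_feed s e (by omega)) (reg_feed s e (by omega)) ?_ ?_ <;> cases e <;> rfl

theorem GraphInv.sim {n L : ℕ} {C : Set ℕ} {R : ℕ → ℕ → Prop} {s h : Config}
    (H : GraphInv n L C R h) (hs : s.Sim h) : GraphInv n L C R s :=
  H.congr (hs.reg 0 (by omega)) (hs.reg 4 (by omega)) hs.mem hs.out

/-- Induction on the update sequence, for every tape: randomness enters only through the set of
centers, which no update changes. -/
theorem Reaches.graphInv {n K : ℕ} (hn : 3 ≤ n) (hK : 0 < K)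
    {ω : ℕ → Fin (2 ^ wordLength (K + 10) n)} {σ : List (Update n)} {s : Config}
    (h : Reaches (spannerAlg K) (K + 10) n ω σ s) (hσ : LegalSeq σ) :
    GraphInv n (K * sq n) (centers n ω) (natAdj (graphAfter σ)) s := by
  have hf := fits_wordLength hn hK
  induction h with
  | start hex =>
    obtain ⟨s', t, hex', hsim, -⟩ := Stm.exec_compile _ wordLength_pos ω 0 n (setupStm K)
      (setupStm_ok K) _ _ (Config.Sim.refl (Config.start n)) (by simp [Config.start])
    rw [hex.unique hex']
    have := (run_setupStm (ω := ω) hf).sim hsim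
    rwa [← natAdj_bot (n := n)] at this
  | @step σ e s s' t hr hex ih =>
    have H := (ih (legalSeq_of_append hσ)).feed e
    have hlegal : e.Legal (graphAfter σ) := hσ σ e (List.prefix_refl _)
    obtain ⟨s'', t, hex', hsim, -⟩ := Stm.exec_compile _ wordLength_pos ω 4
      ((s.feed e).reg 4) updateStm updateStm_ok _ _ (Config.Sim.refl (s.feed e)) le_rfl
    rw [hex.unique hex', graphAfter_append]
    refine GraphInv.sim ?_ hsim
    cases e with
    | insert u v =>
      have hne : (u : ℕ) ≠ v := fun e => hlegal.1 (Fin.ext e)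
      rw [natAdj_insert _ hlegal.1]
      exact run_updateStm_insert hf (natAdj_symm _) H hne u.2 v.2
        (by rw [natAdj_val]; exact hlegal.2) (by simp [Config.feed]) (by simp [Config.feed])
        (by simp [Config.feed])
    | delete u v =>
      have hne : (u : ℕ) ≠ v := fun e => SimpleGraph.Adj.ne hlegal (Fin.ext e)
      rw [natAdj_delete]
      exact run_updateStm_delete hf (natAdj_symm _) H hne u.2 v.2
        (by rw [natAdj_val]; exact hlegal) (by simp [Config.feed]) (by simp [Config.feed])
        (by simp [Config.feed])

theorem setupTime_le {n K : ℕ} (ω : ℕ → Fin (2 ^ wordLength (K + 10) n)) :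
    ∃ (s : Config) (t : ℕ), Exec (wordLength (K + 10) n) ω (spannerAlg K).setup (Config.start n)
      s t ∧ t ≤ (setupStm K).cost 1 * (n + 1) := by
  obtain ⟨s', t, hex, -, ht⟩ := Stm.exec_compile _ wordLength_pos ω 0 n (setupStm K)
      (setupStm_ok K) _ _ (Config.Sim.refl (Config.start n)) (by simp [Config.start])
  exact ⟨s', t, hex, ht.trans (Stm.cost_le_of_flat _ _ (setupStm_flat K))⟩

/-- The loops of an update count from register `4`, which by the invariant holds the block length `K
* sq n`. -/
theorem updateTime_le {n K : ℕ} (hn : 3 ≤ n) (hK : 0 < K)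
    {ω : ℕ → Fin (2 ^ wordLength (K + 10) n)} {σ : List (Update n)} {s : Config}
    (h : Reaches (spannerAlg K) (K + 10) n ω σ s) (e : Update n) (hσ : LegalSeq (σ ++ [e])) :
    ∃ (s' : Config) (t : ℕ), Exec (wordLength (K + 10) n) ω (spannerAlg K).update (s.feed e)
      s' t ∧ t ≤ updateStm.cost 1 * (K * sq n + 1) := by
  obtain ⟨_, H⟩ := (h.graphInv hn hK (legalSeq_of_append hσ)).feed e
  obtain ⟨s', t, hex, -, ht⟩ := Stm.exec_compile _ wordLength_pos ω 4 (K * sq n) updateStm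
    updateStm_ok _ _ (Config.Sim.refl (s.feed e)) H.core.reg4.le
  exact ⟨s', t, hex, ht.trans (Stm.cost_le_of_flat _ _ updateStm_flat)⟩

/-! ## The maintained graph is a sparse spanner -/

/-- Replace each edge of a shortest walk by a detour. For unreachable pairs `k ≠ 0` is needed, as `0
* ⊤ = 0`. -/
theorem isSpanner_of_adj {V : Type*} {G H : SimpleGraph V} {k : ℕ} (hk : k ≠ 0) (hle : H ≤ G)
    (h : ∀ u v, G.Adj u v → H.edist u v ≤ k) : IsSpanner k G H := by
  refine ⟨hle, fun u v => ?_⟩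
  have key : ∀ {u v : V} (p : G.Walk u v), H.edist u v ≤ (k : ℕ∞) * p.length := by
    intro u v p
    induction p with
    | nil => simp
    | cons huv p ih =>
      refine SimpleGraph.edist_triangle.trans ((add_le_add (h _ _ huv) ih).trans ?_)
      rw [SimpleGraph.Walk.length_cons]
      push_cast
      rw [mul_add, mul_one, add_comm]
  by_cases hr : G.Reachable u v
  · obtain ⟨p, hp⟩ := hr.exists_walk_length_eq_edist
    rw [← hp]; exact key p
  · rw [SimpleGraph.edist_eq_top_of_not_reachable hr, ENat.mul_top (by simpa using hk)]
    exact le_top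

theorem edist_le_one {V : Type*} {H : SimpleGraph V} {u v : V} (h : H.Adj u v) :
    H.edist u v ≤ 1 := by
  simpa using SimpleGraph.edist_le (SimpleGraph.Walk.cons h .nil)

/-- Every node has fewer neighbors than `L` times the number of adjacent centers plus one. -/
def Covered (n L : ℕ) (C : Set ℕ) (R : ℕ → ℕ → Prop) : Prop :=
  ∀ v < n, {a | R a v}.ncard < ({a | R a v ∧ a ∈ C}.ncard + 1) * L

section Spanner

variable {n L : ℕ} {s : Config} {σ : St} {C : Set ℕ} {R : ℕ → ℕ → Prop}

theorem Inv.asg_eq {Arc : Set (ℕ × ℕ)} {Z : Set (Sym2 ℕ)} {Cl : ℕ → ℕ → Prop} {u v : ℕ}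
    (H : Inv n L C Arc Z Cl s σ) (h : (u, v) ∈ Arc) :
    ∃ i < (σ.ls (v, 2 * n)).cnt, (σ.ls (v, 2 * n)).elt i = u ∧
      σ.asg (u, v) = tgt n L (σ.ls (v, 2 * n + 1)) v i := by
  have hv := (H.core.arc u v h).2.1
  obtain ⟨i, hi, e⟩ := (H.adj v hv u).2 h
  have := H.settled v hv i hi (by simp)
  rw [e] at this
  exact ⟨i, hi, e, this⟩

/-- Dummies are at least `n` and centers are below `n`, so arcs with the same label fall into the
same case. -/
theorem Inv.asg_cases {Arc : Set (ℕ × ℕ)} {Z : Set (Sym2 ℕ)} {Cl : ℕ → ℕ → Prop} {u v : ℕ}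
    (H : Inv n L C Arc Z Cl s σ) (h : (u, v) ∈ Arc) :
    σ.asg (u, v) = n + v ∨ (σ.asg (u, v) < n ∧ Cl v (σ.asg (u, v))) := by
  have hv := (H.core.arc u v h).2.1
  obtain ⟨i, hi, e, ha⟩ := H.asg_eq h
  rw [ha, tgt]
  split_ifs with hl
  · exact .inr ⟨(H.core.wf (v, 2 * n + 1) ⟨hv, by simp⟩ _ hl).1, (H.cenl v hv _).1 ⟨_, hl, rfl⟩⟩
  · exact .inl rfl

theorem outputGraph_adj {u v : Fin n} :
    (s.outputGraph n).Adj u v ↔ u ≠ v ∧ s(u.val, v.val) ∈ s.out := Iff.rfl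

/-- The detour for an arc `(u, v)` with center `c` goes to the head `v'` of its list, then to `c`,
then to `v`. No probabilistic assumption is involved. -/
theorem GraphInv.isSpanner {G : SimpleGraph (Fin n)} (h : GraphInv n L C (natAdj G) s) :
    IsSpanner 3 G (s.outputGraph n) := by
  obtain ⟨σ, H⟩ := h
  have hout := H.core.out
  have hcen : ∀ {a b : Fin n}, G.Adj a b → ((a : ℕ) ∈ C ∨ (b : ℕ) ∈ C) →
      (s.outputGraph n).Adj a b := fun {a b} hab hC =>
    outputGraph_adj.2 ⟨hab.ne, (hout _).2 (.inl ((mk_mem_cenEdges (natAdj_symm G)).2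
      ⟨(natAdj_val G a b).2 hab, hC⟩))⟩
  have harc : ∀ {u v : Fin n}, u < v → G.Adj u v → (u : ℕ) ∉ C → (v : ℕ) ∉ C →
      (s.outputGraph n).edist u v ≤ 3 := by
    intro u v huv hadj hu hv
    have ha : ((u : ℕ), (v : ℕ)) ∈ arcs C (natAdj G) :=
      ⟨(natAdj_val G u v).2 hadj, huv, hu, hv⟩
    obtain ⟨-, -, -, hc⟩ := H.core.arc _ _ ha
    set c := σ.asg (u, v) with hcdef
    obtain ⟨i, hi, -⟩ := (H.core.lst u u.2 c hc v).2 ⟨ha, rfl⟩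
    obtain ⟨v', hv'⟩ : ∃ v', v' = (σ.ls (u, c)).elt 0 := ⟨_, rfl⟩
    have hhead : (σ.ls (u, c)).Head v' := ⟨by omega, hv'.symm⟩
    obtain ⟨ha', hc'⟩ := H.core.arc_of_head u.2 hc hhead
    obtain ⟨huv', hvn', -, -⟩ := H.core.arc _ _ ha'
    have hadj' : (s.outputGraph n).Adj u ⟨v', hvn'⟩ :=
      outputGraph_adj.2 ⟨fun e => by rw [Fin.ext_iff] at e; simp only at e; omega,
        (hout _).2 (.inr ⟨u, u.2, c, hc, v', hhead, rfl⟩)⟩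
    have hcv := H.asg_cases ha
    have hcv' := H.asg_cases ha'
    rw [hc'] at hcv'
    rw [← hcdef] at hcv
    rcases hcv with hcv | ⟨hcn, hC, _, hcv⟩
    · rcases hcv' with hcv' | ⟨hcn, -⟩
      -- Both dummies equal `c`, so `n + v' = n + v` and the kept arc is the given one.
      · have : (⟨v', hvn'⟩ : Fin n) = v := Fin.ext (by simp only; omega)
        rw [this] at hadj'
        exact (edist_le_one hadj').trans (by norm_num)
      · omega
    · rcases hcv' with hcv' | ⟨-, -, hcn', hcv'⟩
      · omega
      · obtain ⟨_, hcv⟩ := hcv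
        obtain ⟨_, hcv'⟩ := hcv'
        have e1 : (s.outputGraph n).Adj ⟨c, hcn⟩ v := hcen hcv (.inl hC)
        have e2 : (s.outputGraph n).Adj ⟨c, hcn⟩ ⟨v', hvn'⟩ := hcen hcv' (.inl hC)
        exact SimpleGraph.edist_le (.cons hadj' (.cons e2.symm (.cons e1 .nil)))
  refine isSpanner_of_adj (by norm_num) ?_ ?_
  · intro u v huv
    obtain ⟨hne, h⟩ := outputGraph_adj.1 huv
    rw [← natAdj_val]
    rcases (hout _).1 h with h | ⟨a, ha, c, hc, b, hh, e⟩
    · exact ((mk_mem_cenEdges (natAdj_symm G)).1 h).1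
    · have hab : natAdj G a b := (H.core.arc_of_head ha hc hh).1.1
      rcases Sym2.eq_iff.1 e with ⟨e1, e2⟩ | ⟨e1, e2⟩
      · rw [e1, e2]; exact hab
      · rw [e1, e2]; exact natAdj_symm G hab
  · intro u v huv
    by_cases hu : (u : ℕ) ∈ C ∨ (v : ℕ) ∈ C
    · exact (edist_le_one (hcen huv hu)).trans (by norm_num)
    · push Not at hu
      rcases lt_or_gt_of_ne huv.ne with h | h
      · exact harc h huv hu.1 hu.2
      · rw [SimpleGraph.edist_comm]; exact harc h huv.symm hu.2 hu.1

/-- The output is covered by `T1`, the edges at centers, `T2`, the heads of lists of centers, and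
`T3`, the arcs with a dummy label. The last ones occupy positions from `k * L` on, where `k` is the
number of adjacent centers, and `Covered` ends the list before `(k + 1) * L`. -/
theorem GraphInv.ncard_edgeSet_le {G : SimpleGraph (Fin n)} (h : GraphInv n L C (natAdj G) s)
    {A : Finset ℕ} (hA : C = A) (hcov : Covered n L C (natAdj G)) :
    (s.outputGraph n).edgeSet.ncard ≤ n * (2 * A.card + L) := by
  classical
  obtain ⟨σ, H⟩ := h
  let T1 : Finset (Sym2 ℕ) := (Finset.range n ×ˢ A).image fun p => s(p.2, p.1)
  let T2 : Finset (Sym2 ℕ) := (Finset.range n ×ˢ A).image fun p => s(p.1, (σ.ls p).elt 0)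
  let T3 : Finset (Sym2 ℕ) := (Finset.range n ×ˢ Finset.range L).image fun p =>
    s((σ.ls (p.1, 2 * n)).elt ((σ.ls (p.1, 2 * n + 1)).cnt * L + p.2), p.1)
  have hfin : ∀ v, {a | natAdj G a v}.Finite := fun v =>
    (Set.finite_Iio n).subset fun a ⟨ha, _⟩ => ha
  have hsub : s.out ⊆ (T1 ∪ T2 ∪ T3 : Finset (Sym2 ℕ)) := by
    intro e he
    simp only [Finset.coe_union, Set.mem_union, Finset.mem_coe]
    rcases (H.core.out e).1 he with ⟨a, b, ⟨_, hb, _⟩, haC, rfl⟩ | ⟨u, hu, c, hc, v, hh, rfl⟩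
    · left; left
      rw [hA] at haC
      exact Finset.mem_image.2 ⟨(b, a), by simp [hb, Finset.mem_coe.1 haC], rfl⟩
    · obtain ⟨ha, hasg⟩ := H.core.arc_of_head hu hc hh
      have hv := (H.core.arc u v ha).2.1
      rcases H.asg_cases ha with h | ⟨hcn, hcC, _⟩
      · right
        obtain ⟨i, hi, rfl, e⟩ := H.asg_eq ha
        have hw := H.core.wf (v, 2 * n) ⟨hv, by simp⟩
        have hw2 := H.core.wf (v, 2 * n + 1) ⟨hv, by simp⟩
        set k := (σ.ls (v, 2 * n + 1)).cnt with hkdef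
        have hk : ¬ i / L < k := fun hlt => by
          rw [h, tgt, if_pos hlt] at e
          have := (hw2 _ hlt).1
          omega
        have hd : (σ.ls (v, 2 * n)).cnt ≤ {a | natAdj G a v}.ncard := by
          have := Set.ncard_le_ncard (s := (σ.ls (v, 2 * n)).elt '' Set.Iio (σ.ls (v, 2 * n)).cnt)
            (t := {a | natAdj G a v}) (by
              rintro _ ⟨j, hj, rfl⟩
              exact ((H.adj v hv _).1 ⟨j, hj, rfl⟩).1) (hfin v)
          have hinj : Set.InjOn (σ.ls (v, 2 * n)).elt (Set.Iio (σ.ls (v, 2 * n)).cnt) :=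
            fun a ha b hb e => hw.elt_inj ha hb e
          rwa [hinj.ncard_image, Set.ncard_eq_toFinset_card', Set.toFinset_Iio, Nat.card_Iio] at this
        have hk' : {a | natAdj G a v ∧ a ∈ C}.ncard ≤ k := by
          have := Set.ncard_le_ncard (s := {a | natAdj G a v ∧ a ∈ C})
            (t := (σ.ls (v, 2 * n + 1)).elt '' Set.Iio k) (by
              rintro a ⟨ha, haC⟩
              obtain ⟨j, hj, e⟩ := (H.cenl v hv a).2 ⟨haC, ha⟩
              exact ⟨j, hj, e⟩) ((Set.finite_Iio k).image _)
          refine this.trans ((Set.ncard_image_le (Set.finite_Iio k)).trans ?_)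
          rw [Set.ncard_eq_toFinset_card', Set.toFinset_Iio, Nat.card_Iio]
        have hlt : i < (k + 1) * L :=
          (hi.trans_le hd).trans_le ((hcov v hv).le.trans (Nat.mul_le_mul_right _ (by omega)))
        have hge : k * L ≤ i := by
          by_contra! h
          exact hk (Nat.div_lt_of_lt_mul (by rwa [mul_comm]))
        rw [Nat.succ_mul] at hlt
        refine Finset.mem_image.2 ⟨(v, i - k * L), ?_, ?_⟩
        · simp only [Finset.mem_product, Finset.mem_range]; omega
        · simp only
          rw [← hkdef, Nat.add_sub_cancel' hge]
      · left; right
        rw [hasg, hA] at hcC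
        refine Finset.mem_image.2 ⟨(u, c), by simp [hu, Finset.mem_coe.1 hcC], ?_⟩
        simp only [hh.2]
  have hinj : Function.Injective (Sym2.map (Fin.val : Fin n → ℕ)) :=
    Sym2.map.injective Fin.val_injective
  have hmap : Sym2.map Fin.val '' (s.outputGraph n).edgeSet ⊆ (T1 ∪ T2 ∪ T3 : Finset (Sym2 ℕ)) := by
    rintro _ ⟨e, he, rfl⟩
    induction e with
    | h a b => exact hsub (outputGraph_adj.1 ((SimpleGraph.mem_edgeSet _).1 he)).2
  rw [← Set.ncard_image_of_injective _ hinj]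
  refine (Set.ncard_le_ncard hmap (Finset.finite_toSet _)).trans ?_
  rw [Set.ncard_coe_finset]
  have h1 : T1.card ≤ n * A.card := Finset.card_image_le.trans (by simp)
  have h2 : T2.card ≤ n * A.card := Finset.card_image_le.trans (by simp)
  have h3 : T3.card ≤ n * L := Finset.card_image_le.trans (by simp)
  have h4 := Finset.card_union_le (T1 ∪ T2) T3
  have h5 := Finset.card_union_le T1 T2
  nlinarith

end Spanner

/-! ## Random centers hit all large sets -/

section Probability

/-- The number of words whose residue lies in `S`. -/
theorem card_residues_ge {n N : ℕ} (S : Finset ℕ) (hS : S ⊆ Finset.range n) :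
    S.card * (N / n) ≤ (Finset.univ.filter fun x : Fin N => (x : ℕ) % n ∈ S).card := by
  rw [← Finset.card_range (N / n), ← Finset.card_product]
  -- Each residue in `S` occurs once in each of the `N / n` complete periods below `N`.
  have hinj : Set.InjOn (fun p : ℕ × ℕ => p.2 * n + p.1) (S ×ˢ Finset.range (N / n) : Finset _) := by
    intro p hp q hq e
    simp only [Finset.coe_product, Set.mem_prod, Finset.mem_coe] at hp hq
    have := (mul_add_inj (Finset.mem_range.1 (hS hp.1)) (Finset.mem_range.1 (hS hq.1))).1 e
    exact Prod.ext this.2 this.1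
  rw [← Finset.card_image_of_injOn hinj]
  refine (Finset.card_le_card (t := (Finset.univ.filter fun x : Fin N => (x : ℕ) % n ∈ S).image
    Fin.val) ?_).trans Finset.card_image_le
  intro x hx
  obtain ⟨p, hp, rfl⟩ := Finset.mem_image.1 hx
  simp only [Finset.mem_product, Finset.mem_range] at hp
  have h1 := Finset.mem_range.1 (hS hp.1)
  have h2 : (p.2 + 1) * n ≤ N / n * n := Nat.mul_le_mul_right _ hp.2
  have h3 := Nat.div_mul_le_self N n
  have h4 : (p.2 + 1) * n = p.2 * n + n := by ring
  refine Finset.mem_image.2 ⟨⟨p.2 * n + p.1, by omega⟩, ?_, rfl⟩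
  simp only [Finset.mem_filter, Finset.mem_univ, true_and]
  rw [add_comm, Nat.add_mul_mod_self_right, Nat.mod_eq_of_lt h1]
  exact hp.1

/-- From `n ≤ 2 ^ lg n ≤ exp (lg n)`. -/
theorem inv_pow_ge_exp {n b : ℕ} (hn : 0 < n) :
    Real.exp (-((b : ℝ) * lg n)) ≤ ((n : ℝ)⁻¹) ^ b := by
  have h1 : (n : ℝ) ≤ Real.exp (lg n) := by
    have h2 : (n : ℝ) ≤ 2 ^ lg n := by exact_mod_cast (lt_two_pow_lg n).le
    have h3 : (2 : ℝ) ≤ Real.exp 1 := by have := Real.add_one_le_exp (1 : ℝ); linarith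
    calc (n : ℝ) ≤ 2 ^ lg n := h2
      _ ≤ Real.exp 1 ^ lg n := pow_le_pow_left₀ (by norm_num) h3 _
      _ = Real.exp (lg n) := by rw [← Real.exp_nat_mul, mul_one]
  have h4 : Real.exp (-((b : ℝ) * lg n)) = (Real.exp (lg n))⁻¹ ^ b := by
    rw [← Real.exp_neg, ← Real.exp_nat_mul, mul_neg]
  rw [h4]
  exact pow_le_pow_left₀ (by positivity) (inv_anti₀ (by exact_mod_cast hn) h1) b

/-- The probability that a large set contains no center. -/
theorem prob_disjoint_centers_le {n w b : ℕ} (hn : 0 < n) (hw : n ≤ 2 ^ w) (S : Finset ℕ)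
    (hS : S ⊆ Finset.range n) (hb : 2 * b * sq n ≤ S.card) :
    tapeMeasure w {ω | ∀ v ∈ S, v ∉ centers n ω} ≤ ((n : ENNReal)⁻¹) ^ b := by
  classical
  set bad : Set (Fin (2 ^ w)) := {x | (x : ℕ) % n ∉ S} with hbad
  -- The event constrains each of the first `sq n` words separately, so by independence its
  -- probability is a power.
  have e1 : {ω : ℕ → Fin (2 ^ w) | ∀ v ∈ S, v ∉ centers n ω} =
      Set.pi (Finset.range (sq n) : Finset ℕ) fun _ => bad := by
    ext ω
    simp only [Set.mem_ofPred_eq, Set.mem_pi, Finset.mem_coe, Finset.mem_range, hbad, centers]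
    exact ⟨fun h i hi hS => h _ hS ⟨i, hi, rfl⟩, fun h v hv ⟨i, hi, e⟩ => h i hi (e ▸ hv)⟩
  rw [e1, tapeMeasure, Measure.infinitePi_pi _ fun _ _ => MeasurableSet.of_discrete]
  rw [Finset.prod_const, Finset.card_range,
    PMF.toMeasure_uniformOfFintype_apply _ MeasurableSet.of_discrete, Fintype.card_fin]
  -- Residues of words are not exactly uniform; since `n ≤ 2 ^ w`, each is hit with probability at
  -- least `1 / (2 * n)`, and `1 - x ≤ exp (-x)` applies.
  have hcard : (Fintype.card bad : ℝ) / (2 ^ w : ℕ) ≤ Real.exp (-(S.card / (2 * n))) := by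
    have h1 := card_residues_ge (N := 2 ^ w) S hS
    have h2 : Fintype.card bad + (Finset.univ.filter fun x : Fin (2 ^ w) => (x : ℕ) % n ∈ S).card =
        2 ^ w := by
      have := Finset.card_filter_add_card_filter_not (s := (Finset.univ : Finset (Fin (2 ^ w))))
        (fun x => (x : ℕ) % n ∈ S)
      rw [Finset.card_univ, Fintype.card_fin] at this
      have hbc : Fintype.card bad = (Finset.univ.filter
          fun x : Fin (2 ^ w) => ¬ (x : ℕ) % n ∈ S).card :=
        Fintype.card_of_subtype _ (by simp [hbad])
      rw [hbc, add_comm]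
      exact this
    have h3 : 2 ^ w ≤ 2 * n * (2 ^ w / n) := by
      have h4 := Nat.div_add_mod (2 ^ w) n
      have h5 := Nat.mod_lt (2 ^ w) hn
      have h6 : 1 ≤ 2 ^ w / n := Nat.div_pos hw hn
      nlinarith
    have h4 : S.card * 2 ^ w ≤ 2 * n * (Finset.univ.filter
        fun x : Fin (2 ^ w) => (x : ℕ) % n ∈ S).card := by
      calc S.card * 2 ^ w ≤ S.card * (2 * n * (2 ^ w / n)) := Nat.mul_le_mul_left _ h3
        _ = 2 * n * (S.card * (2 ^ w / n)) := by ring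
        _ ≤ _ := Nat.mul_le_mul_left _ h1
    refine le_trans ?_ (Real.add_one_le_exp _)
    have hpos : (0 : ℝ) < (2 ^ w : ℕ) := by positivity
    have hn' : (0 : ℝ) < n := by exact_mod_cast hn
    have h2' : (Fintype.card bad : ℝ) + (Finset.univ.filter
        fun x : Fin (2 ^ w) => (x : ℕ) % n ∈ S).card = (2 ^ w : ℕ) := by exact_mod_cast h2
    have h4' : (S.card : ℝ) * (2 ^ w : ℕ) ≤ 2 * n * (Finset.univ.filter
        fun x : Fin (2 ^ w) => (x : ℕ) % n ∈ S).card := by exact_mod_cast h4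
    rw [div_le_iff₀ hpos]
    have h5 : (S.card : ℝ) / (2 * n) * (2 ^ w : ℕ) ≤ (Finset.univ.filter
        fun x : Fin (2 ^ w) => (x : ℕ) % n ∈ S).card := by
      rw [div_mul_eq_mul_div, div_le_iff₀ (by positivity)]; linarith
    linarith
  -- The exponent is `sq n * S.card / (2 * n)`, at least `b * sq n ^ 2 / n`, hence at least `b * lg
  -- n`.
  have hpow : ((Fintype.card bad : ℝ) / (2 ^ w : ℕ)) ^ sq n ≤ ((n : ℝ)⁻¹) ^ b := by
    refine (pow_le_pow_left₀ (by positivity) hcard _).trans (le_trans ?_ (inv_pow_ge_exp hn))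
    rw [← Real.exp_nat_mul]
    refine Real.exp_le_exp.2 ?_
    have hn' : (0 : ℝ) < n := by exact_mod_cast hn
    have h1 : ((n : ℝ) * lg n) ≤ sq n * sq n := by exact_mod_cast le_sq_mul_sq hn.ne'
    have h2 : (2 * b * sq n : ℝ) ≤ S.card := by exact_mod_cast hb
    rw [mul_neg, neg_le_neg_iff, mul_div_assoc', le_div_iff₀ (by positivity)]
    have hsq : (0 : ℝ) ≤ sq n := Nat.cast_nonneg _
    have hb0 : (0 : ℝ) ≤ b := Nat.cast_nonneg _
    nlinarith [mul_le_mul_of_nonneg_left h1 hb0, mul_le_mul_of_nonneg_left h2 hsq]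
  have e2 : ((Fintype.card bad : ENNReal) / ((2 ^ w : ℕ) : ENNReal)) =
      ENNReal.ofReal ((Fintype.card bad : ℝ) / (2 ^ w : ℕ)) := by
    rw [ENNReal.ofReal_div_of_pos (by positivity), ENNReal.ofReal_natCast, ENNReal.ofReal_natCast]
  have e3 : (n : ENNReal)⁻¹ = ENNReal.ofReal ((n : ℝ)⁻¹) := by
    rw [ENNReal.ofReal_inv_of_pos (by exact_mod_cast hn), ENNReal.ofReal_natCast]
  rw [e2, e3, ← ENNReal.ofReal_pow (by positivity), ← ENNReal.ofReal_pow (by positivity)]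
  exact ENNReal.ofReal_le_ofReal hpow

/-- If all blocks of length `L` of a set contain elements of `C`, then the set has many elements
of `C`. -/
theorem card_lt_of_blocks {L : ℕ} (hL : 0 < L) (C : Set ℕ) (N : Finset ℕ) (f : ℕ → ℕ)
    (hf : Set.InjOn f (Set.Iio N.card)) (hfN : ∀ i < N.card, f i ∈ N)
    (h : ∀ j < N.card / L, ∃ v ∈ (Finset.Ico (j * L) (j * L + L)).image f, v ∈ C) :
    N.card < ({a | a ∈ N ∧ a ∈ C}.ncard + 1) * L := by
  have hd := Nat.div_add_mod N.card L
  have hm := Nat.mod_lt N.card hL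
  have hlt : ∀ j < N.card / L, j * L + L ≤ N.card := fun j hj => by
    have : (j + 1) * L ≤ N.card / L * L := Nat.mul_le_mul_right _ hj
    have := Nat.div_mul_le_self N.card L
    rw [Nat.succ_mul] at *
    omega
  have h' : ∀ j < N.card / L, ∃ i, j * L ≤ i ∧ i < j * L + L ∧ f i ∈ C := fun j hj => by
    obtain ⟨v, hv, hvC⟩ := h j hj
    obtain ⟨i, hi, rfl⟩ := Finset.mem_image.1 hv
    rw [Finset.mem_Ico] at hi
    exact ⟨i, hi.1, hi.2, hvC⟩
  choose! g hg1 hg2 hg3 using h'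
  have hfin : {a | a ∈ N ∧ a ∈ C}.Finite := N.finite_toSet.subset fun a h => h.1
  -- One center is chosen from each complete block; disjointness of the blocks makes the choices
  -- distinct.
  have hq : N.card / L ≤ {a | a ∈ N ∧ a ∈ C}.ncard := by
    have hinj : Set.InjOn (fun j => f (g j)) (Set.Iio (N.card / L)) := by
      intro i hi j hj e
      rw [Set.mem_Iio] at hi hj
      have h1 := hlt i hi
      have h2 := hlt j hj
      have h3 := hg2 i hi
      have h4 := hg2 j hj
      have e' : g i = g j := hf (show g i < _ by omega) (show g j < _ by omega) e
      have h5 := hg1 i hi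
      have h6 := hg1 j hj
      rcases lt_trichotomy i j with h | h | h
      · have : (i + 1) * L ≤ j * L := Nat.mul_le_mul_right _ h
        rw [Nat.succ_mul] at this; omega
      · exact h
      · have : (j + 1) * L ≤ i * L := Nat.mul_le_mul_right _ h
        rw [Nat.succ_mul] at this; omega
    have := Set.ncard_le_ncard (s := (fun j => f (g j)) '' Set.Iio (N.card / L))
      (t := {a | a ∈ N ∧ a ∈ C}) (by
        rintro _ ⟨j, hj, rfl⟩
        rw [Set.mem_Iio] at hj
        have h1 := hlt j hj
        have h3 := hg2 j hj
        exact ⟨hfN _ (by omega), hg3 j hj⟩) hfin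
    rwa [hinj.ncard_image, Set.ncard_eq_toFinset_card', Set.toFinset_Iio, Nat.card_Iio] at this
  have : N.card / L * L ≤ {a | a ∈ N ∧ a ∈ C}.ncard * L := Nat.mul_le_mul_right _ hq
  rw [Nat.succ_mul]
  rw [mul_comm] at hd
  omega

/-- The probability that a set has too few centers. -/
theorem prob_few_centers_le {n w b : ℕ} (hn : 0 < n) (hb : 0 < b) (hw : n ≤ 2 ^ w) (N : Finset ℕ)
    (hN : N ⊆ Finset.range n) :
    tapeMeasure w {ω | ¬ N.card < ({a | a ∈ N ∧ a ∈ centers n ω}.ncard + 1) * (2 * b * sq n)} ≤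
      n * ((n : ENNReal)⁻¹) ^ b := by
  classical
  have hL : 0 < 2 * b * sq n := Nat.mul_pos (by omega) (Nat.succ_pos _)
  set L := 2 * b * sq n
  -- The enumeration, and with it the division into blocks, is independent of the tape and need not
  -- match the order in which the algorithm stores neighbors.
  obtain ⟨f, hf, hfN⟩ : ∃ f : ℕ → ℕ, Set.InjOn f (Set.Iio N.card) ∧ ∀ i < N.card, f i ∈ N := by
    refine ⟨fun i => if h : i < N.card then N.equivFin.symm ⟨i, h⟩ else 0, ?_, ?_⟩
    · intro i hi j hj e
      rw [Set.mem_Iio] at hi hj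
      simp only [hi, hj, dif_pos] at e
      simpa using N.equivFin.symm.injective (Subtype.ext e)
    · intro i hi
      simp only [hi, dif_pos]
      exact (N.equivFin.symm ⟨i, hi⟩).2
  let S : ℕ → Finset ℕ := fun j => (Finset.Ico (j * L) (j * L + L)).image f
  have hcard : N.card ≤ n := by simpa using Finset.card_le_card hN
  have hsub : {ω : ℕ → Fin (2 ^ w) |
      ¬ N.card < ({a | a ∈ N ∧ a ∈ centers n ω}.ncard + 1) * L} ⊆
      ⋃ j ∈ Finset.range (N.card / L), {ω | ∀ v ∈ S j, v ∉ centers n ω} := by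
    intro ω hω
    by_contra hcon
    refine hω (card_lt_of_blocks hL _ N f hf hfN fun j hj => ?_)
    simp only [Set.mem_iUnion, not_exists, Set.mem_ofPred_eq, Finset.mem_range] at hcon
    have := hcon j hj
    push Not at this
    exact this
  refine (measure_mono hsub).trans ((measure_biUnion_finset_le _ _).trans ?_)
  have hone : ∀ j ∈ Finset.range (N.card / L),
      tapeMeasure w {ω | ∀ v ∈ S j, v ∉ centers n ω} ≤ ((n : ENNReal)⁻¹) ^ b := by
    intro j hj
    rw [Finset.mem_range] at hj
    have h1 : j * L + L ≤ N.card := by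
      have : (j + 1) * L ≤ N.card / L * L := Nat.mul_le_mul_right _ hj
      have := Nat.div_mul_le_self N.card L
      rw [Nat.succ_mul] at *
      omega
    refine prob_disjoint_centers_le hn hw (S j) ?_ ?_
    · intro v hv
      obtain ⟨i, hi, rfl⟩ := Finset.mem_image.1 hv
      rw [Finset.mem_Ico] at hi
      exact hN (hfN i (by omega))
    · rw [Finset.card_image_of_injOn]
      · simp [L]
      · intro i hi k hk e
        simp only [Finset.coe_Ico, Set.mem_Ico] at hi hk
        exact hf (show i < _ by omega) (show k < _ by omega) e
  refine (Finset.sum_le_sum hone).trans ?_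
  rw [Finset.sum_const, Finset.card_range, nsmul_eq_mul]
  gcongr
  exact (Nat.div_le_self _ _).trans hcard

end Probability


/-! ## The main theorem -/

section Bounds

theorem one_le_log {n : ℕ} (hn : 3 ≤ n) : 1 ≤ Real.log n := by
  rw [Real.le_log_iff_exp_le (by positivity)]
  have h1 : Real.exp 1 < 3 := Real.exp_one_lt_three
  have h2 : (3 : ℝ) ≤ n := by exact_mod_cast hn
  linarith

theorem lg_le_log {n : ℕ} (hn : 3 ≤ n) : (lg n : ℝ) ≤ 3 * Real.log n := by
  have h1 := one_le_log hn
  have h2 : (2 : ℝ) ^ Nat.log 2 n ≤ n := by exact_mod_cast Nat.pow_log_le_self 2 (by omega)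
  have h3 := Real.log_le_log (by positivity) h2
  rw [Real.log_pow] at h3
  have h4 := Real.log_two_gt_d9
  have h5 : (0 : ℝ) ≤ Nat.log 2 n := Nat.cast_nonneg _
  rw [lg]
  push_cast
  nlinarith

/-- Squaring reduces this to `sq n ^ 2 ≤ 4 * n * lg n ≤ 12 * n * log n`, below `16 * n * log n`. -/
theorem sq_le_rpow {n : ℕ} (hn : 3 ≤ n) :
    (sq n : ℝ) ≤ 4 * ((n : ℝ) ^ (1 / 2 : ℝ) * Real.log n ^ (1 / 2 : ℝ)) := by
  have h1 := one_le_log hn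
  have h2 : (sq n : ℝ) * sq n ≤ 4 * (n * lg n) := by
    exact_mod_cast sq_mul_sq_le (show n ≠ 0 by omega)
  have h3 := lg_le_log hn
  have hn0 : (0 : ℝ) ≤ n := Nat.cast_nonneg _
  rw [← Real.sqrt_eq_rpow, ← Real.sqrt_eq_rpow]
  refine le_of_sq_le_sq ?_ (by positivity)
  rw [mul_pow, mul_pow, Real.sq_sqrt hn0, Real.sq_sqrt (by linarith)]
  nlinarith [mul_le_mul_of_nonneg_left h3 hn0, mul_nonneg hn0 (by linarith : 0 ≤ Real.log n)]

theorem sq_le_time {n : ℕ} (hn : 3 ≤ n) :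
    (sq n : ℝ) ≤ 4 * ((n : ℝ) ^ (3 / 4 : ℝ) * Real.log n ^ 4) := by
  refine (sq_le_rpow hn).trans ?_
  have h1 := one_le_log hn
  have hn1 : (1 : ℝ) ≤ n := by exact_mod_cast (show 1 ≤ n by omega)
  have h2 : Real.log n ^ (1 / 2 : ℝ) ≤ Real.log n ^ 4 := by
    rw [← Real.rpow_natCast]
    exact Real.rpow_le_rpow_of_exponent_le h1 (by norm_num)
  exact mul_le_mul_of_nonneg_left (mul_le_mul
    (Real.rpow_le_rpow_of_exponent_le hn1 (by norm_num)) h2 (by positivity) (by positivity))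
    (by norm_num)

theorem log_log_three_pos : 0 < Real.log (Real.log 3) := by
  refine Real.log_pos ?_
  rw [Real.lt_log_iff_exp_lt (by norm_num)]
  exact Real.exp_one_lt_three

theorem log_log_three_le {n : ℕ} (hn : 3 ≤ n) :
    Real.log (Real.log 3) ≤ Real.log (Real.log n) := by
  have h3 : (3 : ℝ) ≤ n := by exact_mod_cast hn
  have h1 : 1 ≤ Real.log (3 : ℕ) := one_le_log le_rfl
  refine Real.log_le_log (by push_cast at h1; linarith) (Real.log_le_log (by norm_num) h3)

/-- The factor `log log n` is slack: for `n ≥ 3` it is at least the positive number `log log 3`,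
which `D` scales up to `1`. -/
theorem mul_sq_le_size {n D : ℕ} (hn : 3 ≤ n) (hD : 1 ≤ D * Real.log (Real.log 3)) :
    (n : ℝ) * sq n ≤ 4 * D *
      ((n : ℝ) ^ (1 + 1 / 2 : ℝ) * Real.log n ^ (1 / 2 : ℝ) * Real.log (Real.log n)) := by
  have h1 := sq_le_rpow hn
  have h2 : 1 ≤ D * Real.log (Real.log n) :=
    hD.trans (mul_le_mul_of_nonneg_left (log_log_three_le hn) (Nat.cast_nonneg _))
  have hn0 : (0 : ℝ) < n := by exact_mod_cast (show 0 < n by omega)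
  have hl := one_le_log hn
  rw [Real.rpow_add hn0, Real.rpow_one]
  set x := (n : ℝ) ^ (1 / 2 : ℝ) * Real.log n ^ (1 / 2 : ℝ) with hx
  have hx0 : 0 ≤ x := by positivity
  calc (n : ℝ) * sq n ≤ n * (4 * x) := by gcongr
    _ ≤ n * (4 * x) * (D * Real.log (Real.log n)) := le_mul_of_one_le_right (by positivity) h2
    _ = _ := by rw [hx]; ring

end Bounds

/-- The neighbors of a node, as a set of numbers. -/
noncomputable def nbrs {n : ℕ} (G : SimpleGraph (Fin n)) (v : ℕ) : Finset ℕ :=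
  open Classical in (Finset.range n).filter fun a => natAdj G a v

theorem mem_nbrs {n : ℕ} {G : SimpleGraph (Fin n)} {v a : ℕ} : a ∈ nbrs G v ↔ natAdj G a v := by
  classical
  simp only [nbrs, Finset.mem_filter, Finset.mem_range, and_iff_right_iff_imp]
  exact fun h => h.1

/-- The number of failures is bounded by the probability of hitting neighborhoods badly. -/
theorem prob_fails_le {n b a : ℕ} (hn : 3 ≤ n) (hb : 2 * a + 3 ≤ b) {S : ℝ}
    (hS : ((n * ((2 + 2 * b) * sq n) : ℕ) : ℝ) ≤ S) :
    MaintainsSpannerWHP (spannerAlg (2 * b)) (2 * b + 10) n 3 S (n ^ a) a := by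
  intro σ τ hστ hτ
  have hf := fits_wordLength (K := 2 * b) hn (by omega)
  have hw : n ≤ 2 ^ wordLength (2 * b + 10) n := by have := hf.large; omega
  -- The neighborhoods depend only on the fixed update sequence. A failure at any time of the window
  -- lies in one of `(n ^ a + 1) * n` such events.
  set bad : ℕ → ℕ → Set (ℕ → Fin (2 ^ wordLength (2 * b + 10) n)) := fun k v =>
    {ω | ¬ (nbrs (graphAfter (σ ++ τ.take k)) v).card <
      ({a | a ∈ nbrs (graphAfter (σ ++ τ.take k)) v ∧ a ∈ centers n ω}.ncard + 1) *
        (2 * b * sq n)} with hbad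
  have hsub : {ω | ∃ τ' : List (Update n), τ' <+: τ ∧
      FailsAfter (spannerAlg (2 * b)) (2 * b + 10) n 3 S ω (σ ++ τ')} ⊆
      ⋃ k ∈ Finset.range (n ^ a + 1), ⋃ v ∈ Finset.range n, bad k v := by
    rintro ω ⟨τ', hpre, s, hs, hfail⟩
    by_contra hcon
    simp only [Set.mem_iUnion, not_exists, Finset.mem_range] at hcon
    have hlen := hpre.length_le
    have htake : τ.take τ'.length = τ' := (List.prefix_iff_eq_take.1 hpre).symm
    have hlegal : LegalSeq (σ ++ τ') := by
      obtain ⟨t, rfl⟩ := hpre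
      rw [← List.append_assoc] at hστ
      exact legalSeq_of_append hστ
    have H := hs.graphInv hn (by omega) hlegal
    refine hfail ⟨H.isSpanner, ?_⟩
    have hcov : Covered n (2 * b * sq n) (centers n ω) (natAdj (graphAfter (σ ++ τ'))) := by
      intro v hv
      have := hcon τ'.length (by omega) v hv
      simp only [hbad, Set.mem_ofPred_eq, not_not, htake] at this
      rw [← Set.ncard_coe_finset] at this
      have e : ((nbrs (graphAfter (σ ++ τ')) v : Finset ℕ) : Set ℕ) =
          {a | natAdj (graphAfter (σ ++ τ')) a v} := by ext; simp [mem_nbrs]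
      rw [e] at this
      simpa only [mem_nbrs] using this
    have hcard := H.ncard_edgeSet_le
      (A := (Finset.range (sq n)).image fun i => (ω i : ℕ) % n)
      (by ext v; simp [centers]) hcov
    refine le_trans ?_ hS
    have hA : ((Finset.range (sq n)).image fun i => (ω i : ℕ) % n).card ≤ sq n :=
      Finset.card_image_le.trans (by simp)
    have : (s.outputGraph n).edgeSet.ncard ≤ n * ((2 + 2 * b) * sq n) :=
      hcard.trans (Nat.mul_le_mul_left _ (by nlinarith))
    exact_mod_cast this
  have hn0 : (n : ENNReal) ≠ 0 := by simp; omega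
  have hone : ∀ k v, tapeMeasure (wordLength (2 * b + 10) n) (bad k v) ≤
      n * ((n : ENNReal)⁻¹) ^ b := fun k v =>
    prob_few_centers_le (by omega) (by omega) hw _ fun a ha => by
      obtain ⟨h, _⟩ := mem_nbrs.1 ha
      exact Finset.mem_range.2 h
  calc tapeMeasure (wordLength (2 * b + 10) n) _
      ≤ ∑ k ∈ Finset.range (n ^ a + 1), ∑ v ∈ Finset.range n,
          tapeMeasure (wordLength (2 * b + 10) n) (bad k v) :=
        (measure_mono hsub).trans ((measure_biUnion_finset_le _ _).trans
          (Finset.sum_le_sum fun k _ => measure_biUnion_finset_le _ _))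
    _ ≤ ∑ k ∈ Finset.range (n ^ a + 1), ∑ v ∈ Finset.range n, n * ((n : ENNReal)⁻¹) ^ b :=
        Finset.sum_le_sum fun k _ => Finset.sum_le_sum fun v _ => hone k v
    _ = (((n ^ a + 1) * n * n : ℕ) : ENNReal) * ((n : ENNReal)⁻¹) ^ b := by
        simp only [Finset.sum_const, Finset.card_range, nsmul_eq_mul]
        push_cast; ring
    -- Times, nodes and blocks contribute at most `n ^ (a + 3)` events, so the exponent `2 * a + 3`
    -- leaves `n⁻ᵃ`.
    _ ≤ ((n ^ (a + 3) : ℕ) : ENNReal) * ((n : ENNReal)⁻¹) ^ (2 * a + 3) := by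
        have h1 : (n ^ a + 1) * n * n ≤ n ^ (a + 3) := by
          have : 1 ≤ n ^ a := Nat.one_le_pow _ _ (by omega)
          calc (n ^ a + 1) * n * n ≤ (n ^ a * n) * n * n := by
                gcongr; nlinarith
            _ = n ^ (a + 3) := by ring
        have h2 : (n : ENNReal)⁻¹ ≤ 1 := by
          rw [ENNReal.inv_le_one]; exact_mod_cast (show 1 ≤ n by omega)
        exact mul_le_mul' (by exact_mod_cast h1) (pow_le_pow_right_of_le_one' h2 hb)
    _ = ((n : ENNReal) ^ a)⁻¹ := by
        have : 2 * a + 3 = (a + 3) + a := by ring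
        rw [this, pow_add ((n : ENNReal)⁻¹) (a + 3) a, ← mul_assoc, Nat.cast_pow, ← mul_pow,
          ENNReal.mul_inv_cancel hn0 (ENNReal.natCast_ne_top n), one_pow, one_mul, ENNReal.inv_pow]

end DynSpanner

theorem mainTheorem1 (a : ℕ) :
    ∃ (A : DynSpanner.DynAlg) (c C : ℕ), 1 ≤ c ∧ ∀ n : ℕ, 3 ≤ n →
      DynSpanner.SetupTimeAtMost A c n (C * (n : ℝ) ^ 2) ∧
      DynSpanner.UpdateTimeAtMost A c n
        (C * ((n : ℝ) ^ (3 / 4 : ℝ) * Real.log n ^ 4)) ∧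
      DynSpanner.MaintainsSpannerWHP A c n 3
        (C * ((n : ℝ) ^ (1 + 1 / 2 : ℝ) * Real.log n ^ (1 / 2 : ℝ) * Real.log (Real.log n)))
        (n ^ a) a := by
  obtain ⟨D, hD⟩ : ∃ D : ℕ, 1 ≤ D * Real.log (Real.log 3) := by
    obtain ⟨D, hD⟩ := exists_nat_ge (1 / Real.log (Real.log 3))
    exact ⟨D, (div_le_iff₀ DynSpanner.log_log_three_pos).1 hD⟩
  set b := 2 * a + 3
  -- Only the existence of these constants matters; naming them keeps the numerals opaque. The
  -- constant `C` below is the sum of what setup time, update time and size require.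
  obtain ⟨cs, hcs⟩ : ∃ cs, (DynSpanner.setupStm (2 * b)).cost 1 = cs := ⟨_, rfl⟩
  obtain ⟨cu, hcu⟩ : ∃ cu, DynSpanner.updateStm.cost 1 = cu := ⟨_, rfl⟩
  refine ⟨DynSpanner.spannerAlg (2 * b), 2 * b + 10,
    2 * cs + cu * (2 * b + 1) * 4 + (2 + 2 * b) * (4 * D), by omega, fun n hn =>
    ⟨fun ω => ?_, fun ω σ e hσ s hs => ?_, ?_⟩⟩
  · obtain ⟨s, t, hex, ht⟩ := DynSpanner.setupTime_le (K := 2 * b) ω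
    refine ⟨s, t, hex, ?_⟩
    rw [hcs] at ht
    have h : t ≤ (2 * cs + cu * (2 * b + 1) * 4 + (2 + 2 * b) * (4 * D)) * n ^ 2 := by
      calc t ≤ cs * (n + 1) := ht
        _ ≤ cs * (2 * n ^ 2) := Nat.mul_le_mul_left _ (by nlinarith)
        _ = 2 * cs * n ^ 2 := by ring
        _ ≤ _ := Nat.mul_le_mul_right _ (by rw [add_assoc]; exact Nat.le_add_right _ _)
    exact_mod_cast h
  · obtain ⟨s', t, hex, ht⟩ := DynSpanner.updateTime_le hn (show 0 < 2 * b by omega) hs e hσ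
    refine ⟨s', t, hex, ?_⟩
    rw [hcu] at ht
    have h1 : t ≤ cu * ((2 * b + 1) * DynSpanner.sq n) := by
      have : 1 ≤ DynSpanner.sq n := Nat.succ_pos _
      exact ht.trans (Nat.mul_le_mul_left _ (by nlinarith))
    have hx := DynSpanner.sq_le_time hn
    have hlog := DynSpanner.one_le_log hn
    set x := (n : ℝ) ^ (3 / 4 : ℝ) * Real.log n ^ 4
    have hx0 : 0 ≤ x := by positivity
    calc (t : ℝ) ≤ cu * ((2 * b + 1) * DynSpanner.sq n) := by exact_mod_cast h1
      _ ≤ cu * ((2 * b + 1) * (4 * x)) := by gcongr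
      _ = (cu * (2 * b + 1) * 4) * x := by ring
      _ ≤ _ := by
        refine mul_le_mul_of_nonneg_right ?_ hx0
        push_cast
        have h2 : (0 : ℝ) ≤ 2 * cs := by positivity
        have h3 : (0 : ℝ) ≤ (2 + 2 * b) * (4 * D) := by positivity
        linarith
  · refine DynSpanner.prob_fails_le hn le_rfl ?_
    have hx := DynSpanner.mul_sq_le_size hn hD
    have hlog := DynSpanner.one_le_log hn
    have hlog2 := DynSpanner.log_log_three_pos.le.trans (DynSpanner.log_log_three_le hn)
    set x := (n : ℝ) ^ (1 + 1 / 2 : ℝ) * Real.log n ^ (1 / 2 : ℝ) * Real.log (Real.log n)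
    have hx0 : 0 ≤ x := by positivity
    calc ((n * ((2 + 2 * b) * DynSpanner.sq n) : ℕ) : ℝ)
        = (2 + 2 * b) * ((n : ℝ) * DynSpanner.sq n) := by push_cast; ring
      _ ≤ (2 + 2 * b) * (4 * D * x) := by gcongr
      _ = ((2 + 2 * b) * (4 * D)) * x := by ring
      _ ≤ _ := by
        refine mul_le_mul_of_nonneg_right ?_ hx0
        push_cast
        have h2 : (0 : ℝ) ≤ 2 * cs := by positivity
        have h3 : (0 : ℝ) ≤ cu * (2 * b + 1) * 4 := by positivity
        linarith
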